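/- Let $n\ge 1$. For $\sigma:\mathbf R^n\times\mathbf R^n\to\mathbf C$ put $$T_\sigma f(x)=\int_{\mathbf R^n}\sigma(x,\xi)e^{2\pi i\xi\cdot x}\hat f(\xi)\,d\xi ,\qquad \hat f(\xi)=\int_{\mathbf R^n} f(x)e^{-2\pi i x\cdot\xi}\,dx ,$$ for Schwartz functions $f$; "$\|T_\sigma\|_{L^p\to L^p}\le K$" means that, for every Schwartz $f$, the integral converges absolutely for every $x$, $T_\sigma f\in L^p(\mathbf R^n)$ and $\|T_\sigma f\|_{L^p}\le K\|f\|_{L^p}$. A cutoff on a normed space is a nonnegative smooth even function $\chi$ with $\chi(\xi)=1$ for $|\xi|\le 1$ and $\chi(\xi)=0$ for $|\xi|>2$; put $\varphi(\xi)=\chi(\xi)-\chi(2\xi)$. *Symbols on $\mathbf R^n$.* Fix a cutoff $\chi$ on $\mathbf R^n$ and let $P_l g(\xi)=2^{ln}\int\hat\varphi(2^l(\xi-\eta))g(\eta)\,d\eta$, $l\in\mathbf Z$, be the Littlewood–Paley operators; $P_l^\xi$ denotes $P_l$ acting in $\xi$. Put $$A(\sigma)=\sum_{l\in\mathbf Z}2^{ln/2}\sup_x\|P_l^\xi\sigma(x,\cdot)\|_{L^2(\mathbf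 R^n)},\qquad B(\sigma)=\sum_{l\in\mathbf Z}2^{ln}\sup_x\|P_l^\xi\sigma(x,\cdot)\|_{L^1(\mathbf R^n)} .$$ All symbols $\sigma,\sigma_1,\sigma_2$ are measurable on $\mathbf R^n\times\mathbf R^n$ and, for each $x$, vanish as $|\xi|\to\infty$ in the averaged sense that $\int_{\{\xi:|\sigma(x,\xi)|\ge\varepsilon\}}|\sigma(x,\xi)|\,d\xi<\infty$ for every $\varepsilon>0$ (for instance $\sigma(x,\cdot)\in L^q$ with $1\le q<\infty$, or $\sigma(x,\cdot)\in C_0$). Then there is $C>0$, depending only on $n$ and $\chi$, such that 1. if $A(\sigma_1),A(\sigma_2)<\infty$, then $\|T_{\sigma_1\sigma_2}\|_{L^2\to L^2}\le C\,A(\sigma_1)A(\sigma_2)$; 2. if $B(\sigma_1),B(\sigma_2)<\infty$, then $\|T_{\sigma_1\sigma_2}\|_{L^p\to L^p}\le C\,B(\sigma_1)B(\sigma_2)$ for all $1<p<\infty$; 3. if $A(\sigma)<\infty$, then $\|T_{e^\sigma}\|_{L^2\to L^2}\le C\exp(C A(\sigma))$; if $B(\sigma)<\infty$, then $\|T_{e^\sigma}\|_{L^p\to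 L^p}\le C\exp(C B(\sigma))$ for all $1<p<\infty$. *Symbols homogeneous of degree zero.* For $\mu:\mathbf R^n\times\mathbf S^{n-1}\to\mathbf C$ let $T_\mu$ be the operator with symbol $\mu(x,\xi/|\xi|)$. Fix a cutoff $\chi$ on $\mathbf R$, and for integrable $g$ on $\mathbf S^{n-1}$ (with surface measure) let $g_k$ be its component in the spherical harmonics of degree $k$ and $P_m g=\sum_{k\ge0}\varphi(2^{-m}k)g_k$, $m\in\mathbf Z$. Write $\mu_0(x,\cdot)$ for the degree $0$ component (the mean) of $\mu(x,\cdot)$, and put $$A'(\mu)=\sup_x\|\mu_0(x,\cdot)\|_{L^2(\mathbf S^{n-1})}+\sum_{m\in\mathbf Z}2^{m(n-1)/2}\sup_x\|P_m\mu(x,\cdot)\|_{L^2(\mathbf S^{n-1})},$$ $$B'(\mu)=\sup_x\|\mu_0(x,\cdot)\|_{L^1(\mathbf S^{n-1})}+\sum_{m\in\mathbf Z}2^{m(n-1)}\sup_x\|P_m\mu(x,\cdot)\|_{L^1(\mathbf S^{n-1})}.$$ All $\mu,\mu_1,\mu_2$ are measurable, with $\mu(x,\cdot)$ etc. integrable on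 $\mathbf S^{n-1}$ for each $x$. Then there is $C>0$, depending only on $n$ and $\chi$, such that 4. if $A'(\mu_1),A'(\mu_2)<\infty$, then $\|T_{\mu_1\mu_2}\|_{L^2\to L^2}\le C\,A'(\mu_1)A'(\mu_2)$; 5. if $A'(\mu)<\infty$, then $\|T_{e^\mu}\|_{L^2\to L^2}\le C\exp(C A'(\mu))$; if $B'(\mu)<\infty$, then $\|T_{e^\mu}\|_{L^2\to L^2}\le C\exp(C B'(\mu))$. -/

import Mathlib

open MeasureTheory FourierTransform
open scoped ENNReal ContDiff

noncomputable section

/-- Euclidean space `ℝⁿ`. -/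
abbrev Eucl (n : ℕ) : Type := EuclideanSpace ℝ (Fin n)

/-- The unit sphere `S^{n-1}` of `ℝⁿ`. -/
abbrev USphere (n : ℕ) : Type := Metric.sphere (0 : Eucl n) 1

/-- The surface measure on `S^{n-1}`. -/
abbrev surfaceMeasure (n : ℕ) : Measure (USphere n) :=
  (volume : Measure (Eucl n)).toSphere

/-- A nonnegative smooth even function, equal to `1` on the closed unit ball and supported in the
closed ball of radius `2`. -/
structure IsLPCutoff {E : Type*} [NormedAddCommGroup E] [NormedSpace ℝ E] (χ : E → ℝ) : Prop where
  smooth : ContDiff ℝ ∞ χ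
  nonneg : ∀ ξ, 0 ≤ χ ξ
  even : ∀ ξ, χ (-ξ) = χ ξ
  eq_one : ∀ ξ, ‖ξ‖ ≤ 1 → χ ξ = 1
  eq_zero : ∀ ξ, 2 < ‖ξ‖ → χ ξ = 0

/-- `φ(ξ) = χ(ξ) - χ(2ξ)`. -/
def lpBump {E : Type*} [AddCommGroup E] [Module ℝ E] (χ : E → ℝ) (ξ : E) : ℝ :=
  χ ξ - χ ((2 : ℝ) • ξ)

/-! ### Pseudodifferential operators -/

/-- The integrand of `T_σ f (x) = ∫ σ(x,ξ) e^{2π i ξ·x} f̂(ξ) dξ`. -/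
def pdoIntegrand {n : ℕ} (σ : Eucl n → Eucl n → ℂ) (f : SchwartzMap (Eucl n) ℂ)
    (x ξ : Eucl n) : ℂ :=
  σ x ξ * Complex.exp (2 * Real.pi * Complex.I * (inner ℝ ξ x : ℝ)) * 𝓕 (f : Eucl n → ℂ) ξ

/-- The pseudodifferential operator `T_σ`, on Schwartz functions. -/
def pdo {n : ℕ} (σ : Eucl n → Eucl n → ℂ) (f : SchwartzMap (Eucl n) ℂ) (x : Eucl n) : ℂ :=
  ∫ ξ, pdoIntegrand σ f x ξ

/-- `T_σ` is well defined on Schwartz functions and `‖T_σ‖_{L^p → L^p} ≤ K`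
(for `1 ≤ p < ∞` the Schwartz functions are dense in `L^p`). -/
def PdoNormLE {n : ℕ} (σ : Eucl n → Eucl n → ℂ) (p K : ℝ≥0∞) : Prop :=
  ∀ f : SchwartzMap (Eucl n) ℂ,
    (∀ x, Integrable (pdoIntegrand σ f x) volume) ∧
    MemLp (pdo σ f) p volume ∧
    eLpNorm (pdo σ f) p volume ≤ K * eLpNorm (f : Eucl n → ℂ) p volume

/-! ### Symbols on `ℝⁿ × ℝⁿ` -/

/-- `σ` is measurable, and for each `x` the function `σ(x,·)` vanishes at infinity in the averaged
sense that `∫_{|σ(x,ξ)| ≥ ε} |σ(x,ξ)| dξ < ∞` for every `ε > 0`.  (This holds for continuous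
functions tending to `0` at infinity and for all functions in `L^q`, `1 ≤ q < ∞`; it excludes
the nonzero polynomials, which the operators `P_l` annihilate.) -/
structure IsSymbol {n : ℕ} (σ : Eucl n → Eucl n → ℂ) : Prop where
  measurable : Measurable (Function.uncurry σ)
  vanishing : ∀ x, ∀ ε : ℝ, 0 < ε → IntegrableOn (σ x) {ξ | ε ≤ ‖σ x ξ‖} volume

/-- The Littlewood–Paley operator
`P_l g (ξ) = 2^{ln} ∫ φ̂(2^l (ξ - η)) g(η) dη`. -/
def lpProj {n : ℕ} (χ : Eucl n → ℝ) (l : ℤ) (g : Eucl n → ℂ) (ξ : Eucl n) : ℂ :=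
  ((2 : ℂ) ^ (l * (n : ℤ))) *
    ∫ η, 𝓕 (fun ζ : Eucl n => (lpBump χ ζ : ℂ)) ((2 : ℝ) ^ l • (ξ - η)) * g η

/-- `∑_{l ∈ ℤ} 2^{ls} sup_x ‖P_l^ξ σ(x,·)‖_{L^p(ℝⁿ)}`. -/
def symbolBesov {n : ℕ} (χ : Eucl n → ℝ) (s : ℝ) (p : ℝ≥0∞) (σ : Eucl n → Eucl n → ℂ) : ℝ≥0∞ :=
  ∑' l : ℤ, ENNReal.ofReal ((2 : ℝ) ^ ((l : ℝ) * s)) *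
    ⨆ x, eLpNorm (lpProj χ l (σ x)) p volume

/-! ### Spherical harmonics and symbols homogeneous of degree zero -/

/-- The Laplacian on polynomials. -/
def polyLaplacian (n : ℕ) : MvPolynomial (Fin n) ℂ →ₗ[ℂ] MvPolynomial (Fin n) ℂ :=
  ∑ i, (MvPolynomial.pderiv i).toLinearMap ∘ₗ (MvPolynomial.pderiv i).toLinearMap

/-- The harmonic homogeneous polynomials of degree `k`. -/
def harmonicPoly (n k : ℕ) : Submodule ℂ (MvPolynomial (Fin n) ℂ) :=
  MvPolynomial.homogeneousSubmodule (Fin n) ℂ k ⊓ LinearMap.ker (polyLaplacian n)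

/-- Restriction of a polynomial to the sphere. -/
def restrictSphere (n : ℕ) : MvPolynomial (Fin n) ℂ →ₗ[ℂ] C(USphere n, ℂ) where
  toFun p := ⟨fun θ => MvPolynomial.eval (fun i => ((θ : Eucl n) i : ℂ)) p, by
    refine (MvPolynomial.continuous_eval p).comp ?_
    fun_prop⟩
  map_add' p q := by ext θ; simp
  map_smul' c p := by ext θ; simp

/-- The spherical harmonics of degree `k`, as a subspace of `L²(S^{n-1})`. -/
def sphericalHarmonics (n k : ℕ) : Submodule ℂ (Lp ℂ 2 (surfaceMeasure n)) :=
  (harmonicPoly n k).map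
    ((ContinuousMap.toLp (E := ℂ) 2 (surfaceMeasure n) ℂ).toLinearMap ∘ₗ restrictSphere n)

instance sphericalHarmonics_finite (n k : ℕ) : FiniteDimensional ℂ (sphericalHarmonics n k) := by
  have h : FiniteDimensional ℂ (MvPolynomial.homogeneousSubmodule (Fin n) ℂ k) :=
    Module.Finite.iff_fg.2 (MvPolynomial.homogeneousSubmodule_fg (R := ℂ) (σ := Fin n) k)
  have h' : FiniteDimensional ℂ (harmonicPoly n k) :=
    Submodule.finiteDimensional_of_le inf_le_left
  exact Module.Finite.map _ _

/-- The component of degree `k` in the spherical harmonics expansion of an integrable `g`: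
`∑_j ⟨g, Y_{k,j}⟩ Y_{k,j}` for an orthonormal basis `Y_{k,j}` of the spherical harmonics of
degree `k`. -/
def harmonicComponent {n : ℕ} (k : ℕ) (g : USphere n → ℂ) (θ : USphere n) : ℂ :=
  ∑ j, (∫ η, g η * (starRingEnd ℂ)
      ((stdOrthonormalBasis ℂ (sphericalHarmonics n k) j : Lp ℂ 2 (surfaceMeasure n)) η)
        ∂(surfaceMeasure n)) *
    (stdOrthonormalBasis ℂ (sphericalHarmonics n k) j : Lp ℂ 2 (surfaceMeasure n)) θ

/-- The spherical Littlewood–Paley operator `P_m g = ∑_k φ(2^{-m} k) g_k`, where `g_k` is the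
component of degree `k` (only finitely many terms are nonzero). -/
def sphereLpProj {n : ℕ} (χ : ℝ → ℝ) (m : ℤ) (g : USphere n → ℂ) (θ : USphere n) : ℂ :=
  ∑' k : ℕ, (lpBump χ ((2 : ℝ) ^ (-m) * (k : ℝ)) : ℂ) * harmonicComponent k g θ

/-- `sup_x ‖μ_0(x,·)‖_{L^p} + ∑_{m ∈ ℤ} 2^{ms} sup_x ‖P_m μ(x,·)‖_{L^p}` on `S^{n-1}`, where
`μ_0(x,·)` is the component of degree `0` of `μ(x,·)` (its mean), which all `P_m` annihilate. -/
def sphereBesov {n : ℕ} (χ : ℝ → ℝ) (s : ℝ) (p : ℝ≥0∞) (μ : Eucl n → USphere n → ℂ) : ℝ≥0∞ :=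
  (⨆ x, eLpNorm (harmonicComponent 0 (μ x)) p (surfaceMeasure n)) +
  ∑' m : ℤ, ENNReal.ofReal ((2 : ℝ) ^ ((m : ℝ) * s)) *
    ⨆ x, eLpNorm (sphereLpProj χ m (μ x)) p (surfaceMeasure n)

/-- `μ : ℝⁿ × S^{n-1} → ℂ` is measurable, with `μ(x,·)` integrable for every `x`. -/
structure IsSphereSymbol {n : ℕ} (μ : Eucl n → USphere n → ℂ) : Prop where
  measurable : Measurable (Function.uncurry μ)
  integrable : ∀ x, Integrable (μ x) (surfaceMeasure n)

open Classical in
/-- The symbol `(x, ξ) ↦ μ(x, ξ/|ξ|)`, homogeneous of degree zero (with value `0` at `ξ = 0`). -/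
def homogeneousSymbol {n : ℕ} (μ : Eucl n → USphere n → ℂ) (x ξ : Eucl n) : ℂ :=
  if h : ξ = 0 then 0
  else μ x ⟨‖ξ‖⁻¹ • ξ, by
    have : ‖ξ‖ ≠ 0 := norm_ne_zero_iff.2 h
    simp [norm_smul, this]⟩

end

noncomputable section

open scoped NNReal

/-! ### Minkowski's inequality for countable sums -/

/-! The proof rests on a domination principle for frequency-localized symbols. Suppose that `g` is
the Fourier transform of a kernel `k` supported in the ball of radius `2^l`. Then `T_g f(x) = ∫ k(y)
f(x - y) dy`, and Parseval gives `|T_g f(x)| ≤ C 2^{ln/q} ‖g‖_q M_l f(x)` for `q = 1, 2`, where `M_l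
f` is an `L^p` average of `f` over the ball of radius `2^{l+1}` and `‖M_l f‖_p ≤ ‖f‖_p`. Since `M_l
f` does not depend on `g`, the symbol `g` may change with `x`, so an `x`-dependent symbol localized
at `2^l` costs only `sup_x 2^{ln/q} ‖σ(x,·)‖_q` (`bandLimited_scale`).

These weighted norms behave well under products. If `g` lives at level `l` and `h` at level `m ≤ l`,
then `gh` lives at level `l + 1`. The Bernstein inequality bounds `h` in sup norm by its own
weighted norm, so the weighted norm of `gh` is at most a constant times the product of the two
(`mul_aux`). The double series of a product of two Littlewood–Paley expansions therefore converges
absolutely, with no condition relating the levels (`decomp_mul`). Iteration bounds the `j`-th power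
by `C^j S^j`, and the exponential series gives `exp(C S)` (`decomp_exp_dominated`).

The structure `SymbolScale` isolates what this argument needs: nested levels, products, Bernstein
and a dominant that is uniform in the symbol. On the sphere the level `l` consists of the
polynomials of degree at most `2^l`. This space is rotation invariant, so an orthonormal basis `e_i`
has constant `∑ |e_i|²`, equal to the dimension over the total measure, hence `O(2^{l(n-1)})`
(`exists_frame_of_invariant`). Writing `g = ∑ c_i e_i`, Cauchy–Schwarz bounds `|T_g f(x)|` by `‖g‖_2
(∑ |T_{e_i} f(x)|²)^{1/2}`, and Plancherel bounds the square function in `L²`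
(`sphereLevel_dominated`). The `L¹` quantity on the sphere reduces to the `L²` one by the Nikolskii
inequality.

It remains to see that symbols are the sums of their pieces. On `ℝⁿ` the averaged vanishing kills
the low-frequency limit (`ae_hasSum_lpProj`). On the sphere this follows from orthogonality and
completeness of the harmonics (`ae_hasSum_spherePiece`). -/

theorem eLpNorm_tsum_le_tsum_eLpNorm {α ι : Type*} [Countable ι] {m : MeasurableSpace α}
    {ρ : Measure α} {p : ℝ≥0∞} (hp : 1 ≤ p) (hp' : p ≠ ⊤) {F : ι → α → ℝ≥0∞}
    (hF : ∀ i, AEMeasurable (F i) ρ) :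
    eLpNorm (fun x => ∑' i, F i x) p ρ ≤ ∑' i, eLpNorm (F i) p ρ := by
  have hp0 : p ≠ 0 := (zero_lt_one.trans_le hp).ne'
  have hpos : 0 < p.toReal := ENNReal.toReal_pos hp0 hp'
  have key : ∀ s : Finset ι, eLpNorm (fun x => ∑ i ∈ s, F i x) p ρ ≤ ∑' i, eLpNorm (F i) p ρ := by
    intro s
    have h1 : eLpNorm (∑ i ∈ s, F i) p ρ ≤ ∑ i ∈ s, eLpNorm (F i) p ρ := by
      classical
      induction s using Finset.induction_on with
      | empty => simp
      | insert a s ha ih =>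
        rw [Finset.sum_insert ha, Finset.sum_insert ha]
        refine (eLpNorm_add_le (hF a).aestronglyMeasurable ?_ hp).trans (by gcongr)
        exact (Finset.aemeasurable_sum s fun i _ => hF i).aestronglyMeasurable
    have h2 : (∑ i ∈ s, F i) = fun x => ∑ i ∈ s, F i x := by
      ext x; simp
    rw [← h2]
    exact h1.trans (ENNReal.sum_le_tsum s)
  rw [eLpNorm_eq_lintegral_rpow_enorm_toReal hp0 hp', one_div, ENNReal.rpow_inv_le_iff hpos]
  -- `t ↦ t^p` is an order isomorphism, so it commutes with the supremum of the finite partial sums;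
  -- monotone convergence along this directed family then applies.
  have hsup : ∀ x, ‖∑' i, F i x‖ₑ ^ p.toReal = ⨆ s : Finset ι, (∑ i ∈ s, F i x) ^ p.toReal := by
    intro x
    rw [enorm_eq_self, ENNReal.tsum_eq_iSup_sum]
    exact (ENNReal.orderIsoRpow p.toReal hpos).map_iSup _
  simp_rw [hsup]
  rw [lintegral_iSup_directed]
  · refine iSup_le fun s => ?_
    have := key s
    rw [eLpNorm_eq_lintegral_rpow_enorm_toReal hp0 hp', one_div, ENNReal.rpow_inv_le_iff hpos] at this
    simpa using this
  · intro s
    exact (Finset.aemeasurable_fun_sum s fun i _ => hF i).pow_const _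
  · intro s t
    classical
    refine ⟨s ∪ t, fun x => ?_, fun x => ?_⟩
    · exact ENNReal.rpow_le_rpow (Finset.sum_le_sum_of_subset Finset.subset_union_left) hpos.le
    · exact ENNReal.rpow_le_rpow (Finset.sum_le_sum_of_subset Finset.subset_union_right) hpos.le

theorem eLpNorm_const_mul_le_of_ne_top {α : Type*} {m : MeasurableSpace α} {ρ : Measure α}
    {p c : ℝ≥0∞} (hc : c ≠ ⊤) (hp : 1 ≤ p) (hp' : p ≠ ⊤) (M : α → ℝ≥0∞) :
    eLpNorm (fun x => c * M x) p ρ ≤ c * eLpNorm M p ρ := by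
  have hp0 : p ≠ 0 := (zero_lt_one.trans_le hp).ne'
  have hpos : 0 < p.toReal := ENNReal.toReal_pos hp0 hp'
  rw [eLpNorm_eq_lintegral_rpow_enorm_toReal hp0 hp',
    eLpNorm_eq_lintegral_rpow_enorm_toReal hp0 hp']
  simp only [enorm_eq_self]
  simp_rw [ENNReal.mul_rpow_of_nonneg _ _ hpos.le]
  rw [lintegral_const_mul' _ _ (ENNReal.rpow_ne_top_of_nonneg hpos.le hc),
    ENNReal.mul_rpow_of_nonneg _ _ (by positivity),
    ← ENNReal.rpow_mul, mul_one_div_cancel hpos.ne', ENNReal.rpow_one]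

/-! ### Pointwise domination of pseudodifferential operators -/

/-- `T_σ f` is given by absolutely convergent integrals and is dominated pointwise by a measurable
function whose `L^p` norm is at most `K ‖f‖_{L^p}`. -/
def PdoDominated {n : ℕ} (σ : Eucl n → Eucl n → ℂ) (p K : ℝ≥0∞) (f : SchwartzMap (Eucl n) ℂ) :
    Prop :=
  (∀ x, Integrable (pdoIntegrand σ f x) volume) ∧
    ∃ R : Eucl n → ℝ≥0∞, AEMeasurable R volume ∧ (∀ x, ‖pdo σ f x‖ₑ ≤ R x) ∧
      eLpNorm R p volume ≤ K * eLpNorm (f : Eucl n → ℂ) p volume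

theorem continuous_fourier_schwartz {n : ℕ} (f : SchwartzMap (Eucl n) ℂ) :
    Continuous (𝓕 (f : Eucl n → ℂ)) := by
  rw [← SchwartzMap.fourier_coe]; exact (𝓕 f).continuous

theorem integrable_fourier_schwartz {n : ℕ} (f : SchwartzMap (Eucl n) ℂ) :
    Integrable (𝓕 (f : Eucl n → ℂ)) volume := by
  rw [← SchwartzMap.fourier_coe]; exact (𝓕 f).integrable

theorem norm_exp_two_pi_I_inner {n : ℕ} (ξ x : Eucl n) :
    ‖Complex.exp (2 * Real.pi * Complex.I * (inner ℝ ξ x : ℝ))‖ = 1 := by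
  rw [show (2 * Real.pi * Complex.I * (inner ℝ ξ x : ℝ) : ℂ)
    = ((2 * Real.pi * inner ℝ ξ x : ℝ) : ℂ) * Complex.I by push_cast; ring]
  exact Complex.norm_exp_ofReal_mul_I _

theorem norm_pdoIntegrand {n : ℕ} (σ : Eucl n → Eucl n → ℂ) (f : SchwartzMap (Eucl n) ℂ)
    (x ξ : Eucl n) : ‖pdoIntegrand σ f x ξ‖ = ‖σ x ξ‖ * ‖𝓕 (f : Eucl n → ℂ) ξ‖ := by
  simp only [pdoIntegrand, norm_mul, norm_exp_two_pi_I_inner, mul_one]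

theorem measurable_uncurry_pdoIntegrand {n : ℕ} {σ : Eucl n → Eucl n → ℂ}
    (hσ : Measurable (Function.uncurry σ)) (f : SchwartzMap (Eucl n) ℂ) :
    Measurable (Function.uncurry (pdoIntegrand σ f)) := by
  have h2 : Measurable fun z : Eucl n × Eucl n =>
      Complex.exp (2 * Real.pi * Complex.I * (inner ℝ z.2 z.1 : ℝ)) := by
    apply Continuous.measurable; fun_prop
  have h3 : Measurable fun z : Eucl n × Eucl n => 𝓕 (f : Eucl n → ℂ) z.2 :=
    (continuous_fourier_schwartz f).measurable.comp measurable_snd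
  exact (hσ.mul h2).mul h3

theorem aestronglyMeasurable_pdoIntegrand {n : ℕ} {σ : Eucl n → Eucl n → ℂ} {x : Eucl n}
    (hσ : AEStronglyMeasurable (σ x) volume) (f : SchwartzMap (Eucl n) ℂ) :
    AEStronglyMeasurable (pdoIntegrand σ f x) volume := by
  have h2 : Continuous fun ξ : Eucl n =>
      Complex.exp (2 * Real.pi * Complex.I * (inner ℝ ξ x : ℝ)) := by fun_prop
  exact (hσ.mul h2.aestronglyMeasurable).mul (continuous_fourier_schwartz f).aestronglyMeasurable

theorem integrable_pdoIntegrand_of_bound {n : ℕ} {σ : Eucl n → Eucl n → ℂ} {x : Eucl n}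
    (hσ : AEStronglyMeasurable (σ x) volume) {b : ℝ} (hb : ∀ᵐ ξ, ‖σ x ξ‖ ≤ b)
    (f : SchwartzMap (Eucl n) ℂ) : Integrable (pdoIntegrand σ f x) volume := by
  refine ((integrable_fourier_schwartz f).norm.const_mul b).mono'
    (aestronglyMeasurable_pdoIntegrand hσ f) ?_
  filter_upwards [hb] with ξ hξ
  rw [norm_pdoIntegrand]
  gcongr

/-- The dominant carries the norm bound; measurability of `pdo σ f` comes separately, from joint
measurability of `σ`. -/
theorem pdoNormLE_of_dominated {n : ℕ} {σ : Eucl n → Eucl n → ℂ}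
    (hσ : Measurable (Function.uncurry σ)) {p K : ℝ≥0∞} (hK : K ≠ ⊤)
    (h : ∀ f, PdoDominated σ p K f) : PdoNormLE σ p K := by
  intro f
  obtain ⟨hi, R, -, hle, hn⟩ := h f
  have hle' : eLpNorm (pdo σ f) p volume ≤ K * eLpNorm (f : Eucl n → ℂ) p volume :=
    (eLpNorm_mono_enorm (fun x => by simpa using hle x)).trans hn
  have hm : StronglyMeasurable (pdo σ f) :=
    (measurable_uncurry_pdoIntegrand hσ f).stronglyMeasurable.integral_prod_right
  exact ⟨hi, ⟨hm.aestronglyMeasurable,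
    hle'.trans_lt (ENNReal.mul_lt_top hK.lt_top (f.memLp p volume).2)⟩, hle'⟩

/-- The bounds `b i` times the integrable function `𝓕 f` dominate the integrands, so sum and
integral commute at each fixed `x`. Convergence is asked only for almost every `ξ`, because the
Littlewood–Paley series recovers a symbol only almost everywhere. -/
theorem pdo_hasSum {n : ℕ} {ι : Type*} [Countable ι] {σ : Eucl n → Eucl n → ℂ}
    {τ : ι → Eucl n → Eucl n → ℂ} {x : Eucl n} {b : ι → ℝ} (hb : Summable b)
    (hτ : ∀ i, AEStronglyMeasurable (τ i x) volume) (hτb : ∀ i, ∀ᵐ ξ, ‖τ i x ξ‖ ≤ b i)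
    (hsum : ∀ᵐ ξ, HasSum (fun i => τ i x ξ) (σ x ξ)) (f : SchwartzMap (Eucl n) ℂ) :
    Integrable (pdoIntegrand σ f x) volume ∧ HasSum (fun i => pdo (τ i) f x) (pdo σ f x) := by
  have hi : ∀ i, Integrable (pdoIntegrand (τ i) f x) volume := fun i =>
    integrable_pdoIntegrand_of_bound (hτ i) (hτb i) f
  have hle : ∀ i, ∫ ξ, ‖pdoIntegrand (τ i) f x ξ‖ ≤ b i * ∫ ξ, ‖𝓕 (f : Eucl n → ℂ) ξ‖ := by
    intro i
    rw [← integral_const_mul]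
    refine integral_mono_ae (hi i).norm ((integrable_fourier_schwartz f).norm.const_mul _) ?_
    filter_upwards [hτb i] with ξ hξ
    rw [norm_pdoIntegrand]
    gcongr
  have hS : Summable fun i => ∫ ξ, ‖pdoIntegrand (τ i) f x ξ‖ :=
    Summable.of_nonneg_of_le (fun i => integral_nonneg fun _ => norm_nonneg _) hle
      (hb.mul_right _)
  have h1 := hasSum_integral_of_summable_integral_norm hi hS
  have hae : ∀ᵐ ξ, ∑' i, pdoIntegrand (τ i) f x ξ = pdoIntegrand σ f x ξ := by
    filter_upwards [hsum] with ξ hξ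
    exact ((hξ.mul_right _).mul_right _).tsum_eq
  refine ⟨?_, ?_⟩
  · have hbd : ∀ᵐ ξ, ‖σ x ξ‖ ≤ ∑' i, b i := by
      filter_upwards [hsum, ae_all_iff.2 hτb] with ξ hξ hξb
      rw [← hξ.tsum_eq]
      exact tsum_of_norm_bounded hb.hasSum hξb
    have hm : AEMeasurable (σ x) volume := by
      have : AEMeasurable (fun ξ => ∑' i, τ i x ξ) volume := by
        have hlim : ∀ᵐ ξ, Filter.Tendsto (fun s : Finset ι => ∑ i ∈ s, τ i x ξ) Filter.atTop
            (nhds (∑' i, τ i x ξ)) := by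
          filter_upwards [hsum] with ξ hξ
          exact hξ.summable.hasSum
        exact aemeasurable_of_tendsto_metrizable_ae _
          (fun s => Finset.aemeasurable_fun_sum s fun i _ => (hτ i).aemeasurable) hlim
      refine this.congr ?_
      filter_upwards [hsum] with ξ hξ
      exact hξ.tsum_eq
    exact integrable_pdoIntegrand_of_bound hm.aestronglyMeasurable hbd f
  · have : pdo σ f x = ∫ ξ, ∑' i, pdoIntegrand (τ i) f x ξ := (integral_congr_ae hae).symm
    rw [this]
    exact h1

theorem enorm_le_tsum_of_hasSum {ι : Type*} {u : ι → ℂ} {z : ℂ} (h : HasSum u z) :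
    ‖z‖ₑ ≤ ∑' i, ‖u i‖ₑ := by
  have h1 : Filter.Tendsto (fun s : Finset ι => ‖∑ i ∈ s, u i‖ₑ) Filter.atTop (nhds ‖z‖ₑ) :=
    (continuous_enorm.tendsto z).comp h
  refine le_of_tendsto h1 (Filter.Eventually.of_forall fun s => ?_)
  exact (enorm_sum_le _ _).trans (ENNReal.sum_le_tsum s)

/-- Dominants add up: `∑ R i` dominates the sum of the operators, and Minkowski bounds its norm. -/
theorem pdoDominated_of_hasSum {n : ℕ} {ι : Type*} [Countable ι] {σ : Eucl n → Eucl n → ℂ}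
    {τ : ι → Eucl n → Eucl n → ℂ} {b : ι → ℝ} {p : ℝ≥0∞} (hp : 1 ≤ p) (hp' : p ≠ ⊤)
    (hb : Summable b) (hτ : ∀ i x, AEStronglyMeasurable (τ i x) volume)
    (hτb : ∀ i x, ∀ᵐ ξ, ‖τ i x ξ‖ ≤ b i)
    (hsum : ∀ x, ∀ᵐ ξ, HasSum (fun i => τ i x ξ) (σ x ξ)) (f : SchwartzMap (Eucl n) ℂ)
    {R : ι → Eucl n → ℝ≥0∞} (hR : ∀ i, AEMeasurable (R i) volume)
    (hτR : ∀ i x, ‖pdo (τ i) f x‖ₑ ≤ R i x) {K : ι → ℝ≥0∞}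
    (hRK : ∀ i, eLpNorm (R i) p volume ≤ K i * eLpNorm (f : Eucl n → ℂ) p volume) :
    PdoDominated σ p (∑' i, K i) f := by
  have key := fun x => pdo_hasSum hb (fun i => hτ i x) (fun i => hτb i x) (hsum x) f
  refine ⟨fun x => (key x).1, fun x => ∑' i, R i x, AEMeasurable.tsum hR,
    fun x => (enorm_le_tsum_of_hasSum (key x).2).trans (ENNReal.tsum_le_tsum fun i => hτR i x), ?_⟩
  refine (eLpNorm_tsum_le_tsum_eLpNorm hp hp' hR).trans ?_
  rw [← ENNReal.tsum_mul_right]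
  exact ENNReal.tsum_le_tsum hRK

/-! ### Scales of localized symbols -/

/-- The weight `2^{ls}`. -/
def dyadicWeight (s : ℝ) (l : ℤ) : ℝ≥0∞ := ENNReal.ofReal ((2 : ℝ) ^ ((l : ℝ) * s))

theorem dyadicWeight_succ (s : ℝ) (l : ℤ) :
    dyadicWeight s (l + 1) = ENNReal.ofReal ((2 : ℝ) ^ s) * dyadicWeight s l := by
  rw [dyadicWeight, dyadicWeight, ← ENNReal.ofReal_mul (by positivity),
    ← Real.rpow_add (by norm_num)]
  congr 2; push_cast; ring

/-- An increasing family `V` of sets of localized functions on `Ω`, almost closed under products,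
satisfying a Bernstein inequality and, pulled back along `π : ℝⁿ → Ω`, pointwise bounds for the
corresponding Fourier multipliers. -/
structure SymbolScale {n : ℕ} {Ω : Type*} [MeasurableSpace Ω] (ρ : Measure Ω) (π : Eucl n → Ω)
    (q p : ℝ≥0∞) (s : ℝ) (V : ℤ → Set (Ω → ℂ)) (C : ℝ≥0) : Prop where
  quasiMeasurePreserving : Measure.QuasiMeasurePreserving π volume ρ
  mono : Monotone V
  mul_mem : ∀ {l g h}, g ∈ V l → h ∈ V l → (fun θ => g θ * h θ) ∈ V (l + 1)
  measurable : ∀ {l g}, g ∈ V l → Measurable g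
  bernstein : ∀ {l g}, g ∈ V l → ∀ θ, ‖g θ‖ₑ ≤ C * (dyadicWeight s l * eLpNorm g q ρ)
  -- The order of quantifiers is essential: `M` depends on `f` and `l` but not on `g`, so `g` may
  -- later be chosen as a function of `x`.
  dominated : ∀ f : SchwartzMap (Eucl n) ℂ, ∀ l, ∃ M : Eucl n → ℝ≥0∞, AEMeasurable M volume ∧
    eLpNorm M p volume ≤ eLpNorm (f : Eucl n → ℂ) p volume ∧
    ∀ g ∈ V l, eLpNorm g q ρ < ⊤ → ∀ x,
      ‖pdo (fun _ ξ => g (π ξ)) f x‖ₑ ≤ C * (dyadicWeight s l * eLpNorm g q ρ) * M x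

/-- `μ(x,·)` is a sum of localized functions whose weighted norms are bounded uniformly in `x`, with
sum at most `S`. -/
def HasLocalizedDecomp {X Ω : Type*} [MeasurableSpace Ω] (ρ : Measure Ω) (q : ℝ≥0∞) (s : ℝ)
    (V : ℤ → Set (Ω → ℂ)) (μ : X → Ω → ℂ) (S : ℝ≥0∞) : Prop :=
  ∃ (ι : Type) (_ : Countable ι) (L : ι → ℤ) (a : ι → ℝ≥0∞) (g : ι → X → Ω → ℂ),
    (∀ i x, g i x ∈ V (L i)) ∧ (∀ i x, dyadicWeight s (L i) * eLpNorm (g i x) q ρ ≤ a i) ∧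
    ∑' i, a i ≤ S ∧ ∀ x, ∀ᵐ θ ∂ρ, HasSum (fun i => g i x θ) (μ x θ)

theorem HasLocalizedDecomp.mono {X Ω : Type*} [MeasurableSpace Ω] {ρ : Measure Ω} {q : ℝ≥0∞} {s : ℝ}
    {V : ℤ → Set (Ω → ℂ)} {μ : X → Ω → ℂ} {S S' : ℝ≥0∞} (h : HasLocalizedDecomp ρ q s V μ S)
    (hS : S ≤ S') : HasLocalizedDecomp ρ q s V μ S' := by
  obtain ⟨ι, hι, L, a, g, h1, h2, h3, h4⟩ := h
  exact ⟨ι, hι, L, a, g, h1, h2, h3.trans hS, h4⟩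

theorem dyadicWeight_ne_top (s : ℝ) (l : ℤ) : dyadicWeight s l ≠ ⊤ := ENNReal.ofReal_ne_top

theorem dyadicWeight_ne_zero (s : ℝ) (l : ℤ) : dyadicWeight s l ≠ 0 := by
  rw [dyadicWeight, ENNReal.ofReal_ne_zero_iff]; positivity

namespace SymbolScale

variable {n : ℕ} {Ω : Type*} [MeasurableSpace Ω] {ρ : Measure Ω} {π : Eucl n → Ω}
    {q p : ℝ≥0∞} {s : ℝ} {V : ℤ → Set (Ω → ℂ)} {C : ℝ≥0}

/-- The constant in the product estimate. -/
def prodConst (s : ℝ) (C : ℝ≥0) : ℝ≥0 := Real.toNNReal ((2 : ℝ) ^ s) * C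

theorem norm_le (h : SymbolScale ρ π q p s V C) {l : ℤ} {g : Ω → ℂ} (hg : g ∈ V l) {a : ℝ≥0∞}
    (ha : dyadicWeight s l * eLpNorm g q ρ ≤ a) (ha' : a ≠ ⊤) (θ : Ω) :
    ‖g θ‖ ≤ (C * a).toReal := by
  rw [← toReal_enorm]
  refine ENNReal.toReal_mono (ENNReal.mul_ne_top ENNReal.coe_ne_top ha') ?_
  exact (h.bernstein hg θ).trans (by gcongr)

theorem summable_bound {ι : Type*} {a : ι → ℝ≥0∞} (ha : ∑' i, a i ≠ ⊤) (C : ℝ≥0) :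
    Summable fun i => (C * a i).toReal := by
  refine ENNReal.summable_toReal ?_
  rw [ENNReal.tsum_mul_left]
  exact ENNReal.mul_ne_top ENNReal.coe_ne_top ha

/-- The factor of higher level keeps its `L^q` norm, while the factor of lower level is bounded
pointwise by Bernstein. Raising the level by one costs the factor `2^s` in `prodConst`. -/
theorem mul_aux (h : SymbolScale ρ π q p s V C) {l m : ℤ} (hml : m ≤ l) {g k : Ω → ℂ}
    (hg : g ∈ V l) (hk : k ∈ V m) {a b : ℝ≥0∞}
    (ha : dyadicWeight s l * eLpNorm g q ρ ≤ a) (hb : dyadicWeight s m * eLpNorm k q ρ ≤ b) :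
    (fun θ => g θ * k θ) ∈ V (l + 1) ∧
      dyadicWeight s (l + 1) * eLpNorm (fun θ => g θ * k θ) q ρ ≤ prodConst s C * (a * b) := by
  refine ⟨h.mul_mem hg (h.mono hml hk), ?_⟩
  have hle : eLpNorm (fun θ => g θ * k θ) q ρ ≤ (C * b) * eLpNorm g q ρ := by
    -- For `b = ⊤` the right side is infinite unless `C` or the norm of `g` vanishes, and in those
    -- cases Bernstein forces `g = 0`.
    by_cases hb' : b = ⊤
    · rcases eq_or_ne (C : ℝ≥0∞) 0 with hC | hC
      · have : (fun θ => g θ * k θ) = 0 := by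
          ext θ
          have := h.bernstein hg θ
          rw [hC, zero_mul] at this
          simp [enorm_eq_zero.1 (le_zero_iff.1 this)]
        rw [this]; simp
      · rcases eq_or_ne (eLpNorm g q ρ) 0 with h0 | h0
        · have : (fun θ => g θ * k θ) = 0 := by
            ext θ
            have := h.bernstein hg θ
            rw [h0, mul_zero, mul_zero] at this
            simp [enorm_eq_zero.1 (le_zero_iff.1 this)]
          rw [this]; simp
        · rw [hb', ENNReal.mul_top hC, ENNReal.top_mul h0]; exact le_top
    · have hb2 : (C * b : ℝ≥0∞) ≠ ⊤ := ENNReal.mul_ne_top ENNReal.coe_ne_top hb'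
      have := eLpNorm_le_nnreal_smul_eLpNorm_of_ae_le_mul (f := fun θ => g θ * k θ) (g := g)
        (c := (C * b).toNNReal) (μ := ρ) (Filter.Eventually.of_forall fun θ => by
          have := h.norm_le hk hb hb' θ
          rw [← NNReal.coe_le_coe]
          push_cast
          rw [norm_mul, mul_comm]
          gcongr) q
      refine this.trans ?_
      rw [ENNReal.smul_def, smul_eq_mul, ENNReal.coe_toNNReal hb2]
  rw [dyadicWeight_succ]
  calc _ ≤ ENNReal.ofReal (2 ^ s) * dyadicWeight s l * ((C * b) * eLpNorm g q ρ) := by gcongr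
    _ = ENNReal.ofReal (2 ^ s) * C * ((dyadicWeight s l * eLpNorm g q ρ) * b) := by ring
    _ ≤ ENNReal.ofReal (2 ^ s) * C * (a * b) := by gcongr
    _ = _ := by simp [prodConst, ENNReal.ofReal]

/-- Each pair of pieces goes to the level `max + 1`, and its bound is a product, so the sum over all
pairs factors. The Bernstein bounds make both series absolutely convergent, which allows them to be
multiplied. -/
theorem decomp_mul (h : SymbolScale ρ π q p s V C) {X : Type*} {μ ν : X → Ω → ℂ} {S T : ℝ≥0∞}
    (hμ : HasLocalizedDecomp ρ q s V μ S) (hν : HasLocalizedDecomp ρ q s V ν T) (hS : S ≠ ⊤)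
    (hT : T ≠ ⊤) :
    HasLocalizedDecomp ρ q s V (fun x θ => μ x θ * ν x θ) (prodConst s C * (S * T)) := by
  obtain ⟨ι, hι, L, a, g, h1, h2, h3, h4⟩ := hμ
  obtain ⟨κ, hκ, L', b, g', h1', h2', h3', h4'⟩ := hν
  have key : ∀ (z : ι × κ) (x : X), (fun θ => g z.1 x θ * g' z.2 x θ) ∈ V (max (L z.1) (L' z.2) + 1)
      ∧ dyadicWeight s (max (L z.1) (L' z.2) + 1) * eLpNorm (fun θ => g z.1 x θ * g' z.2 x θ) q ρ
        ≤ prodConst s C * (a z.1 * b z.2) := by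
    rintro ⟨i, j⟩ x
    rcases le_total (L' j) (L i) with hij | hij
    · simp only [max_eq_left hij]
      exact h.mul_aux hij (h1 i x) (h1' j x) (h2 i x) (h2' j x)
    · simp only [max_eq_right hij, mul_comm (g i x _), mul_comm (a i)]
      exact h.mul_aux hij (h1' j x) (h1 i x) (h2' j x) (h2 i x)
  have ha : ∑' i, a i ≠ ⊤ := ne_top_of_le_ne_top hS h3
  have hb : ∑' i, b i ≠ ⊤ := ne_top_of_le_ne_top hT h3'
  refine ⟨ι × κ, inferInstance, fun z => max (L z.1) (L' z.2) + 1,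
    fun z => prodConst s C * (a z.1 * b z.2), fun z x θ => g z.1 x θ * g' z.2 x θ,
    fun z x => (key z x).1, fun z x => (key z x).2, ?_, fun x => ?_⟩
  · rw [ENNReal.tsum_mul_left]
    gcongr
    rw [ENNReal.tsum_prod (f := fun i j => a i * b j)]
    simp_rw [ENNReal.tsum_mul_left, ENNReal.tsum_mul_right]
    gcongr
  · filter_upwards [h4 x, h4' x] with θ hθ hθ'
    have s1 : Summable fun i => ‖g i x θ‖ :=
      Summable.of_nonneg_of_le (fun _ => norm_nonneg _)
        (fun i => h.norm_le (h1 i x) (h2 i x) (ENNReal.ne_top_of_tsum_ne_top ha i) θ)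
        (summable_bound ha C)
    have s2 : Summable fun i => ‖g' i x θ‖ :=
      Summable.of_nonneg_of_le (fun _ => norm_nonneg _)
        (fun i => h.norm_le (h1' i x) (h2' i x) (ENNReal.ne_top_of_tsum_ne_top hb i) θ)
        (summable_bound hb C)
    have s3 : Summable fun z : ι × κ => g z.1 x θ * g' z.2 x θ :=
      summable_mul_of_summable_norm (f := fun i => g i x θ) (g := fun j => g' j x θ) s1 s2
    exact HasSum.mul (f := fun i => g i x θ) (g := fun j => g' j x θ) hθ hθ' s3

/-- The zeroth power is left out: on `ℝⁿ` no level contains the constant `1`, whose operator is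
treated separately as the identity. -/
theorem decomp_pow (h : SymbolScale ρ π q p s V C) {X : Type*} {μ : X → Ω → ℂ} {S : ℝ≥0}
    (hμ : HasLocalizedDecomp ρ q s V μ S) (j : ℕ) :
    HasLocalizedDecomp ρ q s V (fun x θ => μ x θ ^ (j + 1))
      ((prodConst s C ^ j * S ^ (j + 1) : ℝ≥0) : ℝ≥0∞) := by
  induction j with
  | zero => simpa using hμ
  | succ j ih =>
    have := h.decomp_mul ih hμ ENNReal.coe_ne_top ENNReal.coe_ne_top
    simp_rw [pow_succ _ (j + 1)]
    refine this.mono (le_of_eq ?_)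
    push_cast; ring

theorem decomp_bounded (h : SymbolScale ρ π q p s V C) {X : Type*} {μ : X → Ω → ℂ} {S : ℝ≥0∞}
    (hμ : HasLocalizedDecomp ρ q s V μ S) (hS : S ≠ ⊤) (x : X) :
    ∀ᵐ θ ∂ρ, ‖μ x θ‖ ≤ (C * S).toReal := by
  obtain ⟨ι, hι, L, a, g, h1, h2, h3, h4⟩ := hμ
  have ha : ∑' i, a i ≠ ⊤ := ne_top_of_le_ne_top hS h3
  filter_upwards [h4 x] with θ hθ
  rw [← hθ.tsum_eq]
  refine (tsum_of_norm_bounded (summable_bound ha C).hasSum (fun i =>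
    h.norm_le (h1 i x) (h2 i x) (ENNReal.ne_top_of_tsum_ne_top ha i) θ)).trans ?_
  rw [← ENNReal.tsum_toReal_eq (fun i => ENNReal.mul_ne_top ENNReal.coe_ne_top
    (ENNReal.ne_top_of_tsum_ne_top ha i)), ENNReal.tsum_mul_left]
  exact ENNReal.toReal_mono (ENNReal.mul_ne_top ENNReal.coe_ne_top hS) (by gcongr)

/-- All slices `g i x` of one piece share the dominant `M (L i)`, so the dependence on `x` costs
only the uniform bound `a i`. -/
theorem decomp_dominated (h : SymbolScale ρ π q p s V C) (hp : 1 ≤ p) (hp' : p ≠ ⊤)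
    {μ : Eucl n → Ω → ℂ} {S : ℝ≥0∞} (hμ : HasLocalizedDecomp ρ q s V μ S) (hS : S ≠ ⊤)
    (f : SchwartzMap (Eucl n) ℂ) : PdoDominated (fun x ξ => μ x (π ξ)) p (C * S) f := by
  obtain ⟨ι, hι, L, a, g, h1, h2, h3, h4⟩ := hμ
  have ha : ∑' i, a i ≠ ⊤ := ne_top_of_le_ne_top hS h3
  choose M hM1 hM2 hM3 using h.dominated f
  have := pdoDominated_of_hasSum (σ := fun x ξ => μ x (π ξ)) (τ := fun i x ξ => g i x (π ξ))
    (b := fun i => (C * a i).toReal) hp hp' (summable_bound ha C)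
    (fun i x => ((h.measurable (h1 i x)).comp
      h.quasiMeasurePreserving.measurable).aestronglyMeasurable)
    (fun i x => Filter.Eventually.of_forall fun ξ =>
      h.norm_le (h1 i x) (h2 i x) (ENNReal.ne_top_of_tsum_ne_top ha i) (π ξ))
    (fun x => h.quasiMeasurePreserving.ae (h4 x)) f
    (R := fun i x => (C * a i) * M (L i) x)
    (fun i => (hM1 (L i)).const_mul _)
    (fun i x => ?_) (K := fun i => C * a i) (fun i => ?_)
  · obtain ⟨hi, R, hR1, hR2, hR3⟩ := this
    refine ⟨hi, R, hR1, hR2, hR3.trans ?_⟩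
    rw [ENNReal.tsum_mul_left]
    gcongr
  · have hfin : eLpNorm (g i x) q ρ < ⊤ := by
      have := ENNReal.ne_top_of_tsum_ne_top ha i
      by_contra hcon
      rw [not_lt, top_le_iff] at hcon
      have h2' := h2 i x
      rw [hcon, ENNReal.mul_top (dyadicWeight_ne_zero _ _), top_le_iff] at h2'
      exact this h2'
    exact (hM3 (L i) (g i x) (h1 i x) hfin x).trans (by gcongr; exact h2 i x)
  · have hc : ((C : ℝ≥0∞) * a i) ≠ ⊤ :=
      ENNReal.mul_ne_top ENNReal.coe_ne_top (ENNReal.ne_top_of_tsum_ne_top ha i)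
    exact (eLpNorm_const_mul_le_of_ne_top hc hp hp' _).trans (by gcongr; exact hM2 (L i))

/-- Fourier inversion. It supplies the zeroth term of the exponential series. -/
theorem pdo_one (f : SchwartzMap (Eucl n) ℂ) (x : Eucl n) : pdo (fun _ _ => 1) f x = f x := by
  have h1 : 𝓕⁻ (𝓕 (f : Eucl n → ℂ)) = f :=
    f.continuous.fourierInv_fourier_eq f.integrable (integrable_fourier_schwartz f)
  conv_rhs => rw [← h1, Real.fourierInv_eq']
  refine integral_congr_ae (Filter.Eventually.of_forall fun ξ => ?_)
  simp only [pdoIntegrand, one_mul, smul_eq_mul]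
  congr 2
  push_cast; ring

/-- The constant in the exponential estimate. -/
def expConst (s : ℝ) (C : ℝ≥0) : ℝ≥0 := max C (prodConst s C)

/-- The power `j + 1` costs `C * prodConst^j * S^(j+1)`, at most `(expConst * S)^(j+1)`; division by
the factorial and summation give the exponential. The almost everywhere bound on `μ` justifies
summing the operators term by term. -/
theorem decomp_exp_dominated (h : SymbolScale ρ π q p s V C) (hp : 1 ≤ p) (hp' : p ≠ ⊤)
    {μ : Eucl n → Ω → ℂ} {S : ℝ≥0} (hμ : HasLocalizedDecomp ρ q s V μ S)
    (hμm : ∀ x, Measurable (μ x)) (f : SchwartzMap (Eucl n) ℂ) :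
    PdoDominated (fun x ξ => Complex.exp (μ x (π ξ))) p
      (ENNReal.ofReal (Real.exp (expConst s C * S))) f := by
  have hdom : ∀ j : ℕ, ∃ R : Eucl n → ℝ≥0∞, AEMeasurable R volume ∧
      (∀ x, ‖pdo (fun x ξ => ((j.factorial : ℂ)⁻¹ * μ x (π ξ) ^ j)) f x‖ₑ ≤ R x) ∧
      eLpNorm R p volume ≤ ENNReal.ofReal ((expConst s C * S) ^ j / j.factorial) *
        eLpNorm (f : Eucl n → ℂ) p volume := by
    intro j
    have hsmul : ∀ x, pdo (fun x ξ => ((j.factorial : ℂ)⁻¹ * μ x (π ξ) ^ j)) f x =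
        (j.factorial : ℂ)⁻¹ * pdo (fun x ξ => μ x (π ξ) ^ j) f x := by
      intro x
      simp only [pdo, pdoIntegrand, mul_assoc]
      rw [integral_const_mul]
    have hfac : ‖(j.factorial : ℂ)⁻¹‖ₑ = ENNReal.ofReal ((j.factorial : ℝ)⁻¹) := by
      rw [← ofReal_norm]; simp
    cases j with
    | zero =>
      refine ⟨fun x => ‖f x‖ₑ, f.continuous.enorm.aemeasurable, fun x => ?_, ?_⟩
      · simp [pdo_one]
      · simp [eLpNorm_enorm]
    | succ j =>
      obtain ⟨-, R, hR1, hR2, hR3⟩ := h.decomp_dominated hp hp' (h.decomp_pow hμ j)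
        ENNReal.coe_ne_top f
      set c : ℝ≥0∞ := ENNReal.ofReal (((j + 1).factorial : ℝ)⁻¹) with hc
      refine ⟨fun x => c * R x, hR1.const_mul c, fun x => ?_, ?_⟩
      · rw [hsmul, enorm_mul, hfac]
        exact mul_le_mul_right (hR2 x) _
      · have hsm : eLpNorm (fun x => c * R x) p volume ≤ c * eLpNorm R p volume :=
          eLpNorm_const_mul_le_of_ne_top ENNReal.ofReal_ne_top hp hp' R
        refine hsm.trans ((mul_le_mul_right hR3 _).trans ?_)
        rw [← mul_assoc, hc]
        gcongr
        rw [div_eq_inv_mul, ENNReal.ofReal_mul (by positivity)]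
        gcongr
        rw [← ENNReal.ofReal_coe_nnreal, ← ENNReal.ofReal_coe_nnreal,
          ← ENNReal.ofReal_mul (by positivity)]
        apply ENNReal.ofReal_le_ofReal
        push_cast
        rw [mul_pow, ← mul_assoc]
        gcongr
        rw [pow_succ, mul_comm]
        have e1 : (C : ℝ) ≤ expConst s C := NNReal.coe_le_coe.2 (le_max_left _ _)
        have e2 : (prodConst s C : ℝ) ≤ expConst s C := NNReal.coe_le_coe.2 (le_max_right _ _)
        gcongr
  choose R hR1 hR2 hR3 using hdom
  have hbd := fun x => h.quasiMeasurePreserving.ae (h.decomp_bounded hμ ENNReal.coe_ne_top x)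
  have hexp : HasSum (fun j : ℕ => (expConst s C * S : ℝ) ^ j / j.factorial)
      (Real.exp (expConst s C * S)) := by
    rw [Real.exp_eq_exp_ℝ]; exact NormedSpace.expSeries_div_hasSum_exp (𝔸 := ℝ) _
  have := pdoDominated_of_hasSum (σ := fun x ξ => Complex.exp (μ x (π ξ)))
    (τ := fun (j : ℕ) x ξ => (j.factorial : ℂ)⁻¹ * μ x (π ξ) ^ j)
    (b := fun j => ((C * S : ℝ≥0∞)).toReal ^ j / j.factorial) hp hp'
    (Real.summable_pow_div_factorial _)
    (fun i x => ((((hμm x).comp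
      h.quasiMeasurePreserving.measurable).pow_const i).const_mul _).aestronglyMeasurable)
    (fun j x => by
      filter_upwards [hbd x] with ξ hξ
      rw [norm_mul, norm_pow, norm_inv, Complex.norm_natCast, div_eq_inv_mul]
      gcongr)
    (fun x => Filter.Eventually.of_forall fun ξ => by
      have := NormedSpace.expSeries_div_hasSum_exp (𝔸 := ℂ) (μ x (π ξ))
      rw [← Complex.exp_eq_exp_ℂ] at this
      simpa only [div_eq_inv_mul] using this)
    f hR1 hR2 hR3
  rwa [← ENNReal.ofReal_tsum_of_nonneg (fun j => by positivity) hexp.summable,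
    hexp.tsum_eq] at this

end SymbolScale

/-! ### Band-limited functions on `ℝⁿ` -/

theorem integral_fourier_mul_eq_flip {n : ℕ} {f g : Eucl n → ℂ} (hf : Integrable f volume)
    (hg : Integrable g volume) : ∫ ξ, 𝓕 f ξ * g ξ = ∫ x, f x * 𝓕 g x := by
  have := VectorFourier.integral_fourierIntegral_smul_eq_flip (L := innerₗ (Eucl n))
    (μ := (volume : Measure (Eucl n))) (ν := (volume : Measure (Eucl n)))
    Real.continuous_fourierChar continuous_inner hf hg
  rw [flip_innerₗ] at this
  exact this

theorem continuous_fourier_of_integrable {n : ℕ} {k : Eucl n → ℂ} (hk : Integrable k volume) :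
    Continuous (𝓕 k) :=
  VectorFourier.fourierIntegral_continuous Real.continuous_fourierChar
    (by exact continuous_inner) hk

/-- Fourier transforms of integrable functions supported in the ball of radius `2^l`. -/
def bandLimited (n : ℕ) (l : ℤ) : Set (Eucl n → ℂ) :=
  {g | ∃ k : Eucl n → ℂ, Integrable k volume ∧ (∀ y, (2 : ℝ) ^ l < ‖y‖ → k y = 0) ∧ g = 𝓕 k}

theorem bandLimited_mono (n : ℕ) : Monotone (bandLimited n) := by
  rintro l m hlm g ⟨k, hk, hs, rfl⟩
  refine ⟨k, hk, fun y hy => hs y (lt_of_le_of_lt ?_ hy), rfl⟩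
  exact zpow_le_zpow_right₀ (by norm_num) hlm

/-- A product of Fourier transforms is the transform of a convolution, and supports add, so the
radius doubles. -/
theorem bandLimited_mul {n : ℕ} {l : ℤ} {g h : Eucl n → ℂ} (hg : g ∈ bandLimited n l)
    (hh : h ∈ bandLimited n l) : (fun θ => g θ * h θ) ∈ bandLimited n (l + 1) := by
  obtain ⟨k, hk, hs, rfl⟩ := hg
  obtain ⟨k', hk', hs', rfl⟩ := hh
  refine ⟨convolution k k' (ContinuousLinearMap.mul ℂ ℂ) volume,
    hk.integrable_convolution _ hk', fun y hy => ?_, ?_⟩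
  · by_contra hne
    obtain ⟨a, ha, b, hb, rfl⟩ := Set.mem_add.1 (support_convolution_subset _ hne)
    have h1 : ‖a‖ ≤ (2 : ℝ) ^ l := by
      by_contra hcon; exact ha (hs a (not_le.1 hcon))
    have h2 : ‖b‖ ≤ (2 : ℝ) ^ l := by
      by_contra hcon; exact hb (hs' b (not_le.1 hcon))
    have h3 := norm_add_le a b
    rw [zpow_add_one₀ (by norm_num)] at hy
    linarith
  · ext ξ
    rw [Real.fourier_mul_convolution_eq hk hk']

/-- A fixed smooth bump, equal to `1` on the unit ball and supported in the ball of radius `2`. -/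
def stdBump (n : ℕ) : ContDiffBump (0 : Eucl n) := ⟨1, 2, by norm_num, by norm_num⟩

theorem norm_two_zpow_neg_smul {n : ℕ} (l : ℤ) (y : Eucl n) :
    ‖((2 : ℝ) ^ (-l)) • y‖ = ((2 : ℝ) ^ l)⁻¹ * ‖y‖ := by
  rw [norm_smul, zpow_neg, norm_inv, Real.norm_of_nonneg (by positivity)]

theorem stdBump_eq_one {n : ℕ} {l : ℤ} {y : Eucl n} (hy : ‖y‖ ≤ (2 : ℝ) ^ l) :
    stdBump n ((2 : ℝ) ^ (-l) • y) = 1 := by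
  refine (stdBump n).one_of_mem_closedBall ?_
  rw [mem_closedBall_zero_iff, norm_two_zpow_neg_smul]
  change _ ≤ (1 : ℝ)
  rw [inv_mul_le_iff₀ (by positivity)]; simpa using hy

theorem stdBump_eq_zero {n : ℕ} {l : ℤ} {y : Eucl n} (hy : (2 : ℝ) ^ (l + 1) ≤ ‖y‖) :
    stdBump n ((2 : ℝ) ^ (-l) • y) = 0 := by
  refine (stdBump n).zero_of_le_dist ?_
  rw [dist_zero_right, norm_two_zpow_neg_smul]
  change (2 : ℝ) ≤ _
  rw [le_inv_mul_iff₀ (by positivity), ← zpow_add_one₀ (by norm_num)]; exact hy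

/-- The product of a smooth function with a bump at scale `2^l`. -/
def localize {n : ℕ} (l : ℤ) (F : Eucl n → ℂ) (hF : ContDiff ℝ ∞ F) : SchwartzMap (Eucl n) ℂ :=
  HasCompactSupport.toSchwartzMap (f := fun y => (stdBump n ((2 : ℝ) ^ (-l) • y) : ℂ) * F y)
    (HasCompactSupport.intro (isCompact_closedBall (0 : Eucl n) ((2 : ℝ) ^ (l + 1))) fun y hy => by
      rw [mem_closedBall_zero_iff, not_le] at hy
      rw [stdBump_eq_zero hy.le, Complex.ofReal_zero, zero_mul])
    ((Complex.ofRealCLM.contDiff.comp ((stdBump n).contDiff.comp (contDiff_const_smul _))).mul hF)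

theorem localize_apply {n : ℕ} (l : ℤ) (F : Eucl n → ℂ) (hF : ContDiff ℝ ∞ F) (y : Eucl n) :
    localize l F hF y = (stdBump n ((2 : ℝ) ^ (-l) • y) : ℂ) * F y := rfl

theorem eLpNorm_localize_le {n : ℕ} (l : ℤ) (F : Eucl n → ℂ) (hF : ContDiff ℝ ∞ F) (q : ℝ≥0∞) :
    eLpNorm (localize l F hF) q volume
      ≤ eLpNorm F q (volume.restrict (Metric.ball 0 ((2 : ℝ) ^ (l + 1)))) := by
  rw [← eLpNorm_indicator_eq_eLpNorm_restrict measurableSet_ball]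
  refine eLpNorm_mono fun y => ?_
  rw [localize_apply]
  by_cases hy : y ∈ Metric.ball (0 : Eucl n) ((2 : ℝ) ^ (l + 1))
  · rw [Set.indicator_of_mem hy, norm_mul, Complex.norm_real,
      Real.norm_of_nonneg ((stdBump n).nonneg)]
    exact mul_le_of_le_one_left (norm_nonneg _) (stdBump n).le_one
  · rw [mem_ball_zero_iff, not_lt] at hy
    rw [stdBump_eq_zero hy, Complex.ofReal_zero, zero_mul, norm_zero]
    exact norm_nonneg _

theorem eLpNorm_two_fourierInv_schwartz {n : ℕ} (φ : SchwartzMap (Eucl n) ℂ) :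
    eLpNorm (𝓕⁻ φ : SchwartzMap (Eucl n) ℂ) 2 volume = eLpNorm φ 2 volume := by
  have h := SchwartzMap.norm_fourier_toL2_eq (𝓕⁻ φ)
  rw [FourierTransform.fourier_fourierInv_eq, SchwartzMap.norm_toLp, SchwartzMap.norm_toLp,
    ENNReal.toReal_eq_toReal_iff' (φ.memLp 2 volume).2.ne ((𝓕⁻ φ).memLp 2 volume).2.ne] at h
  exact h.symm

theorem enorm_fourierInv_schwartz_le {n : ℕ} (φ : SchwartzMap (Eucl n) ℂ) (x : Eucl n) :
    ‖(𝓕⁻ φ) x‖ₑ ≤ eLpNorm φ 1 volume := by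
  rw [SchwartzMap.fourierInv_coe, Real.fourierInv_eq', eLpNorm_one_eq_lintegral_enorm]
  refine (enorm_integral_le_lintegral_enorm _).trans (le_of_eq ?_)
  refine lintegral_congr fun v => ?_
  rw [enorm_smul, ← ofReal_norm (Complex.exp _), Complex.norm_exp_ofReal_mul_I]
  simp

theorem enorm_integral_mul_le {α : Type*} {m : MeasurableSpace α} {ρ : Measure α} {f g : α → ℂ}
    (hf : AEStronglyMeasurable f ρ) (hg : AEStronglyMeasurable g ρ) (p q : ℝ≥0∞)
    [p.HolderTriple q 1] : ‖∫ x, f x * g x ∂ρ‖ₑ ≤ eLpNorm f p ρ * eLpNorm g q ρ := by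
  refine (enorm_integral_le_lintegral_enorm _).trans ?_
  rw [← eLpNorm_one_eq_lintegral_enorm]
  have := eLpNorm_smul_le_mul_eLpNorm (p := p) (q := q) (r := 1) hg hf
  exact this

/-- Pairing a compactly supported `k` with a smooth function, in terms of `𝓕 k`. -/
theorem enorm_integral_mul_smooth_le {n : ℕ} {l : ℤ} {k : Eucl n → ℂ} (hk : Integrable k volume)
    (hs : ∀ y, (2 : ℝ) ^ l < ‖y‖ → k y = 0) {F : Eucl n → ℂ} (hF : ContDiff ℝ ∞ F) {q : ℝ≥0∞}
    (hq : q = 1 ∨ q = 2) :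
    ‖∫ y, k y * F y‖ₑ ≤ eLpNorm (𝓕 k) q volume *
      eLpNorm F q (volume.restrict (Metric.ball 0 ((2 : ℝ) ^ (l + 1)))) := by
  -- The bump equals `1` on the support of `k`, so `F` may be replaced by its Schwartz localization;
  -- the pairing then moves to the frequency side.
  have h1 : ∫ y, k y * F y = ∫ ξ, 𝓕 k ξ * (𝓕⁻ (localize l F hF)) ξ := by
    rw [integral_fourier_mul_eq_flip hk (𝓕⁻ (localize l F hF)).integrable,
      ← SchwartzMap.fourier_coe, FourierTransform.fourier_fourierInv_eq]
    refine integral_congr_ae (Filter.Eventually.of_forall fun y => ?_)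
    simp only [localize_apply]
    rcases le_or_gt ‖y‖ ((2 : ℝ) ^ l) with hy | hy
    · rw [stdBump_eq_one hy]; simp
    · rw [hs y hy]; simp
  rw [h1]
  have hm1 := (continuous_fourier_of_integrable hk).aestronglyMeasurable (μ := volume)
  have hm2 := (𝓕⁻ (localize l F hF)).continuous.aestronglyMeasurable (μ := volume)
  -- For `q = 1`, the sup norm of an inverse transform is at most the `L¹` norm of the function. For
  -- `q = 2`, Cauchy–Schwarz and Plancherel are used.
  rcases hq with rfl | rfl
  · refine (enorm_integral_mul_le hm1 hm2 1 ⊤).trans ?_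
    gcongr
    refine le_trans ?_ (eLpNorm_localize_le l F hF 1)
    rw [eLpNorm_exponent_top]
    exact essSup_le_of_ae_le _ (Filter.Eventually.of_forall (enorm_fourierInv_schwartz_le _))
  · refine (enorm_integral_mul_le hm1 hm2 2 2).trans ?_
    gcongr
    rw [eLpNorm_two_fourierInv_schwartz]
    exact eLpNorm_localize_le l F hF 2

/-- The kernel form of a Fourier multiplier. -/
theorem pdo_fourier_eq {n : ℕ} {k : Eucl n → ℂ} (hk : Integrable k volume)
    (f : SchwartzMap (Eucl n) ℂ) (x : Eucl n) :
    pdo (fun _ ξ => 𝓕 k ξ) f x = ∫ y, k y * f (x - y) := by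
  have hi := integrable_pdoIntegrand_of_bound (σ := fun _ _ => 1) (x := x) (b := 1)
    aestronglyMeasurable_const (Filter.Eventually.of_forall fun _ => by simp) f
  have h1 := integral_fourier_mul_eq_flip hk hi
  have h2 : pdo (fun _ ξ => 𝓕 k ξ) f x = ∫ ξ, 𝓕 k ξ * pdoIntegrand (fun _ _ => 1) f x ξ := by
    refine integral_congr_ae (Filter.Eventually.of_forall fun ξ => ?_)
    simp only [pdoIntegrand]; ring
  rw [h2, h1]
  refine integral_congr_ae (Filter.Eventually.of_forall fun y => ?_)
  simp only
  congr 1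
  rw [← SymbolScale.pdo_one f (x - y), Real.fourier_eq', pdo]
  refine integral_congr_ae (Filter.Eventually.of_forall fun ξ => ?_)
  simp only [pdoIntegrand, smul_eq_mul, one_mul]
  rw [← mul_assoc, ← Complex.exp_add, inner_sub_right]
  congr 2
  push_cast; ring

/-- The `L^p` average of `f` over the ball of radius `r` about `x`. -/
def ballAverage {n : ℕ} (r : ℝ) (p : ℝ≥0∞) (f : Eucl n → ℂ) (x : Eucl n) : ℝ≥0∞ :=
  (volume (Metric.ball (0 : Eucl n) r)) ^ (-(1 / p.toReal)) *
    eLpNorm (fun y => f (x - y)) p (volume.restrict (Metric.ball 0 r))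

theorem measurable_ballAverage {n : ℕ} (r : ℝ) {p : ℝ≥0∞} (hp : 1 ≤ p) (hp' : p ≠ ⊤)
    {f : Eucl n → ℂ} (hf : Continuous f) : Measurable (ballAverage r p f) := by
  have hp0 : p ≠ 0 := (zero_lt_one.trans_le hp).ne'
  unfold ballAverage
  simp_rw [eLpNorm_eq_lintegral_rpow_enorm_toReal hp0 hp']
  refine Measurable.const_mul (Measurable.pow_const ?_ _) _
  refine Measurable.lintegral_prod_right' (f := fun z : Eucl n × Eucl n => ‖f (z.1 - z.2)‖ₑ ^ p.toReal) ?_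
  exact (Continuous.enorm (by fun_prop)).measurable.pow_const _

/-- The `p`-th power of the average is a mean of translates of `|f|^p`, and Fubini with translation
invariance integrates it. -/
theorem eLpNorm_ballAverage_le {n : ℕ} {r : ℝ} (hr : 0 < r) {p : ℝ≥0∞} (hp : 1 ≤ p) (hp' : p ≠ ⊤)
    {f : Eucl n → ℂ} (hf : Continuous f) :
    eLpNorm (ballAverage r p f) p volume ≤ eLpNorm f p volume := by
  have hp0 : p ≠ 0 := (zero_lt_one.trans_le hp).ne'
  have hpos : 0 < p.toReal := ENNReal.toReal_pos hp0 hp'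
  set v := volume (Metric.ball (0 : Eucl n) r) with hv
  have hv0 : v ≠ 0 := (Metric.measure_ball_pos volume _ hr).ne'
  have hvt : v ≠ ⊤ := measure_ball_lt_top.ne
  rw [eLpNorm_eq_lintegral_rpow_enorm_toReal hp0 hp',
    eLpNorm_eq_lintegral_rpow_enorm_toReal hp0 hp' (f := f)]
  refine ENNReal.rpow_le_rpow ?_ (by positivity)
  have hpt : ∀ x, ‖ballAverage r p f x‖ₑ ^ p.toReal =
      v⁻¹ * ∫⁻ y in Metric.ball 0 r, ‖f (x - y)‖ₑ ^ p.toReal := by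
    intro x
    rw [enorm_eq_self, ballAverage, ENNReal.mul_rpow_of_nonneg _ _ hpos.le, ← ENNReal.rpow_mul,
      eLpNorm_eq_lintegral_rpow_enorm_toReal hp0 hp', ← ENNReal.rpow_mul,
      one_div_mul_cancel hpos.ne', ENNReal.rpow_one, neg_mul, one_div_mul_cancel hpos.ne',
      ENNReal.rpow_neg_one]
  simp_rw [hpt]
  rw [lintegral_const_mul' _ _ (ENNReal.inv_ne_top.2 hv0), lintegral_lintegral_swap]
  · have : ∀ y, ∫⁻ x, ‖f (x - y)‖ₑ ^ p.toReal = ∫⁻ x, ‖f x‖ₑ ^ p.toReal := fun y =>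
      lintegral_sub_right_eq_self (fun x => ‖f x‖ₑ ^ p.toReal) y
    simp_rw [this]
    rw [lintegral_const, Measure.restrict_apply_univ, ← hv, mul_comm (lintegral _ _), ← mul_assoc,
      ENNReal.inv_mul_cancel hv0 hvt, one_mul]
  · exact ((Continuous.enorm (by fun_prop)).measurable.pow_const _).aemeasurable

/-- Hölder on the ball produces the volume to the power `1/q - 1/p`; the normalization of the
average absorbs the part `-1/p`. -/
theorem eLpNorm_ball_le_ballAverage {n : ℕ} {r : ℝ} (hr : 0 < r) {p q : ℝ≥0∞} (hqp : q ≤ p)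
    {f : Eucl n → ℂ} (hf : Continuous f) (x : Eucl n) :
    eLpNorm (fun y => f (x - y)) q (volume.restrict (Metric.ball 0 r)) ≤
      volume (Metric.ball (0 : Eucl n) r) ^ (1 / q.toReal) * ballAverage r p f x := by
  have hv0 : volume (Metric.ball (0 : Eucl n) r) ≠ 0 := (Metric.measure_ball_pos volume _ hr).ne'
  have hvt : volume (Metric.ball (0 : Eucl n) r) ≠ ⊤ := measure_ball_lt_top.ne
  refine (eLpNorm_le_eLpNorm_mul_rpow_measure_univ hqp
    (Continuous.aestronglyMeasurable (by fun_prop))).trans (le_of_eq ?_)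
  rw [Measure.restrict_apply_univ, ballAverage, ← mul_assoc, ← ENNReal.rpow_add _ _ hv0 hvt,
    mul_comm, sub_eq_add_neg]

/-- The constant in the bounds for band-limited functions. -/
def bandConst (n : ℕ) (q : ℝ≥0∞) : NNReal :=
  ((2 ^ n * volume (Metric.ball (0 : Eucl n) 1)) ^ (1 / q.toReal)).toNNReal

/-- The exponent `s = n/q` is chosen so that the weight `2^{ls}` is a ball volume to the power
`1/q`. The `2^n` in `bandConst` accounts for the radius `2^{l+1}`. -/
theorem volume_ball_rpow {n : ℕ} (hn : 1 ≤ n) {q : ℝ≥0∞} {s : ℝ} (hs : s = n / q.toReal) (l : ℤ) :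
    volume (Metric.ball (0 : Eucl n) ((2 : ℝ) ^ (l + 1))) ^ (1 / q.toReal)
      = bandConst n q * dyadicWeight s l := by
  have : Nonempty (Fin n) := ⟨⟨0, hn⟩⟩
  have hq : 0 ≤ 1 / q.toReal := by positivity
  rw [Measure.addHaar_ball _ _ (by positivity), finrank_euclideanSpace_fin, bandConst,
    ENNReal.coe_toNNReal (ENNReal.rpow_ne_top_of_nonneg hq (ENNReal.mul_ne_top (by simp)
      measure_ball_lt_top.ne)), dyadicWeight, hs, ENNReal.mul_rpow_of_nonneg _ _ hq,
      ENNReal.mul_rpow_of_nonneg _ _ hq]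
  have e1 : ENNReal.ofReal (((2 : ℝ) ^ (l + 1)) ^ n) ^ (1 / q.toReal)
      = (2 ^ n : ℝ≥0∞) ^ (1 / q.toReal) * ENNReal.ofReal (2 ^ ((l : ℝ) * (n / q.toReal))) := by
    have e2 : (2 ^ n : ℝ≥0∞) = ENNReal.ofReal (2 ^ n) := by
      rw [ENNReal.ofReal_pow (by norm_num)]; simp
    rw [e2, ENNReal.ofReal_rpow_of_pos (by positivity), ENNReal.ofReal_rpow_of_pos (by positivity),
      ← ENNReal.ofReal_mul (by positivity)]
    congr 1
    rw [zpow_add_one₀ two_ne_zero, mul_pow, Real.mul_rpow (x := ((2 : ℝ) ^ l) ^ n) (by positivity)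
        (by positivity), mul_comm]
    congr 1
    rw [← Real.rpow_intCast, ← Real.rpow_natCast, ← Real.rpow_mul (by positivity),
      ← Real.rpow_mul (by norm_num)]
    congr 1; ring
  rw [e1]; ring

/-- Bernstein and domination are the same pairing estimate, tested on a unimodular exponential and
on `y ↦ f (x - y)` respectively. -/
theorem bandLimited_scale {n : ℕ} (hn : 1 ≤ n) {p q : ℝ≥0∞} (hq : q = 1 ∨ q = 2) (hqp : q ≤ p)
    (hp' : p ≠ ⊤) {s : ℝ} (hs : s = n / q.toReal) :
    SymbolScale (volume : Measure (Eucl n)) id q p s (bandLimited n) (bandConst n q) where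
  quasiMeasurePreserving := Measure.QuasiMeasurePreserving.id _
  mono := bandLimited_mono n
  mul_mem := bandLimited_mul
  measurable := by
    rintro l g ⟨k, hk, -, rfl⟩
    exact (continuous_fourier_of_integrable hk).measurable
  bernstein := by
    rintro l g ⟨k, hk, hsupp, rfl⟩ ξ
    have hF : ContDiff ℝ ∞ fun y : Eucl n =>
        Complex.exp (((-2 * Real.pi * inner ℝ y ξ : ℝ) : ℂ) * Complex.I) := by
      apply ContDiff.cexp
      apply ContDiff.mul _ contDiff_const
      apply Complex.ofRealCLM.contDiff.comp
      exact contDiff_const.mul (contDiff_id.inner ℝ contDiff_const)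
    have h1 := enorm_integral_mul_smooth_le hk hsupp hF hq
    have h2 : 𝓕 k ξ = ∫ y, k y * Complex.exp (((-2 * Real.pi * inner ℝ y ξ : ℝ) : ℂ) * Complex.I) := by
      rw [Real.fourier_eq']
      refine integral_congr_ae (Filter.Eventually.of_forall fun y => ?_)
      simp only [smul_eq_mul, mul_comm]
    rw [h2]
    refine h1.trans ?_
    have hq0 : q ≠ 0 := by rcases hq with rfl | rfl <;> simp
    have hqt : q ≠ ⊤ := by rcases hq with rfl | rfl <;> simp
    have h3 : eLpNorm (fun y : Eucl n =>
        Complex.exp (((-2 * Real.pi * inner ℝ y ξ : ℝ) : ℂ) * Complex.I)) q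
        (volume.restrict (Metric.ball 0 ((2 : ℝ) ^ (l + 1)))) =
        volume (Metric.ball (0 : Eucl n) ((2 : ℝ) ^ (l + 1))) ^ (1 / q.toReal) := by
      rw [eLpNorm_eq_lintegral_rpow_enorm_toReal hq0 hqt]
      simp_rw [← ofReal_norm (Complex.exp _), Complex.norm_exp_ofReal_mul_I]
      simp
    rw [h3, volume_ball_rpow hn hs]
    refine le_of_eq ?_
    ring
  dominated := by
    intro f l
    have hp : 1 ≤ p := le_trans (by rcases hq with rfl | rfl <;> norm_num) hqp
    refine ⟨ballAverage (2 ^ (l + 1)) p f, (measurable_ballAverage _ hp hp' f.continuous).aemeasurable,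
      eLpNorm_ballAverage_le (by positivity) hp hp' f.continuous, ?_⟩
    rintro g ⟨k, hk, hsupp, rfl⟩ - x
    have hF : ContDiff ℝ ∞ fun y : Eucl n => f (x - y) :=
      (f.smooth ⊤).comp (contDiff_const.sub contDiff_id)
    simp only [id]
    rw [pdo_fourier_eq hk]
    refine (enorm_integral_mul_smooth_le hk hsupp hF hq).trans ?_
    refine (mul_le_mul_right (eLpNorm_ball_le_ballAverage (by positivity) hqp f.continuous x) _).trans
      (le_of_eq ?_)
    rw [volume_ball_rpow hn hs]
    ring

/-! ### Functions vanishing at infinity in the averaged sense -/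

/-- The averaged vanishing condition on the slices of a symbol. -/
structure VanishesOnAverage {n : ℕ} (g : Eucl n → ℂ) : Prop where
  measurable : Measurable g
  integrableOn : ∀ ε : ℝ, 0 < ε → IntegrableOn g {ξ | ε ≤ ‖g ξ‖} volume

theorem IsSymbol.vanishesOnAverage {n : ℕ} {σ : Eucl n → Eucl n → ℂ} (h : IsSymbol σ) (x : Eucl n) :
    VanishesOnAverage (σ x) :=
  ⟨h.measurable.of_uncurry_left, h.vanishing x⟩

namespace VanishesOnAverage

variable {n : ℕ} {g : Eucl n → ℂ}

/-- Truncation at height `ε`. The averaged vanishing condition is used only through this splitting.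
-/
theorem exists_split (hg : VanishesOnAverage g) {ε : ℝ} (hε : 0 < ε) :
    ∃ g₁ g₂ : Eucl n → ℂ, (∀ ξ, g ξ = g₁ ξ + g₂ ξ) ∧ Integrable g₁ volume ∧ Measurable g₂ ∧
      ∀ ξ, ‖g₂ ξ‖ ≤ ε := by
  have hS : MeasurableSet {ξ | ε ≤ ‖g ξ‖} := measurableSet_le measurable_const hg.measurable.norm
  refine ⟨{ξ | ε ≤ ‖g ξ‖}.indicator g, {ξ | ε ≤ ‖g ξ‖}ᶜ.indicator g, fun ξ => ?_,
    (integrable_indicator_iff hS).2 (hg.integrableOn ε hε), hg.measurable.indicator hS.compl,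
    fun ξ => ?_⟩
  · exact (congrFun (Set.indicator_self_add_compl {ξ | ε ≤ ‖g ξ‖} g) ξ).symm
  · by_cases h : ξ ∈ {ξ | ε ≤ ‖g ξ‖}
    · rw [Set.indicator_of_notMem (by simpa using h)]; simpa using hε.le
    · rw [Set.indicator_of_mem (by exact h)]
      exact (not_le.1 h).le

theorem integrable_mul (hg : VanishesOnAverage g) {u : Eucl n → ℂ} (hu : Integrable u volume)
    {B : ℝ} (hB : ∀ ξ, ‖u ξ‖ ≤ B) : Integrable (fun ξ => u ξ * g ξ) volume := by
  obtain ⟨g₁, g₂, h, h1, h2, h3⟩ := hg.exists_split one_pos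
  simp_rw [h, mul_add]
  exact (h1.bdd_mul hu.aestronglyMeasurable (Filter.Eventually.of_forall hB)).add
    (hu.mul_bdd (c := 1) h2.aestronglyMeasurable (Filter.Eventually.of_forall h3))

/-- This licenses Fubini for the filters: against the integrable part of `g` the kernel `v` is
bounded, and against the bounded part `u` and `v` give an integrable convolution integrand. -/
theorem integrable_prod (hg : VanishesOnAverage g) {u : Eucl n → ℂ} (hu : Integrable u volume)
    (v : SchwartzMap (Eucl n) ℂ) :
    Integrable (fun z : Eucl n × Eucl n => u z.1 * (v (z.1 - z.2) * g z.2))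
      (volume.prod volume) := by
  obtain ⟨g₁, g₂, h, h1, h2, h3⟩ := hg.exists_split one_pos
  have hv : Continuous fun z : Eucl n × Eucl n => v (z.1 - z.2) := by fun_prop
  have e : (fun z : Eucl n × Eucl n => u z.1 * (v (z.1 - z.2) * g z.2)) = fun z =>
      v (z.1 - z.2) * (u z.1 * g₁ z.2) + (u z.1 * v (z.1 - z.2)) * g₂ z.2 := by
    ext z; rw [h]; ring
  rw [e]
  refine Integrable.add ?_ ?_
  · exact (hu.mul_prod h1).bdd_mul hv.aestronglyMeasurable
      (Filter.Eventually.of_forall fun z => v.norm_le_seminorm ℝ _)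
  · refine Integrable.mul_bdd (c := 1) ?_ (h2.comp measurable_snd).aestronglyMeasurable
      (Filter.Eventually.of_forall fun z => h3 z.2)
    have := Integrable.convolution_integrand (ContinuousLinearMap.mul ℂ ℂ)
      (μ := (volume : Measure (Eucl n))) hu (v.integrable.comp_neg)
    have := this.swap
    simpa [Function.comp_def] using this

end VanishesOnAverage

/-! ### Low-pass filters -/

/-- The cutoff `χ(2^{-l}·)` as a Schwartz function. -/
def cutoffSchwartz {n : ℕ} {χ : Eucl n → ℝ} (hχ : IsLPCutoff χ) (l : ℤ) :
    SchwartzMap (Eucl n) ℂ :=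
  HasCompactSupport.toSchwartzMap (f := fun y => (χ ((2 : ℝ) ^ (-l) • y) : ℂ))
    (HasCompactSupport.intro (isCompact_closedBall (0 : Eucl n) ((2 : ℝ) ^ (l + 1))) fun y hy => by
      rw [mem_closedBall_zero_iff, not_le] at hy
      rw [hχ.eq_zero, Complex.ofReal_zero]
      rw [norm_two_zpow_neg_smul, lt_inv_mul_iff₀ (by positivity), ← zpow_add_one₀ (by norm_num)]
      exact hy)
    (Complex.ofRealCLM.contDiff.comp (hχ.smooth.comp (contDiff_const_smul _)))

theorem cutoffSchwartz_apply {n : ℕ} {χ : Eucl n → ℝ} (hχ : IsLPCutoff χ) (l : ℤ) (y : Eucl n) :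
    cutoffSchwartz hχ l y = (χ ((2 : ℝ) ^ (-l) • y) : ℂ) := rfl

theorem cutoffSchwartz_eq_zero {n : ℕ} {χ : Eucl n → ℝ} (hχ : IsLPCutoff χ) {l : ℤ} {y : Eucl n}
    (hy : (2 : ℝ) ^ (l + 1) < ‖y‖) : cutoffSchwartz hχ l y = 0 := by
  rw [cutoffSchwartz_apply, hχ.eq_zero, Complex.ofReal_zero]
  rw [norm_two_zpow_neg_smul, lt_inv_mul_iff₀ (by positivity), ← zpow_add_one₀ (by norm_num)]
  exact hy

theorem cutoffSchwartz_eq_one {n : ℕ} {χ : Eucl n → ℝ} (hχ : IsLPCutoff χ) {l : ℤ} {y : Eucl n}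
    (hy : ‖y‖ ≤ (2 : ℝ) ^ l) : cutoffSchwartz hχ l y = 1 := by
  rw [cutoffSchwartz_apply, hχ.eq_one, Complex.ofReal_one]
  rw [norm_two_zpow_neg_smul, inv_mul_le_iff₀ (by positivity)]; simpa using hy

theorem fourier_comp_two_zpow_neg_smul {n : ℕ} (u : Eucl n → ℂ) (l : ℤ) (x : Eucl n) :
    𝓕 (fun ζ => u ((2 : ℝ) ^ (-l) • ζ)) x = (2 : ℂ) ^ (l * (n : ℤ)) * 𝓕 u ((2 : ℝ) ^ l • x) := by
  rw [Real.fourier_eq', Real.fourier_eq']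
  have h := Measure.integral_comp_smul (volume : Measure (Eucl n)) (fun w =>
    Complex.exp (((-2 * Real.pi * inner ℝ w ((2 : ℝ) ^ l • x) : ℝ) : ℂ) * Complex.I) • u w)
    ((2 : ℝ) ^ (-l))
  have e : ∀ v : Eucl n, inner ℝ ((2 : ℝ) ^ (-l) • v) ((2 : ℝ) ^ l • x) = inner ℝ v x := by
    intro v
    rw [real_inner_smul_left, real_inner_smul_right, ← mul_assoc, ← zpow_add₀ (by norm_num)]
    simp
  simp only [e] at h
  rw [h, finrank_euclideanSpace_fin, Complex.real_smul]
  congr 1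
  rw [abs_of_pos (by positivity), zpow_neg, inv_pow, inv_inv]
  push_cast
  rw [zpow_mul, zpow_natCast]

/-- The low-pass filter with frequency cutoff at `2^l`. -/
def lowPass {n : ℕ} {χ : Eucl n → ℝ} (hχ : IsLPCutoff χ) (l : ℤ) (g : Eucl n → ℂ) (ξ : Eucl n) : ℂ :=
  ∫ η, (𝓕 (cutoffSchwartz hχ l)) (ξ - η) * g η

/-- The cutoff to the frequency shell of radius `2^l`. -/
def shellSchwartz {n : ℕ} {χ : Eucl n → ℝ} (hχ : IsLPCutoff χ) (l : ℤ) : SchwartzMap (Eucl n) ℂ :=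
  cutoffSchwartz hχ l - cutoffSchwartz hχ (l - 1)

theorem lpProj_eq {n : ℕ} {χ : Eucl n → ℝ} (hχ : IsLPCutoff χ) (l : ℤ) (g : Eucl n → ℂ)
    (ξ : Eucl n) : lpProj χ l g ξ = ∫ η, (𝓕 (shellSchwartz hχ l)) (ξ - η) * g η := by
  have e : (fun ζ => (lpBump χ ((2 : ℝ) ^ (-l) • ζ) : ℂ)) = shellSchwartz hχ l := by
    ext ζ
    rw [shellSchwartz, sub_apply, cutoffSchwartz_apply, cutoffSchwartz_apply, lpBump,
      smul_smul, show -(l - 1) = 1 + -l by ring, zpow_add₀ (by norm_num), zpow_one]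
    push_cast; rfl
  rw [lpProj, ← integral_const_mul]
  refine integral_congr_ae (Filter.Eventually.of_forall fun η => ?_)
  simp only
  rw [← mul_assoc, ← fourier_comp_two_zpow_neg_smul (fun ζ => (lpBump χ ζ : ℂ)),
    SchwartzMap.fourier_coe, ← e]

theorem integrable_schwartz_sub_mul {n : ℕ} {g : Eucl n → ℂ} (hg : VanishesOnAverage g)
    (v : SchwartzMap (Eucl n) ℂ) (ξ : Eucl n) : Integrable (fun η => v (ξ - η) * g η) volume :=
  hg.integrable_mul (v.integrable.comp_sub_left ξ) fun _ => v.norm_le_seminorm ℝ _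

/-- The shell is a difference of consecutive cutoffs, so partial sums of the `P_l` telescope. -/
theorem lpProj_eq_sub {n : ℕ} {χ : Eucl n → ℝ} (hχ : IsLPCutoff χ) (l : ℤ) {g : Eucl n → ℂ}
    (hg : VanishesOnAverage g) (ξ : Eucl n) :
    lpProj χ l g ξ = lowPass hχ l g ξ - lowPass hχ (l - 1) g ξ := by
  rw [lpProj_eq hχ, lowPass, lowPass, ← integral_sub (integrable_schwartz_sub_mul hg _ _)
    (integrable_schwartz_sub_mul hg _ _)]
  refine integral_congr_ae (Filter.Eventually.of_forall fun η => ?_)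
  simp only [shellSchwartz]
  rw [sub_eq_add_neg, FourierTransform.fourier_add, FourierTransform.fourier_neg]
  simp only [add_apply, neg_apply]
  ring

theorem fourier_fourier_schwartz {n : ℕ} (c : SchwartzMap (Eucl n) ℂ) (y : Eucl n) :
    (𝓕 (𝓕 c)) y = c (-y) := by
  have h : (𝓕⁻ (𝓕 c)) (-y) = c (-y) := by rw [FourierTransform.fourierInv_fourier_eq]
  rw [← h, SchwartzMap.fourierInv_coe, Real.fourierInv_eq_fourier_neg, neg_neg, SchwartzMap.fourier_coe]

/-- On the Fourier side the convolution becomes the product `c * d`, which equals `d`. -/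
theorem integral_fourier_sub_mul_fourier_sub {n : ℕ} (c d : SchwartzMap (Eucl n) ℂ)
    (hcd : ∀ y, c y * d y = d y) (ξ ζ : Eucl n) :
    ∫ η, (𝓕 c) (ξ - η) * (𝓕 d) (η - ζ) = (𝓕 d) (ξ - ζ) := by
  have h1 : SchwartzMap.convolution (ContinuousLinearMap.mul ℂ ℂ) (𝓕 c) (𝓕 d) = 𝓕 d := by
    have h2 : 𝓕 (SchwartzMap.convolution (ContinuousLinearMap.mul ℂ ℂ) (𝓕 c) (𝓕 d)) =
        𝓕 (𝓕 d) := by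
      rw [SchwartzMap.fourier_convolution]
      ext y
      rw [SchwartzMap.pairing_apply_apply,
        fourier_fourier_schwartz, fourier_fourier_schwartz]
      exact hcd _
    have h3 := congrArg (fun u : SchwartzMap (Eucl n) ℂ => (𝓕⁻ u : SchwartzMap (Eucl n) ℂ)) h2
    simpa only [FourierTransform.fourierInv_fourier_eq] using h3
  have h2 := congrArg (fun u : SchwartzMap (Eucl n) ℂ => u (ξ - ζ)) h1
  simp only [SchwartzMap.convolution_apply] at h2
  rw [← h2, convolution_def, ← integral_sub_left_eq_self _ volume ξ]
  refine integral_congr_ae (Filter.Eventually.of_forall fun η => ?_)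
  simp only [ContinuousLinearMap.mul_apply']
  rw [show ξ - η - ζ = ξ - ζ - η by abel, sub_sub_cancel]

/-- The cutoff at level `l + 1` equals `1` on the shell of level `l`. This reproducing identity
records the frequency support of `lpProj χ l g` without a Fourier transform of `g`, which need not
be integrable. -/
theorem lowPass_succ_lpProj {n : ℕ} {χ : Eucl n → ℝ} (hχ : IsLPCutoff χ) (l : ℤ) {g : Eucl n → ℂ}
    (hg : VanishesOnAverage g) (ξ : Eucl n) :
    lowPass hχ (l + 1) (lpProj χ l g) ξ = lpProj χ l g ξ := by
  have hcd : ∀ y, cutoffSchwartz hχ (l + 1) y * shellSchwartz hχ l y = shellSchwartz hχ l y := by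
    intro y
    rcases le_or_gt ‖y‖ ((2 : ℝ) ^ (l + 1)) with hy | hy
    · rw [cutoffSchwartz_eq_one hχ hy, one_mul]
    · have h1 := cutoffSchwartz_eq_zero hχ hy
      have h2 : cutoffSchwartz hχ (l - 1) y = 0 := by
        refine cutoffSchwartz_eq_zero hχ (lt_trans ?_ hy)
        exact zpow_lt_zpow_right₀ (by norm_num) (by lia)
      rw [shellSchwartz, sub_apply, h1, h2]; simp
  rw [lowPass]
  simp_rw [lpProj_eq hχ, ← integral_const_mul]
  rw [integral_integral_swap]
  · refine integral_congr_ae (Filter.Eventually.of_forall fun ζ => ?_)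
    simp only
    simp_rw [← mul_assoc]
    rw [integral_mul_const, integral_fourier_sub_mul_fourier_sub _ _ hcd]
  · exact hg.integrable_prod ((𝓕 (cutoffSchwartz hχ (l + 1))).integrable.comp_sub_left ξ) _

theorem integral_schwartz_mul_fourier_neg {n : ℕ} {G : Eucl n → ℂ} (hG : Integrable G volume)
    (ψ : SchwartzMap (Eucl n) ℂ) : ∫ y, ψ y * 𝓕 G (-y) = ∫ ξ, (𝓕⁻ ψ) ξ * G ξ := by
  have h1 := integral_fourier_mul_eq_flip hG (ψ.integrable.comp_neg)
  rw [← integral_neg_eq_self]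
  simp_rw [mul_comm (ψ _), neg_neg]
  rw [h1]
  refine integral_congr_ae (Filter.Eventually.of_forall fun ξ => ?_)
  simp only
  rw [mul_comm, SchwartzMap.fourierInv_coe, Real.fourierInv_eq_fourier_comp_neg]

theorem integral_schwartz_mul_fourierInv_toLp {n : ℕ} {G : Eucl n → ℂ} (hG : MemLp G 2 volume)
    (ψ : SchwartzMap (Eucl n) ℂ) :
    ∫ y, ψ y * (𝓕⁻ (hG.toLp G) : Lp ℂ 2 (volume : Measure (Eucl n))) y =
      ∫ ξ, (𝓕⁻ ψ) ξ * G ξ := by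
  have h1 := Lp.fourierInv_toTemperedDistribution_eq (hG.toLp G)
  have h2 := congrArg (fun T : TemperedDistribution (Eucl n) ℂ => T ψ) h1
  simp only [TemperedDistribution.fourierInv_apply, Lp.toTemperedDistribution_apply,
    smul_eq_mul] at h2
  rw [← h2]
  refine integral_congr_ae ?_
  filter_upwards [hG.coeFn_toLp] with ξ hξ
  rw [hξ]

/-- `h` stands for the inverse Fourier transform of `G`: a bounded continuous function if `q = 1`,
Plancherel's `L²` function if `q = 2`. Only its pairing with Schwartz functions matters later. -/
theorem exists_fourierInv_pairing {n : ℕ} {q : ℝ≥0∞} (hq : q = 1 ∨ q = 2) {G : Eucl n → ℂ}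
    (hG : MemLp G q volume) : ∃ h : Eucl n → ℂ, ∀ ψ : SchwartzMap (Eucl n) ℂ,
      Integrable (fun y => ψ y * h y) volume ∧ ∫ y, ψ y * h y = ∫ ξ, (𝓕⁻ ψ) ξ * G ξ := by
  rcases hq with rfl | rfl
  · have hG' := memLp_one_iff_integrable.1 hG
    have hc := continuous_fourier_of_integrable hG'
    refine ⟨fun y => 𝓕 G (-y), fun ψ => ⟨?_, integral_schwartz_mul_fourier_neg hG' ψ⟩⟩
    refine ψ.integrable.mul_bdd (c := ∫ v, ‖G v‖) (hc.comp continuous_neg).aestronglyMeasurable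
      (Filter.Eventually.of_forall fun y => ?_)
    exact VectorFourier.norm_fourierIntegral_le_integral_norm _ _ _ _ _
  · refine ⟨(𝓕⁻ (hG.toLp G) : Lp ℂ 2 (volume : Measure (Eucl n))), fun ψ => ⟨?_,
      integral_schwartz_mul_fourierInv_toLp hG ψ⟩⟩
    exact MemLp.integrable_mul (p := 2) (q := 2) (ψ.memLp 2 volume) (Lp.memLp _)

/-- Modulation of a cutoff. -/
def modulatedCutoff {n : ℕ} {χ : Eucl n → ℝ} (hχ : IsLPCutoff χ) (l : ℤ) (ξ : Eucl n) :
    SchwartzMap (Eucl n) ℂ :=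
  HasCompactSupport.toSchwartzMap
    (f := fun y => Complex.exp (((-2 * Real.pi * inner ℝ y ξ : ℝ) : ℂ) * Complex.I) *
      (χ ((2 : ℝ) ^ (-l) • y) : ℂ))
    (HasCompactSupport.intro (isCompact_closedBall (0 : Eucl n) ((2 : ℝ) ^ (l + 1))) fun y hy => by
      rw [mem_closedBall_zero_iff, not_le] at hy
      rw [← cutoffSchwartz_apply hχ, cutoffSchwartz_eq_zero hχ hy, mul_zero])
    (ContDiff.mul (by
      apply ContDiff.cexp
      apply ContDiff.mul _ contDiff_const
      apply Complex.ofRealCLM.contDiff.comp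
      exact contDiff_const.mul (contDiff_id.inner ℝ contDiff_const))
      (Complex.ofRealCLM.contDiff.comp (hχ.smooth.comp (contDiff_const_smul _))))

theorem modulatedCutoff_apply {n : ℕ} {χ : Eucl n → ℝ} (hχ : IsLPCutoff χ) (l : ℤ)
    (ξ y : Eucl n) : modulatedCutoff hχ l ξ y =
      Complex.exp (((-2 * Real.pi * inner ℝ y ξ : ℝ) : ℂ) * Complex.I) * cutoffSchwartz hχ l y := rfl

theorem fourierInv_modulatedCutoff {n : ℕ} {χ : Eucl n → ℝ} (hχ : IsLPCutoff χ) (l : ℤ)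
    (ξ η : Eucl n) : (𝓕⁻ (modulatedCutoff hχ l ξ)) η = (𝓕 (cutoffSchwartz hχ l)) (ξ - η) := by
  rw [SchwartzMap.fourierInv_coe, SchwartzMap.fourier_coe, Real.fourierInv_eq', Real.fourier_eq']
  refine integral_congr_ae (Filter.Eventually.of_forall fun y => ?_)
  simp only [modulatedCutoff_apply, smul_eq_mul]
  rw [← mul_assoc, ← Complex.exp_add, inner_sub_right]
  congr 2
  push_cast; ring

/-- A reproduced `G` is the transform of the cutoff times its inverse transform. That product is
integrable and compactly supported, even when the inverse transform is merely in `L²`. -/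
theorem lowPass_fixed_mem_bandLimited {n : ℕ} {χ : Eucl n → ℝ} (hχ : IsLPCutoff χ) {l : ℤ}
    {q : ℝ≥0∞} (hq : q = 1 ∨ q = 2) {G : Eucl n → ℂ} (hG : MemLp G q volume)
    (hfix : ∀ ξ, lowPass hχ l G ξ = G ξ) : G ∈ bandLimited n (l + 1) := by
  obtain ⟨h, hh⟩ := exists_fourierInv_pairing hq hG
  refine ⟨fun y => cutoffSchwartz hχ l y * h y, (hh _).1, fun y hy => ?_, ?_⟩
  · simp only [cutoffSchwartz_eq_zero hχ hy, zero_mul]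
  · ext ξ
    have h1 := (hh (modulatedCutoff hχ l ξ)).2
    simp_rw [fourierInv_modulatedCutoff] at h1
    rw [← hfix, lowPass, ← h1, Real.fourier_eq']
    refine integral_congr_ae (Filter.Eventually.of_forall fun y => ?_)
    simp only [modulatedCutoff_apply, smul_eq_mul]
    ring

theorem aestronglyMeasurable_lpProj {n : ℕ} {χ : Eucl n → ℝ} (hχ : IsLPCutoff χ) (l : ℤ)
    {g : Eucl n → ℂ} (hg : Measurable g) : AEStronglyMeasurable (lpProj χ l g) volume := by
  have : StronglyMeasurable fun ξ => ∫ η, (𝓕 (shellSchwartz hχ l)) (ξ - η) * g η := by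
    refine StronglyMeasurable.integral_prod_right (ν := volume) (f := fun ξ η =>
      (𝓕 (shellSchwartz hχ l)) (ξ - η) * g η) ?_
    refine Measurable.stronglyMeasurable ?_
    have hc : Continuous fun z : Eucl n × Eucl n => (𝓕 (shellSchwartz hχ l)) (z.1 - z.2) := by
      fun_prop
    exact hc.measurable.mul (hg.comp measurable_snd)
  refine this.aestronglyMeasurable.congr (Filter.Eventually.of_forall fun ξ => ?_)
  exact (lpProj_eq hχ l g ξ).symm

/-- The level is `l + 2` because the reproducing filter sits at `l + 1` and its cutoff reaches out
to twice that radius. -/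
theorem lpProj_mem_bandLimited {n : ℕ} {χ : Eucl n → ℝ} (hχ : IsLPCutoff χ) {l : ℤ}
    {q : ℝ≥0∞} (hq : q = 1 ∨ q = 2) {g : Eucl n → ℂ} (hg : VanishesOnAverage g)
    (hfin : eLpNorm (lpProj χ l g) q volume < ⊤) : lpProj χ l g ∈ bandLimited n (l + 2) := by
  rw [show l + 2 = l + 1 + 1 by ring]
  exact lowPass_fixed_mem_bandLimited hχ (l := l + 1) hq
    ⟨aestronglyMeasurable_lpProj hχ l hg.measurable, hfin⟩
    (lowPass_succ_lpProj hχ l hg)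

/-! ### Convergence of low-pass filters -/

theorem fourier_cutoffSchwartz_scale {n : ℕ} {χ : Eucl n → ℝ} (hχ : IsLPCutoff χ) (l : ℤ)
    (x : Eucl n) : (𝓕 (cutoffSchwartz hχ l)) x =
      (2 : ℂ) ^ (l * (n : ℤ)) * (𝓕 (cutoffSchwartz hχ 0)) ((2 : ℝ) ^ l • x) := by
  have e : (fun ζ => cutoffSchwartz hχ 0 ((2 : ℝ) ^ (-l) • ζ)) = cutoffSchwartz hχ l := by
    ext ζ
    simp [cutoffSchwartz_apply]
  rw [SchwartzMap.fourier_coe, SchwartzMap.fourier_coe, ← fourier_comp_two_zpow_neg_smul, e]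

theorem integral_norm_fourier_cutoffSchwartz {n : ℕ} {χ : Eucl n → ℝ} (hχ : IsLPCutoff χ) (l : ℤ) :
    ∫ x, ‖(𝓕 (cutoffSchwartz hχ l)) x‖ = ∫ x, ‖(𝓕 (cutoffSchwartz hχ 0)) x‖ := by
  have h := Measure.integral_comp_smul (volume : Measure (Eucl n))
    (fun x => ‖(𝓕 (cutoffSchwartz hχ 0)) x‖) ((2 : ℝ) ^ l)
  simp_rw [fourier_cutoffSchwartz_scale hχ l, norm_mul]
  rw [integral_const_mul, h, finrank_euclideanSpace_fin, abs_of_pos (by positivity), smul_eq_mul,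
    ← mul_assoc, norm_zpow, Complex.norm_ofNat, zpow_mul, zpow_natCast, mul_inv_cancel₀ (by positivity),
    one_mul]

/-- The integrable part meets the height of the kernel, of order `2^{ln}`; the small part meets its
`L¹` norm, which does not depend on `l`. -/
theorem norm_lowPass_le {n : ℕ} {χ : Eucl n → ℝ} (hχ : IsLPCutoff χ) (l : ℤ)
    {g g₁ g₂ : Eucl n → ℂ} {ε : ℝ} (h : ∀ ξ, g ξ = g₁ ξ + g₂ ξ) (h1 : Integrable g₁ volume)
    (h2 : Measurable g₂) (h3 : ∀ ξ, ‖g₂ ξ‖ ≤ ε) (ξ : Eucl n) :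
    ‖lowPass hχ l g ξ‖ ≤ ((2 : ℝ) ^ l) ^ n *
      (SchwartzMap.seminorm ℝ 0 0 (𝓕 (cutoffSchwartz hχ 0)) * ∫ η, ‖g₁ η‖) +
      ε * ∫ x, ‖(𝓕 (cutoffSchwartz hχ 0)) x‖ := by
  set X := 𝓕 (cutoffSchwartz hχ l) with hX
  set B := SchwartzMap.seminorm ℝ 0 0 (𝓕 (cutoffSchwartz hχ 0)) with hB
  have hXb : ∀ x, ‖X x‖ ≤ ((2 : ℝ) ^ l) ^ n * B := by
    intro x
    rw [hX, fourier_cutoffSchwartz_scale, norm_mul, norm_zpow, Complex.norm_ofNat, zpow_mul,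
      zpow_natCast]
    gcongr
    exact SchwartzMap.norm_le_seminorm ℝ _ _
  have hXi : Integrable (fun η => X (ξ - η)) volume := X.integrable.comp_sub_left ξ
  have i1 : Integrable (fun η => X (ξ - η) * g₁ η) volume :=
    h1.bdd_mul hXi.aestronglyMeasurable (Filter.Eventually.of_forall fun η => hXb _)
  have i2 : Integrable (fun η => X (ξ - η) * g₂ η) volume :=
    hXi.mul_bdd (c := ε) h2.aestronglyMeasurable (Filter.Eventually.of_forall h3)
  have e : lowPass hχ l g ξ = (∫ η, X (ξ - η) * g₁ η) + ∫ η, X (ξ - η) * g₂ η := by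
    rw [← integral_add i1 i2]
    refine integral_congr_ae (Filter.Eventually.of_forall fun η => ?_)
    simp only [h, mul_add]; rfl
  rw [e]
  refine (norm_add_le _ _).trans (add_le_add ?_ ?_)
  · rw [← mul_assoc, ← integral_const_mul]
    refine (norm_integral_le_integral_norm _).trans (integral_mono i1.norm (h1.norm.const_mul _) ?_)
    intro η
    simp only [norm_mul]
    gcongr
    exact hXb _
  · rw [← integral_norm_fourier_cutoffSchwartz hχ l, ← integral_const_mul,
      ← integral_sub_left_eq_self (fun x => ε * ‖X x‖) volume ξ]
    refine (norm_integral_le_integral_norm _).trans (integral_mono i2.norm (hXi.norm.const_mul _) ?_)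
    intro η
    simp only [norm_mul]
    rw [mul_comm]
    gcongr
    exact h3 η

/-- As `l → -∞` the first term of the preceding bound decays like `2^{ln}`, and the second is as
small as desired. Vanishing on average is indispensable here: nonzero constants are fixed by every
low-pass filter. -/
theorem tendsto_lowPass_neg {n : ℕ} (hn : 1 ≤ n) {χ : Eucl n → ℝ} (hχ : IsLPCutoff χ)
    {g : Eucl n → ℂ} (hg : VanishesOnAverage g) (ξ : Eucl n) :
    Filter.Tendsto (fun N : ℕ => lowPass hχ (-(N : ℤ)) g ξ) Filter.atTop (nhds 0) := by
  rw [Metric.tendsto_atTop]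
  intro δ hδ
  set I := ∫ x, ‖(𝓕 (cutoffSchwartz hχ 0)) x‖
  have hI : 0 ≤ I := integral_nonneg fun _ => norm_nonneg _
  obtain ⟨g₁, g₂, h, h1, h2, h3⟩ := hg.exists_split (ε := δ / (2 * (I + 1))) (by positivity)
  set A := SchwartzMap.seminorm ℝ 0 0 (𝓕 (cutoffSchwartz hχ 0)) * ∫ η, ‖g₁ η‖
  have ht : Filter.Tendsto (fun N : ℕ => ((1 / 2 : ℝ) ^ n) ^ N * A) Filter.atTop (nhds 0) := by
    have := (tendsto_pow_atTop_nhds_zero_of_lt_one (r := (1 / 2 : ℝ) ^ n) (by positivity)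
      (pow_lt_one₀ (by norm_num) (by norm_num) (by lia))).mul_const A
    simpa using this
  obtain ⟨N₀, hN₀⟩ := (Filter.eventually_atTop.1 (ht.eventually_lt_const (half_pos hδ)))
  refine ⟨N₀, fun N hN => ?_⟩
  rw [dist_zero_right]
  refine (norm_lowPass_le hχ (-(N : ℤ)) h h1 h2 h3 ξ).trans_lt ?_
  have e1 : ((2 : ℝ) ^ (-(N : ℤ))) ^ n * A < δ / 2 := by
    have := hN₀ N hN
    rwa [← pow_mul, mul_comm n N, pow_mul, one_div, inv_pow, ← zpow_natCast (2 : ℝ) N,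
      ← zpow_neg] at this
  have e2 : δ / (2 * (I + 1)) * I ≤ δ / 2 := by
    rw [div_mul_eq_mul_div, div_le_div_iff₀ (by positivity) (by norm_num)]
    nlinarith
  linarith

theorem exists_bound_lowPass_neg {n : ℕ} {χ : Eucl n → ℝ} (hχ : IsLPCutoff χ)
    {g : Eucl n → ℂ} (hg : VanishesOnAverage g) :
    ∃ B : ℝ, ∀ (N : ℕ) ξ, ‖lowPass hχ (-(N : ℤ)) g ξ‖ ≤ B := by
  obtain ⟨g₁, g₂, h, h1, h2, h3⟩ := hg.exists_split one_pos
  refine ⟨_, fun N ξ => (norm_lowPass_le hχ (-(N : ℤ)) h h1 h2 h3 ξ).trans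
    (add_le_add_left (mul_le_of_le_one_left ?_ ?_) _)⟩
  · exact mul_nonneg (apply_nonneg _ _) (integral_nonneg fun _ => norm_nonneg _)
  · refine pow_le_one₀ (by positivity) ?_
    rw [zpow_neg, zpow_natCast]
    exact inv_le_one_of_one_le₀ (one_le_pow₀ (by norm_num))

theorem integral_mul_fourier_cutoff_sub {n : ℕ} {χ : Eucl n → ℝ} (hχ : IsLPCutoff χ) (l : ℤ)
    (u : Eucl n → ℂ) (η : Eucl n) :
    ∫ ξ, u ξ * (𝓕 (cutoffSchwartz hχ l)) (ξ - η) =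
      ∫ t, u (η + (2 : ℝ) ^ (-l) • t) * (𝓕 (cutoffSchwartz hχ 0)) t := by
  rw [← integral_add_right_eq_self _ η]
  have h := Measure.integral_comp_smul (volume : Measure (Eucl n))
    (fun t => u (η + (2 : ℝ) ^ (-l) • t) * (𝓕 (cutoffSchwartz hχ 0)) t) ((2 : ℝ) ^ l)
  have e : ∀ ξ, u (ξ + η) * (𝓕 (cutoffSchwartz hχ l)) (ξ + η - η) = (2 : ℂ) ^ (l * (n : ℤ)) *
      (u (η + (2 : ℝ) ^ (-l) • (2 : ℝ) ^ l • ξ) * (𝓕 (cutoffSchwartz hχ 0)) ((2 : ℝ) ^ l • ξ)) := by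
    intro ξ
    rw [add_sub_cancel_right, fourier_cutoffSchwartz_scale, smul_smul, ← zpow_add₀ (by norm_num),
      neg_add_cancel, zpow_zero, one_smul, add_comm η]
    ring
  simp_rw [e]
  rw [integral_const_mul, h, finrank_euclideanSpace_fin, abs_of_pos (by positivity),
    Complex.real_smul, ← mul_assoc]
  push_cast
  rw [zpow_mul, zpow_natCast, mul_inv_cancel₀ (pow_ne_zero _ (zpow_ne_zero _ two_ne_zero)), one_mul]

theorem integral_fourier_cutoff_zero {n : ℕ} {χ : Eucl n → ℝ} (hχ : IsLPCutoff χ) :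
    ∫ t, (𝓕 (cutoffSchwartz hχ 0)) t = 1 := by
  have h : (𝓕 (𝓕 (cutoffSchwartz hχ 0))) 0 = 1 := by
    rw [fourier_fourier_schwartz, neg_zero, cutoffSchwartz_eq_one hχ (by simp)]
  rw [← h, SchwartzMap.fourier_coe (𝓕 (cutoffSchwartz hχ 0)), Real.fourier_eq']
  refine integral_congr_ae (Filter.Eventually.of_forall fun t => ?_)
  simp

/-- The filter is an approximate identity, and Fubini moves it onto the test function `u`. Since `g`
is only integrable plus bounded, dominated convergence needs decay in `η` uniformly in `N`. -/
theorem tendsto_integral_mul_lowPass {n : ℕ} {χ : Eucl n → ℝ} (hχ : IsLPCutoff χ)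
    {g : Eucl n → ℂ} (hg : VanishesOnAverage g) {u : Eucl n → ℂ} (hu : Continuous u)
    (hus : HasCompactSupport u) :
    Filter.Tendsto (fun N : ℕ => ∫ ξ, u ξ * lowPass hχ N g ξ) Filter.atTop
      (nhds (∫ ξ, u ξ * g ξ)) := by
  set X := 𝓕 (cutoffSchwartz hχ 0) with hX
  obtain ⟨C, hC⟩ : ∃ C : ℝ, ∀ ξ, ‖u ξ‖ * (1 + ‖ξ‖) ^ (n + 1) ≤ C := by
    have hc : Continuous fun ξ : Eucl n => ((1 + ‖ξ‖ : ℝ) : ℂ) ^ (n + 1) * u ξ := by fun_prop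
    obtain ⟨C, hC⟩ := hc.bounded_above_of_compact_support hus.mul_left
    refine ⟨C, fun ξ => (le_of_eq ?_).trans (hC ξ)⟩
    rw [norm_mul, norm_pow, Complex.norm_real, Real.norm_of_nonneg (by positivity), mul_comm]
  have hXm : Integrable (fun t => (1 + ‖t‖) ^ (n + 1) * ‖X t‖) volume := by
    have h1 := X.integrable_pow_mul volume (n + 1)
    have h0 := (X.integrable (μ := volume)).norm
    refine ((h0.add h1).const_mul (2 ^ n)).mono' (by fun_prop)
      (Filter.Eventually.of_forall fun t => ?_)
    rw [Real.norm_of_nonneg (by positivity)]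
    have := add_pow_le (zero_le_one (α := ℝ)) (norm_nonneg t) (n + 1)
    simp only [one_pow, Nat.add_sub_cancel] at this
    calc _ ≤ (2 ^ n * (1 + ‖t‖ ^ (n + 1))) * ‖X t‖ := by gcongr
      _ = _ := by simp only [Pi.add_apply]; ring
  -- The decay of `u` passes to its translates through `1 + |η| ≤ (1 + |ζ|)(1 + |t|)`; the power `n
  -- + 1` makes the weight in `η` integrable over `ℝⁿ`.
  have hdecay : ∀ (N : ℕ) η t, ‖u (η + (2 : ℝ) ^ (-(N : ℤ)) • t)‖ ≤
      (C * (1 + ‖t‖) ^ (n + 1)) * ((1 + ‖η‖) ^ (n + 1))⁻¹ := by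
    intro N η t
    rw [le_mul_inv_iff₀ (by positivity)]
    set ζ := η + (2 : ℝ) ^ (-(N : ℤ)) • t with hζ
    have h1 : 1 + ‖η‖ ≤ (1 + ‖ζ‖) * (1 + ‖t‖) := by
      have h2 : ‖η‖ ≤ ‖ζ‖ + ‖t‖ := by
        have : η = ζ - (2 : ℝ) ^ (-(N : ℤ)) • t := by rw [hζ]; abel
        have h3 : ‖(2 : ℝ) ^ (-(N : ℤ)) • t‖ ≤ ‖t‖ := by
          rw [norm_two_zpow_neg_smul]
          refine mul_le_of_le_one_left (norm_nonneg _) ?_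
          rw [zpow_natCast]
          exact inv_le_one_of_one_le₀ (one_le_pow₀ (by norm_num))
        calc ‖η‖ = ‖ζ - (2 : ℝ) ^ (-(N : ℤ)) • t‖ := by rw [← this]
          _ ≤ _ := (norm_sub_le _ _).trans (by linarith)
      nlinarith [mul_nonneg (norm_nonneg ζ) (norm_nonneg t)]
    calc ‖u ζ‖ * (1 + ‖η‖) ^ (n + 1) ≤ ‖u ζ‖ * ((1 + ‖ζ‖) * (1 + ‖t‖)) ^ (n + 1) := by gcongr
      _ = (‖u ζ‖ * (1 + ‖ζ‖) ^ (n + 1)) * (1 + ‖t‖) ^ (n + 1) := by rw [mul_pow]; ring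
      _ ≤ _ := by gcongr; exact hC ζ
  have hcont : ∀ η (N : ℕ), AEStronglyMeasurable
      (fun t => u (η + (2 : ℝ) ^ (-(N : ℤ)) • t) * X t) volume := fun η N =>
    (Continuous.mul (by fun_prop) X.continuous).aestronglyMeasurable
  have hbd : ∀ η (N : ℕ) t, ‖u (η + (2 : ℝ) ^ (-(N : ℤ)) • t) * X t‖ ≤
      (C * ((1 + ‖η‖) ^ (n + 1))⁻¹) * ((1 + ‖t‖) ^ (n + 1) * ‖X t‖) := by
    intro η N t
    rw [norm_mul]
    calc _ ≤ ((C * (1 + ‖t‖) ^ (n + 1)) * ((1 + ‖η‖) ^ (n + 1))⁻¹) * ‖X t‖ := by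
          gcongr; exact hdecay N η t
      _ = _ := by ring
  have hlim : ∀ η, Filter.Tendsto
      (fun N : ℕ => ∫ t, u (η + (2 : ℝ) ^ (-(N : ℤ)) • t) * X t) Filter.atTop (nhds (u η)) := by
    intro η
    have e : u η = ∫ t, u η * X t := by
      rw [integral_const_mul, hX, integral_fourier_cutoff_zero, mul_one]
    rw [e]
    refine tendsto_integral_of_dominated_convergence _ (hcont η)
      (hXm.const_mul (C * ((1 + ‖η‖) ^ (n + 1))⁻¹))
      (fun N => Filter.Eventually.of_forall (hbd η N)) (Filter.Eventually.of_forall fun t => ?_)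
    refine Filter.Tendsto.mul_const _ ?_
    refine (hu.tendsto η).comp ?_
    have : Filter.Tendsto (fun N : ℕ => η + (2 : ℝ) ^ (-(N : ℤ)) • t) Filter.atTop
        (nhds (η + (0 : ℝ) • t)) := by
      refine Filter.Tendsto.const_add _ (Filter.Tendsto.smul_const ?_ _)
      have := tendsto_pow_atTop_nhds_zero_of_lt_one (r := (1 / 2 : ℝ)) (by norm_num) (by norm_num)
      refine this.congr fun N => ?_
      rw [zpow_neg, zpow_natCast, one_div, inv_pow]
    simpa using this
  have hswap : ∀ N : ℕ, ∫ ξ, u ξ * lowPass hχ N g ξ =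
      ∫ η, (∫ t, u (η + (2 : ℝ) ^ (-(N : ℤ)) • t) * X t) * g η := by
    intro N
    simp_rw [lowPass, ← integral_const_mul]
    rw [integral_integral_swap]
    · refine integral_congr_ae (Filter.Eventually.of_forall fun η => ?_)
      simp only
      simp_rw [← mul_assoc]
      rw [integral_mul_const, integral_mul_fourier_cutoff_sub]
    · exact hg.integrable_prod (hu.integrable_of_hasCompactSupport hus) _
  simp_rw [hswap]
  set I := ∫ t, (1 + ‖t‖) ^ (n + 1) * ‖X t‖ with hI
  refine tendsto_integral_of_dominated_convergence
    (fun η => (C * ((1 + ‖η‖) ^ (n + 1))⁻¹ * I) * ‖g η‖) (fun N => ?_) ?_ (fun N => ?_)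
    (Filter.Eventually.of_forall fun η => (hlim η).mul_const _)
  · refine AEStronglyMeasurable.mul ?_ hg.measurable.aestronglyMeasurable
    have : Continuous fun z : Eucl n × Eucl n => u (z.1 + (2 : ℝ) ^ (-(N : ℤ)) • z.2) * X z.2 := by
      fun_prop
    exact (StronglyMeasurable.integral_prod_right (ν := volume) (f := fun η t =>
      u (η + (2 : ℝ) ^ (-(N : ℤ)) • t) * X t) this.stronglyMeasurable).aestronglyMeasurable
  · have h1 : Integrable (fun η : Eucl n => (((1 + ‖η‖) ^ (n + 1))⁻¹ : ℝ)) volume := by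
      have := integrable_one_add_norm (E := Eucl n) (μ := volume) (r := (n + 1 : ℕ))
        (by rw [finrank_euclideanSpace_fin]; push_cast; linarith)
      refine this.congr (Filter.Eventually.of_forall fun η => ?_)
      simp only
      rw [Real.rpow_neg (by positivity), Real.rpow_natCast]
    have h2 := (hg.integrable_mul (u := fun η => ((((1 + ‖η‖) ^ (n + 1))⁻¹ : ℝ) : ℂ)) h1.ofReal
      (B := 1) (fun η => by
        rw [Complex.norm_real, Real.norm_of_nonneg (by positivity)]
        refine inv_le_one_of_one_le₀ (one_le_pow₀ ?_)
        linarith [norm_nonneg η])).norm.const_mul (C * I)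
    refine h2.congr (Filter.Eventually.of_forall fun η => ?_)
    simp only [norm_mul]
    rw [Complex.norm_real, Real.norm_of_nonneg (by positivity)]
    ring
  · refine Filter.Eventually.of_forall fun η => ?_
    rw [norm_mul]
    gcongr
    rw [hI, ← integral_const_mul]
    exact norm_integral_le_of_norm_le (hXm.const_mul _) (Filter.Eventually.of_forall (hbd η N))

/-! ### The Littlewood–Paley decomposition of a symbol -/

theorem lowPass_sub_lowPass_neg {n : ℕ} {χ : Eucl n → ℝ} (hχ : IsLPCutoff χ)
    {g : Eucl n → ℂ} (hg : VanishesOnAverage g) (ξ : Eucl n) (N : ℕ) :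
    lowPass hχ N g ξ - lowPass hχ (-(N : ℤ)) g ξ =
      ∑ l ∈ Finset.Ioc (-(N : ℤ)) N, lpProj χ l g ξ := by
  simp_rw [lpProj_eq_sub hχ _ hg]
  induction N with
  | zero => simp
  | succ N ih =>
    have e : Finset.Ioc (-((N + 1 : ℕ) : ℤ)) ((N + 1 : ℕ) : ℤ) =
        insert (-(N : ℤ)) (insert ((N : ℤ) + 1) (Finset.Ioc (-(N : ℤ)) N)) := by
      ext k; simp only [Finset.mem_Ioc, Finset.mem_insert]; push_cast; lia
    rw [e, Finset.sum_insert, Finset.sum_insert, ← ih]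
    · push_cast
      rw [show (N : ℤ) + 1 - 1 = N by ring, show -(N : ℤ) - 1 = -1 + -N by ring]
      rw [show -((N : ℤ) + 1) = -1 + -N by ring]
      ring
    · simp
    · simp only [Finset.mem_insert, Finset.mem_Ioc]; lia

theorem tendsto_Ioc_neg_atTop :
    Filter.Tendsto (fun N : ℕ => Finset.Ioc (-(N : ℤ)) N) Filter.atTop Filter.atTop := by
  refine Filter.tendsto_atTop_finset_of_monotone (fun M N h => ?_) fun k => ⟨k.natAbs + 1, ?_⟩
  · exact Finset.Ioc_subset_Ioc (by simpa using h) (by simpa using h)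
  · simp only [Finset.mem_Ioc]; rcases abs_cases k with h | h <;> push_cast <;> lia

/-- The series converges absolutely to some `G`. By telescoping, the low-pass filters of `g`
converge pointwise to `G`, while against test functions they converge to `g`; hence `G = g` almost
everywhere. -/
theorem ae_hasSum_lpProj {n : ℕ} (hn : 1 ≤ n) {χ : Eucl n → ℝ} (hχ : IsLPCutoff χ)
    {g : Eucl n → ℂ} (hg : VanishesOnAverage g) {b : ℤ → ℝ} (hb : Summable b)
    (hgb : ∀ l ξ, ‖lpProj χ l g ξ‖ ≤ b l) :
    ∀ᵐ ξ, HasSum (fun l => lpProj χ l g ξ) (g ξ) := by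
  have hs : ∀ ξ, Summable fun l => lpProj χ l g ξ := fun ξ =>
    Summable.of_norm_bounded hb fun l => hgb l ξ
  have hb0 : ∀ l, 0 ≤ b l := fun l => (norm_nonneg _).trans (hgb l 0)
  set G : Eucl n → ℂ := fun ξ => ∑' l, lpProj χ l g ξ with hG
  have hlow : ∀ ξ, Filter.Tendsto (fun N : ℕ => lowPass hχ N g ξ) Filter.atTop (nhds (G ξ)) := by
    intro ξ
    have h1 := ((hs ξ).hasSum.comp tendsto_Ioc_neg_atTop).add (tendsto_lowPass_neg hn hχ hg ξ)
    rw [add_zero] at h1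
    refine h1.congr fun N => ?_
    simp only [Function.comp]
    rw [← lowPass_sub_lowPass_neg hχ hg, sub_add_cancel]
  obtain ⟨B, hB⟩ := exists_bound_lowPass_neg hχ hg
  have hbound : ∀ (N : ℕ) ξ, ‖lowPass hχ N g ξ‖ ≤ (∑' l, b l) + B := by
    intro N ξ
    have h1 := lowPass_sub_lowPass_neg hχ hg ξ N
    rw [sub_eq_iff_eq_add] at h1
    rw [h1]
    refine (norm_add_le _ _).trans (add_le_add ?_ (hB N ξ))
    exact (norm_sum_le _ _).trans ((Finset.sum_le_sum fun l _ => hgb l ξ).trans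
      (hb.sum_le_tsum _ fun l _ => hb0 l))
  have hmeas : ∀ N : ℕ, AEStronglyMeasurable (fun ξ => lowPass hχ N g ξ) volume := by
    intro N
    have hc : Continuous fun z : Eucl n × Eucl n => (𝓕 (cutoffSchwartz hχ N)) (z.1 - z.2) := by
      fun_prop
    exact (StronglyMeasurable.integral_prod_right (ν := volume) (f := fun ξ η =>
      (𝓕 (cutoffSchwartz hχ N)) (ξ - η) * g η)
      (hc.measurable.mul (hg.measurable.comp measurable_snd)).stronglyMeasurable).aestronglyMeasurable
  have hGm : AEStronglyMeasurable G volume := aestronglyMeasurable_of_tendsto_ae _ hmeas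
    (Filter.Eventually.of_forall hlow)
  have hGb : ∀ ξ, ‖G ξ‖ ≤ ∑' l, b l := fun ξ => tsum_of_norm_bounded hb.hasSum fun l => hgb l ξ
  have hGli : LocallyIntegrable G volume :=
    (memLp_top_of_bound hGm _ (Filter.Eventually.of_forall hGb)).locallyIntegrable le_top
  have hgli : LocallyIntegrable g volume := by
    obtain ⟨g₁, g₂, h, h1, h2, h3⟩ := hg.exists_split one_pos
    have e : g = g₁ + g₂ := funext h
    rw [e]
    exact h1.locallyIntegrable.add ((memLp_top_of_bound h2.aestronglyMeasurable _
      (Filter.Eventually.of_forall h3)).locallyIntegrable le_top)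
  have hae : ∀ᵐ ξ, G ξ = g ξ := by
    refine ae_eq_of_integral_contDiff_smul_eq hGli hgli fun ψ hψ hψs => ?_
    have hu : Continuous fun ξ => (ψ ξ : ℂ) := Complex.continuous_ofReal.comp hψ.continuous
    have hus : HasCompactSupport fun ξ => (ψ ξ : ℂ) := hψs.comp_left Complex.ofReal_zero
    have t1 := tendsto_integral_mul_lowPass hχ hg hu hus
    have t2 : Filter.Tendsto (fun N : ℕ => ∫ ξ, (ψ ξ : ℂ) * lowPass hχ N g ξ) Filter.atTop
        (nhds (∫ ξ, (ψ ξ : ℂ) * G ξ)) := by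
      refine tendsto_integral_of_dominated_convergence
        (fun ξ => ‖(ψ ξ : ℂ)‖ * ((∑' l, b l) + B))
        (fun N => hu.aestronglyMeasurable.mul (hmeas N))
        ((hu.integrable_of_hasCompactSupport hus).norm.mul_const _)
        (fun N => Filter.Eventually.of_forall fun ξ => ?_)
        (Filter.Eventually.of_forall fun ξ => (hlow ξ).const_mul _)
      rw [norm_mul]
      gcongr
      exact hbound N ξ
    simpa only [Complex.real_smul] using tendsto_nhds_unique t2 t1
  filter_upwards [hae] with ξ hξ
  rw [← hξ]
  exact (hs ξ).hasSum

theorem dyadicWeight_add_two (s : ℝ) (l : ℤ) :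
    dyadicWeight s (l + 2) = ENNReal.ofReal ((2 : ℝ) ^ (2 * s)) * dyadicWeight s l := by
  rw [dyadicWeight, dyadicWeight, ← ENNReal.ofReal_mul (by positivity),
    ← Real.rpow_add (by norm_num)]
  congr 2; push_cast; ring

/-- The factor `2^{2s}` pays for placing the piece `P_l` at level `l + 2`. -/
theorem IsSymbol.hasLocalizedDecomp {n : ℕ} (hn : 1 ≤ n) {χ : Eucl n → ℝ} (hχ : IsLPCutoff χ)
    {q : ℝ≥0∞} (hq : q = 1 ∨ q = 2) {s : ℝ} (hs : s = n / q.toReal) {σ : Eucl n → Eucl n → ℂ}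
    (hσ : IsSymbol σ) (hfin : symbolBesov χ s q σ < ⊤) :
    HasLocalizedDecomp volume q s (bandLimited n) σ
      (ENNReal.ofReal ((2 : ℝ) ^ (2 * s)) * symbolBesov χ s q σ) := by
  set a : ℤ → ℝ≥0∞ := fun l => ENNReal.ofReal ((2 : ℝ) ^ (2 * s)) *
    (dyadicWeight s l * ⨆ x, eLpNorm (lpProj χ l (σ x)) q volume) with ha
  have hsum : ∑' l, a l = ENNReal.ofReal ((2 : ℝ) ^ (2 * s)) * symbolBesov χ s q σ := by
    rw [ha, ENNReal.tsum_mul_left]; rfl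
  have hne : ∑' l, a l ≠ ⊤ := by
    rw [hsum]; exact ENNReal.mul_ne_top ENNReal.ofReal_ne_top hfin.ne
  have hlfin : ∀ l x, eLpNorm (lpProj χ l (σ x)) q volume < ⊤ := by
    intro l x
    have h1 := ENNReal.ne_top_of_tsum_ne_top hfin.ne l
    have h2 : (⨆ x, eLpNorm (lpProj χ l (σ x)) q volume) ≠ ⊤ := by
      intro hcon
      rw [hcon] at h1
      exact h1 (ENNReal.mul_top (dyadicWeight_ne_zero s l))
    exact (le_iSup (fun x => eLpNorm (lpProj χ l (σ x)) q volume) x).trans_lt h2.lt_top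
  have hmem : ∀ l x, lpProj χ l (σ x) ∈ bandLimited n (l + 2) := fun l x =>
    lpProj_mem_bandLimited hχ hq (hσ.vanishesOnAverage x) (hlfin l x)
  have hle : ∀ l x, dyadicWeight s (l + 2) * eLpNorm (lpProj χ l (σ x)) q volume ≤ a l := by
    intro l x
    rw [dyadicWeight_add_two, mul_assoc]
    exact mul_le_mul_right (mul_le_mul_right
      (le_iSup (fun x => eLpNorm (lpProj χ l (σ x)) q volume) x) _) _
  have hscale := bandLimited_scale hn hq le_rfl (by rcases hq with rfl | rfl <;> simp) hs
  refine ⟨ℤ, inferInstance, fun l => l + 2, a, fun l x => lpProj χ l (σ x), hmem, hle, hsum.le,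
    fun x => ?_⟩
  exact ae_hasSum_lpProj hn hχ (hσ.vanishesOnAverage x)
    (SymbolScale.summable_bound hne (bandConst n q)) fun l ξ =>
      hscale.norm_le (hmem l x) (hle l x) (ENNReal.ne_top_of_tsum_ne_top hne l) ξ

/-! ### Operator bounds from a scale -/

theorem PdoNormLE.mono {n : ℕ} {σ : Eucl n → Eucl n → ℂ} {p K K' : ℝ≥0∞} (h : PdoNormLE σ p K)
    (hK : K ≤ K') : PdoNormLE σ p K' := fun f =>
  ⟨(h f).1, (h f).2.1, (h f).2.2.trans (by gcongr)⟩

theorem PdoNormLE.congr_ae {n : ℕ} {σ τ : Eucl n → Eucl n → ℂ} {p K : ℝ≥0∞} (h : PdoNormLE σ p K)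
    (hστ : ∀ x, ∀ᵐ ξ, σ x ξ = τ x ξ) : PdoNormLE τ p K := by
  have e : ∀ f x, pdoIntegrand σ f x =ᵐ[volume] pdoIntegrand τ f x := by
    intro f x
    filter_upwards [hστ x] with ξ hξ
    simp only [pdoIntegrand, hξ]
  have e' : ∀ f, pdo σ f = pdo τ f := fun f => funext fun x => integral_congr_ae (e f x)
  exact fun f => ⟨fun x => ((h f).1 x).congr (e f x), e' f ▸ (h f).2.1, e' f ▸ (h f).2.2⟩

namespace SymbolScale

variable {n : ℕ} {Ω : Type*} [MeasurableSpace Ω] {ρ : Measure Ω} {π : Eucl n → Ω}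
    {q p : ℝ≥0∞} {s : ℝ} {V : ℤ → Set (Ω → ℂ)} {C : ℝ≥0}

theorem measurable_uncurry_comp (h : SymbolScale ρ π q p s V C) {μ : Eucl n → Ω → ℂ}
    (hμ : Measurable (Function.uncurry μ)) :
    Measurable (Function.uncurry fun x ξ => μ x (π ξ)) :=
  hμ.comp (measurable_fst.prodMk (h.quasiMeasurePreserving.measurable.comp measurable_snd))

theorem pdoNormLE_mul (h : SymbolScale ρ π q p s V C) (hp : 1 ≤ p) (hp' : p ≠ ⊤)
    {μ ν : Eucl n → Ω → ℂ} (hμm : Measurable (Function.uncurry μ))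
    (hνm : Measurable (Function.uncurry ν)) {c : ℝ≥0} {S T : ℝ≥0∞}
    (hμ : HasLocalizedDecomp ρ q s V μ (c * S)) (hν : HasLocalizedDecomp ρ q s V ν (c * T))
    (hS : S ≠ ⊤) (hT : T ≠ ⊤) :
    PdoNormLE (fun x ξ => μ x (π ξ) * ν x (π ξ)) p
      ((C * (prodConst s C * (c * c)) : ℝ≥0) * (S * T)) := by
  have hS' : (c : ℝ≥0∞) * S ≠ ⊤ := ENNReal.mul_ne_top ENNReal.coe_ne_top hS
  have hT' : (c : ℝ≥0∞) * T ≠ ⊤ := ENNReal.mul_ne_top ENNReal.coe_ne_top hT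
  have hd := h.decomp_mul hμ hν hS' hT'
  refine pdoNormLE_of_dominated ((h.measurable_uncurry_comp hμm).mul
    (h.measurable_uncurry_comp hνm))
    (ENNReal.mul_ne_top ENNReal.coe_ne_top (ENNReal.mul_ne_top hS hT)) fun f => ?_
  have := h.decomp_dominated hp hp' hd
    (ENNReal.mul_ne_top ENNReal.coe_ne_top (ENNReal.mul_ne_top hS' hT')) f
  convert this using 1
  push_cast; ring

theorem pdoNormLE_exp (h : SymbolScale ρ π q p s V C) (hp : 1 ≤ p) (hp' : p ≠ ⊤)
    {μ : Eucl n → Ω → ℂ} (hμm : Measurable (Function.uncurry μ)) {c : ℝ≥0} {S : ℝ≥0∞}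
    (hμ : HasLocalizedDecomp ρ q s V μ (c * S)) (hS : S ≠ ⊤) :
    PdoNormLE (fun x ξ => Complex.exp (μ x (π ξ))) p
      (ENNReal.ofReal (Real.exp ((expConst s C * c : ℝ≥0) * S.toReal))) := by
  refine pdoNormLE_of_dominated (σ := fun x ξ => Complex.exp (μ x (π ξ)))
    (Complex.measurable_exp.comp (h.measurable_uncurry_comp hμm))
    ENNReal.ofReal_ne_top fun f => ?_
  have hμ' : HasLocalizedDecomp ρ q s V μ ((c * S.toNNReal : ℝ≥0) : ℝ≥0∞) := by
    rwa [ENNReal.coe_mul, ENNReal.coe_toNNReal hS]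
  have := h.decomp_exp_dominated hp hp' hμ' (fun x => hμm.of_uncurry_left) f
  convert this using 3
  push_cast
  rw [mul_assoc]

end SymbolScale

theorem le_ofReal_coe_of_le {K : ℝ≥0} {C : ℝ} (h : (K : ℝ) ≤ C) : (K : ℝ≥0∞) ≤ ENNReal.ofReal C := by
  rw [← ENNReal.ofReal_coe_nnreal]; exact ENNReal.ofReal_le_ofReal h

theorem ofReal_exp_le {K : ℝ≥0} {C : ℝ} (h : (K : ℝ) ≤ C) (hC : 1 ≤ C) {S : ℝ} (hS : 0 ≤ S) :
    ENNReal.ofReal (Real.exp (K * S)) ≤ ENNReal.ofReal (C * Real.exp (C * S)) := by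
  refine ENNReal.ofReal_le_ofReal ?_
  calc Real.exp (K * S) ≤ 1 * Real.exp (C * S) := by rw [one_mul]; gcongr
    _ ≤ _ := by gcongr

/-- `K` is chosen before `p`: the constants of the scale involve only `n` and `q`, so the estimate
with `q = 1` is uniform in `p`. -/
theorem euclidean_pdo_bounds {n : ℕ} (hn : 1 ≤ n) {χ : Eucl n → ℝ} (hχ : IsLPCutoff χ)
    {q : ℝ≥0∞} (hq : q = 1 ∨ q = 2) {s : ℝ} (hs : s = n / q.toReal) :
    ∃ K : ℝ≥0, ∀ p : ℝ≥0∞, q ≤ p → p ≠ ⊤ →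
      (∀ σ₁ σ₂ : Eucl n → Eucl n → ℂ, IsSymbol σ₁ → IsSymbol σ₂ →
        symbolBesov χ s q σ₁ < ⊤ → symbolBesov χ s q σ₂ < ⊤ →
        PdoNormLE (fun x ξ => σ₁ x ξ * σ₂ x ξ) p
          (K * (symbolBesov χ s q σ₁ * symbolBesov χ s q σ₂))) ∧
      (∀ σ : Eucl n → Eucl n → ℂ, IsSymbol σ → symbolBesov χ s q σ < ⊤ →
        PdoNormLE (fun x ξ => Complex.exp (σ x ξ)) p
          (ENNReal.ofReal (Real.exp (K * (symbolBesov χ s q σ).toReal)))) := by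
  set c : ℝ≥0 := Real.toNNReal ((2 : ℝ) ^ (2 * s))
  set C := bandConst n q
  refine ⟨max (C * (SymbolScale.prodConst s C * (c * c))) (SymbolScale.expConst s C * c),
    fun p hqp hp' => ?_⟩
  have hp : 1 ≤ p := le_trans (by rcases hq with rfl | rfl <;> norm_num) hqp
  have hscale := bandLimited_scale hn hq hqp hp' hs
  refine ⟨fun σ₁ σ₂ h1 h2 hf1 hf2 => ?_, fun σ h hf => ?_⟩
  · refine (hscale.pdoNormLE_mul hp hp' h1.measurable h2.measurable
      (h1.hasLocalizedDecomp hn hχ hq hs hf1) (h2.hasLocalizedDecomp hn hχ hq hs hf2)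
      hf1.ne hf2.ne).mono ?_
    gcongr
    exact le_max_left _ _
  · refine (hscale.pdoNormLE_exp hp hp' h.measurable
      (h.hasLocalizedDecomp hn hχ hq hs hf) hf.ne).mono (ENNReal.ofReal_le_ofReal ?_)
    gcongr
    exact le_max_right _ _

/-! ### Harmonic polynomials -/

section HarmonicPolynomials

open MvPolynomial

variable {n : ℕ}

/-- The polynomial `∑ Xᵢ²`. -/
def radiusSq (n : ℕ) : MvPolynomial (Fin n) ℂ := ∑ i, X i ^ 2

theorem polyLaplacian_apply (p : MvPolynomial (Fin n) ℂ) :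
    polyLaplacian n p = ∑ i, pderiv i (pderiv i p) := by
  simp [polyLaplacian]

theorem mem_harmonicPoly {k : ℕ} {p : MvPolynomial (Fin n) ℂ} :
    p ∈ harmonicPoly n k ↔ p.IsHomogeneous k ∧ polyLaplacian n p = 0 := by
  rw [harmonicPoly, Submodule.mem_inf, mem_homogeneousSubmodule, LinearMap.mem_ker]

theorem isHomogeneous_radiusSq : (radiusSq n).IsHomogeneous 2 :=
  IsHomogeneous.sum _ _ _ fun i _ => by simpa using (isHomogeneous_X ℂ i).pow 2

theorem polyLaplacian_isHomogeneous {k : ℕ} {p : MvPolynomial (Fin n) ℂ} (hp : p.IsHomogeneous k) :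
    (polyLaplacian n p).IsHomogeneous (k - 2) := by
  rw [polyLaplacian_apply]
  exact IsHomogeneous.sum _ _ _ fun i _ => hp.pderiv.pderiv

theorem pderiv_radiusSq (i : Fin n) : pderiv i (radiusSq n) = 2 * X i := by
  classical
  rw [radiusSq, map_sum, Finset.sum_eq_single i]
  · rw [Derivation.leibniz_pow, pderiv_X_self]; simp
  · intro j _ hj
    rw [Derivation.leibniz_pow, pderiv_X_of_ne hj]; simp
  · simp

/-- The product rule together with Euler's identity `∑ xᵢ ∂ᵢ q = d q`. -/
theorem polyLaplacian_radiusSq_mul {d : ℕ} {q : MvPolynomial (Fin n) ℂ} (hq : q.IsHomogeneous d) :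
    polyLaplacian n (radiusSq n * q) =
      C ((2 * n + 4 * d : ℕ) : ℂ) * q + radiusSq n * polyLaplacian n q := by
  have h1 : ∀ i, pderiv i (pderiv i (radiusSq n * q)) =
      2 * q + 4 * (X i * pderiv i q) + radiusSq n * pderiv i (pderiv i q) := by
    intro i
    have h2 : pderiv i (2 : MvPolynomial (Fin n) ℂ) = 0 := by
      rw [show (2 : MvPolynomial (Fin n) ℂ) = C 2 from rfl, pderiv_C]
    simp only [Derivation.leibniz, map_add, pderiv_radiusSq, smul_eq_mul, pderiv_X_self, h2]
    ring
  simp_rw [polyLaplacian_apply, h1, Finset.sum_add_distrib, ← Finset.mul_sum,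
    hq.sum_X_mul_pderiv]
  simp only [Finset.sum_const, Finset.card_univ, Fintype.card_fin, nsmul_eq_mul]
  simp only [map_natCast]
  push_cast
  ring

theorem polyLaplacian_radiusSq_pow_mul {d : ℕ} {h : MvPolynomial (Fin n) ℂ}
    (hh : h ∈ harmonicPoly n d) (j : ℕ) :
    polyLaplacian n (radiusSq n ^ (j + 1) * h) =
      C ((2 * (j + 1) * (n + 2 * d + 2 * j) : ℕ) : ℂ) * (radiusSq n ^ j * h) := by
  obtain ⟨h1, h2⟩ := mem_harmonicPoly.1 hh
  induction j with
  | zero =>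
    rw [pow_one, polyLaplacian_radiusSq_mul h1, h2, mul_zero, add_zero, pow_zero, one_mul]
    congr 2; push_cast; ring
  | succ j ih =>
    have h3 : (radiusSq n ^ (j + 1) * h).IsHomogeneous (2 * (j + 1) + d) :=
      (isHomogeneous_radiusSq.pow (j + 1)).mul h1
    rw [pow_succ' _ (j + 1), mul_assoc, polyLaplacian_radiusSq_mul h3, ih]
    have e : radiusSq n * (C ((2 * (j + 1) * (n + 2 * d + 2 * j) : ℕ) : ℂ) * (radiusSq n ^ j * h)) =
        C ((2 * (j + 1) * (n + 2 * d + 2 * j) : ℕ) : ℂ) * (radiusSq n ^ (j + 1) * h) := by ring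
    rw [e, ← add_mul, ← C_add]
    congr 2; push_cast; ring

/-- The span of the polynomials `r^{2j} h` of degree `k` with `h` harmonic. -/
def radialHarmonicSpan (n k : ℕ) : Submodule ℂ (MvPolynomial (Fin n) ℂ) :=
  Submodule.span ℂ {p | ∃ j d, d + 2 * j = k ∧ ∃ h ∈ harmonicPoly n d, p = radiusSq n ^ j * h}

/-- Up to a nonzero factor the Laplacian lowers the power of `r²` by one in `r^{2j} h`, so it can be
inverted on the span. -/
theorem exists_polyLaplacian_eq (hn : 1 ≤ n) {k : ℕ} {p : MvPolynomial (Fin n) ℂ}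
    (hp : p ∈ radialHarmonicSpan n k) :
    ∃ q ∈ radialHarmonicSpan n (k + 2), polyLaplacian n q = p := by
  induction hp using Submodule.span_induction with
  | mem p hp =>
    obtain ⟨j, d, hk, h, hh, rfl⟩ := hp
    set c : ℂ := ((2 * (j + 1) * (n + 2 * d + 2 * j) : ℕ) : ℂ) with hc
    have hc0 : c ≠ 0 := by
      rw [hc, Nat.cast_ne_zero]
      exact Nat.mul_ne_zero (by lia) (by lia)
    refine ⟨c⁻¹ • (radiusSq n ^ (j + 1) * h), Submodule.smul_mem _ _ (Submodule.subset_span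
      ⟨j + 1, d, by lia, h, hh, rfl⟩), ?_⟩
    rw [map_smul, polyLaplacian_radiusSq_pow_mul hh, ← hc, ← smul_eq_C_mul, smul_smul,
      inv_mul_cancel₀ hc0, one_smul]
  | zero => exact ⟨0, Submodule.zero_mem _, map_zero _⟩
  | add p q _ _ hp hq =>
    obtain ⟨p', hp', rfl⟩ := hp
    obtain ⟨q', hq', rfl⟩ := hq
    exact ⟨p' + q', Submodule.add_mem _ hp' hq', map_add _ _ _⟩
  | smul c p _ hp =>
    obtain ⟨p', hp', rfl⟩ := hp
    exact ⟨c • p', Submodule.smul_mem _ _ hp', map_smul _ _ _⟩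

theorem harmonicPoly_le_radialHarmonicSpan (k : ℕ) : harmonicPoly n k ≤ radialHarmonicSpan n k :=
  fun h hh => Submodule.subset_span ⟨0, k, by simp, h, hh, by simp⟩

/-- By induction the Laplacian of `p` lies in the span, hence is the Laplacian of some `q` in the
span, and `p - q` is harmonic. In degrees `0` and `1` every polynomial is harmonic. -/
theorem IsHomogeneous.mem_radialHarmonicSpan (hn : 1 ≤ n) {k : ℕ} {p : MvPolynomial (Fin n) ℂ}
    (hp : p.IsHomogeneous k) : p ∈ radialHarmonicSpan n k := by
  induction k using Nat.strong_induction_on generalizing p with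
  | _ k ih =>
    by_cases hk : 2 ≤ k
    · obtain ⟨q, hq, hqp⟩ := exists_polyLaplacian_eq hn
        (ih (k - 2) (by lia) (polyLaplacian_isHomogeneous hp))
      rw [Nat.sub_add_cancel hk] at hq
      have hqh : q.IsHomogeneous k := by
        have hle : radialHarmonicSpan n k ≤ homogeneousSubmodule (Fin n) ℂ k := by
          refine Submodule.span_le.2 ?_
          rintro _ ⟨j, d, rfl, h, hh, rfl⟩
          have := (isHomogeneous_radiusSq.pow j).mul (mem_harmonicPoly.1 hh).1
          rw [add_comm]
          exact this
        exact hle hq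
      have hsub : p - q ∈ harmonicPoly n k :=
        mem_harmonicPoly.2 ⟨hp.sub hqh, by rw [map_sub, hqp, sub_self]⟩
      have := Submodule.add_mem _ (harmonicPoly_le_radialHarmonicSpan k hsub) hq
      rwa [sub_add_cancel] at this
    · refine harmonicPoly_le_radialHarmonicSpan k (mem_harmonicPoly.2 ⟨hp, ?_⟩)
      rw [polyLaplacian_apply]
      refine Finset.sum_eq_zero fun i _ => ?_
      have h1 : (pderiv i p).IsHomogeneous 0 := by
        have := hp.pderiv (i := i)
        rwa [show k - 1 = 0 by lia] at this
      rw [← totalDegree_zero_iff_isHomogeneous, totalDegree_eq_zero_iff_eq_C] at h1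
      rw [h1, pderiv_C]

theorem restrictSphere_apply (p : MvPolynomial (Fin n) ℂ) (θ : USphere n) :
    restrictSphere n p θ = eval (fun i => ((θ : Eucl n) i : ℂ)) p := rfl

theorem eval_radiusSq (x : Eucl n) : eval (fun i => (x i : ℂ)) (radiusSq n) = ((‖x‖ ^ 2 : ℝ) : ℂ) := by
  rw [radiusSq, EuclideanSpace.norm_sq_eq]
  simp

theorem restrictSphere_radiusSq_mul (p : MvPolynomial (Fin n) ℂ) :
    restrictSphere n (radiusSq n * p) = restrictSphere n p := by
  ext θ
  rw [restrictSphere_apply, restrictSphere_apply, map_mul, eval_radiusSq]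
  simp

/-- On the sphere `r² = 1`, so the radial factors disappear. -/
theorem restrictSphere_mem_span_harmonic (hn : 1 ≤ n) (p : MvPolynomial (Fin n) ℂ) :
    restrictSphere n p ∈ Submodule.span ℂ
      {g | ∃ k, ∃ h ∈ harmonicPoly n k, g = restrictSphere n h} := by
  rw [← sum_homogeneousComponent p, map_sum]
  refine Submodule.sum_mem _ fun k _ => ?_
  have h1 := IsHomogeneous.mem_radialHarmonicSpan hn (homogeneousComponent_isHomogeneous k p)
  have h2 := Submodule.mem_map_of_mem (f := restrictSphere n) h1
  rw [radialHarmonicSpan, Submodule.map_span] at h2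
  refine Submodule.span_mono ?_ h2
  rintro _ ⟨_, ⟨j, d, -, h, hh, rfl⟩, rfl⟩
  refine ⟨d, h, hh, ?_⟩
  induction j with
  | zero => simp
  | succ j ih => rw [pow_succ', mul_assoc, restrictSphere_radiusSq_mul, ih]

theorem conj_mem_harmonicPoly {k : ℕ} {p : MvPolynomial (Fin n) ℂ} (hp : p ∈ harmonicPoly n k) :
    map (starRingEnd ℂ) p ∈ harmonicPoly n k := by
  obtain ⟨h1, h2⟩ := mem_harmonicPoly.1 hp
  refine mem_harmonicPoly.2 ⟨h1.map _, ?_⟩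
  rw [polyLaplacian_apply]
  simp_rw [pderiv_map]
  rw [← map_sum, ← polyLaplacian_apply, h2, map_zero]

theorem restrictSphere_conj (p : MvPolynomial (Fin n) ℂ) (θ : USphere n) :
    restrictSphere n (map (starRingEnd ℂ) p) θ = starRingEnd ℂ (restrictSphere n p θ) := by
  rw [restrictSphere_apply, restrictSphere_apply, eval_map, eval, coe_eval₂Hom, ← coe_eval₂Hom,
    ← coe_eval₂Hom, ← RingHom.comp_apply]
  congr 1
  refine MvPolynomial.ringHom_ext (fun c => by simp) fun i => by simp

end HarmonicPolynomials

/-! ### Orthogonality of spherical harmonics of different degrees -/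

section Orthogonality

open MvPolynomial

variable {n : ℕ}

/-- Evaluation of a polynomial at a point of `ℝⁿ`. -/
def polyFun (p : MvPolynomial (Fin n) ℂ) (x : Eucl n) : ℂ := eval (fun i => (x i : ℂ)) p

theorem continuous_polyFun (p : MvPolynomial (Fin n) ℂ) : Continuous (polyFun p) :=
  (continuous_eval p).comp (by fun_prop)

theorem hasFDerivAt_polyFun (p : MvPolynomial (Fin n) ℂ) (x : Eucl n) :
    HasFDerivAt (polyFun p) (∑ i, polyFun (pderiv i p) x •
      (Complex.ofRealCLM ∘L (EuclideanSpace.proj i : Eucl n →L[ℝ] ℝ))) x := by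
  classical
  induction p using MvPolynomial.induction_on with
  | C a =>
    have e : polyFun (n := n) (C a) = fun _ => a := by ext x; simp [polyFun]
    rw [e]
    simp only [pderiv_C]
    refine (hasFDerivAt_const (𝕜 := ℝ) (a : ℂ) x).congr_fderiv ?_
    ext v
    simp [polyFun]
  | add p q hp hq =>
    have e : polyFun (p + q) = fun x => polyFun p x + polyFun q x := by ext x; simp [polyFun]
    rw [e]
    refine (hp.add hq).congr_fderiv ?_
    simp only [map_add]
    rw [← Finset.sum_add_distrib]
    refine Finset.sum_congr rfl fun i _ => ?_
    rw [← add_smul]; simp [polyFun]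
  | mul_X p j hp =>
    have e : polyFun (p * X j) = fun x => polyFun p x * (x j : ℂ) := by ext x; simp [polyFun]
    rw [e]
    have h2 : HasFDerivAt (fun x : Eucl n => (x j : ℂ))
        (Complex.ofRealCLM ∘L (EuclideanSpace.proj j : Eucl n →L[ℝ] ℝ)) x :=
      (Complex.ofRealCLM ∘L (EuclideanSpace.proj j : Eucl n →L[ℝ] ℝ)).hasFDerivAt
    refine (hp.mul h2).congr_fderiv ?_
    have h3 : ∀ i, polyFun (pderiv i (p * X j)) x =
        polyFun p x * (if i = j then 1 else 0) + (x j : ℂ) * polyFun (pderiv i p) x := by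
      intro i
      rw [Derivation.leibniz, pderiv_X]
      rcases eq_or_ne i j with rfl | hij
      · simp [polyFun]
      · simp [polyFun, hij, hij.symm]
    ext v
    simp only [h3]
    simp [add_mul, Finset.sum_add_distrib, Finset.mul_sum, mul_assoc]

theorem fderiv_polyFun_single (p : MvPolynomial (Fin n) ℂ) (x : Eucl n) (i : Fin n) :
    fderiv ℝ (polyFun p) x (EuclideanSpace.single i 1) = polyFun (pderiv i p) x := by
  rw [(hasFDerivAt_polyFun p x).fderiv]
  simp [PiLp.single_apply, apply_ite Complex.ofReal]

/-- Squaring makes the truncated weight differentiable across the unit sphere, so integration by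
parts over `ℝⁿ` leaves no boundary term. -/
theorem hasDerivAt_max_zero_sq (t : ℝ) :
    HasDerivAt (fun t : ℝ => max t 0 ^ 2) (2 * max t 0) t := by
  rcases lt_trichotomy t 0 with ht | rfl | ht
  · rw [max_eq_right ht.le, mul_zero]
    refine (hasDerivAt_const t (0 : ℝ)).congr_of_eventuallyEq ?_
    filter_upwards [eventually_lt_nhds ht] with u hu
    rw [max_eq_right hu.le]; simp
  · rw [max_self, mul_zero, hasDerivAt_iff_isLittleO]
    simp only [max_self, sub_zero, smul_zero]
    have h1 : (fun t : ℝ => max t 0 ^ 2 - 0 ^ 2) =O[nhds 0] fun t : ℝ => t ^ 2 := by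
      refine Asymptotics.IsBigO.of_bound 1 (Filter.Eventually.of_forall fun u => ?_)
      rw [zero_pow two_ne_zero, sub_zero, Real.norm_of_nonneg (by positivity),
        Real.norm_of_nonneg (by positivity)]
      rcases le_total u 0 with hu | hu
      · rw [max_eq_right hu]; nlinarith
      · rw [max_eq_left hu]; nlinarith
    exact h1.trans_isLittleO (by simpa using Asymptotics.isLittleO_pow_id (𝕜 := ℝ) one_lt_two)
  · rw [max_eq_left ht.le]
    have h := (hasDerivAt_pow 2 t)
    simp only [Nat.cast_ofNat, Nat.add_one_sub_one, pow_one] at h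
    refine h.congr_of_eventuallyEq ?_
    filter_upwards [eventually_gt_nhds ht] with u hu
    rw [max_eq_left hu.le]

/-- The weight `(1 - |x|²)₊`. -/
def ballWeight (x : Eucl n) : ℝ := max (1 - ‖x‖ ^ 2) 0

theorem continuous_ballWeight : Continuous (ballWeight (n := n)) := by
  unfold ballWeight; fun_prop

theorem hasCompactSupport_ballWeight : HasCompactSupport (ballWeight (n := n)) :=
  HasCompactSupport.intro (isCompact_closedBall (0 : Eucl n) 1) fun x hx => by
    rw [mem_closedBall_zero_iff, not_le] at hx
    rw [ballWeight, max_eq_right]; nlinarith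

theorem hasFDerivAt_ballWeight_sq (x : Eucl n) :
    HasFDerivAt (fun x : Eucl n => ((ballWeight x ^ 2 : ℝ) : ℂ))
      (Complex.ofRealCLM ∘L ((-4 * ballWeight x) • innerSL ℝ x)) x := by
  have h1 : HasFDerivAt (fun x : Eucl n => 1 - ‖x‖ ^ 2) (-(2 • innerSL ℝ x)) x :=
    (hasStrictFDerivAt_norm_sq x).hasFDerivAt.const_sub 1
  have h2 := (hasDerivAt_max_zero_sq (1 - ‖x‖ ^ 2)).comp_hasFDerivAt x h1
  have h3 := Complex.ofRealCLM.hasFDerivAt.comp x h2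
  refine h3.congr_fderiv ?_
  congr 1
  ext v
  simp [ballWeight]
  ring

/-- As `q` is harmonic, `div(p ∇q) = ∇p · ∇q`. Integration by parts meets the gradient `-4 w x` of
`w²`, where `w` is `ballWeight`, and Euler's identity turns `x · ∇q` into `l q`. The left side is
symmetric in `p` and `q`, which forces orthogonality in different degrees. -/
theorem integral_polyFun_pderiv_mul {l : ℕ} {p q : MvPolynomial (Fin n) ℂ}
    (hq : q ∈ harmonicPoly n l) :
    ∫ x, polyFun (∑ i, pderiv i p * pderiv i q) x * ((ballWeight x ^ 2 : ℝ) : ℂ) =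
      4 * l * ∫ x, polyFun p x * polyFun q x * (ballWeight x : ℂ) := by
  have hint : ∀ r : MvPolynomial (Fin n) ℂ, ∀ w : Eucl n → ℝ, Continuous w → HasCompactSupport w →
      Integrable (fun x => polyFun r x * (w x : ℂ)) volume := by
    intro r w hw hws
    refine Continuous.integrable_of_hasCompactSupport
      ((continuous_polyFun r).mul (Complex.continuous_ofReal.comp hw)) ?_
    exact HasCompactSupport.mul_left (hws.comp_left Complex.ofReal_zero)
  have hw2 : Continuous fun x : Eucl n => ballWeight x ^ 2 := continuous_ballWeight.pow 2
  have hw2s : HasCompactSupport fun x : Eucl n => ballWeight x ^ 2 :=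
    hasCompactSupport_ballWeight.comp_left (g := fun t => t ^ 2) (by simp)
  obtain ⟨hq1, hq2⟩ := mem_harmonicPoly.1 hq
  have key : ∀ i, ∫ x, polyFun (pderiv i (p * pderiv i q)) x * ((ballWeight x ^ 2 : ℝ) : ℂ) =
      4 * ∫ x, polyFun (p * (X i * pderiv i q)) x * (ballWeight x : ℂ) := by
    intro i
    have hd : ∀ x : Eucl n, fderiv ℝ (fun x : Eucl n => ((ballWeight x ^ 2 : ℝ) : ℂ)) x
        (EuclideanSpace.single i 1) = -4 * (ballWeight x : ℂ) * (x i : ℂ) := by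
      intro x
      rw [(hasFDerivAt_ballWeight_sq x).fderiv]
      simp [EuclideanSpace.inner_single_right]
    have e1 : ∀ x : Eucl n, polyFun (p * pderiv i q) x *
        fderiv ℝ (fun x : Eucl n => ((ballWeight x ^ 2 : ℝ) : ℂ)) x (EuclideanSpace.single i 1) =
        -4 * (polyFun (p * (X i * pderiv i q)) x * (ballWeight x : ℂ)) := by
      intro x
      rw [hd]; simp only [polyFun, map_mul, eval_X]; ring
    have h := integral_mul_fderiv_eq_neg_fderiv_mul_of_integrable
      (μ := (volume : Measure (Eucl n))) (f := polyFun (p * pderiv i q))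
      (g := fun x : Eucl n => ((ballWeight x ^ 2 : ℝ) : ℂ)) (v := EuclideanSpace.single i 1)
      (by
        simp_rw [fderiv_polyFun_single]
        exact hint _ _ hw2 hw2s)
      (by
        simp_rw [e1]
        exact (hint _ _ continuous_ballWeight hasCompactSupport_ballWeight).const_mul _)
      (hint _ _ hw2 hw2s)
      (fun x _ => (hasFDerivAt_polyFun _ x).differentiableAt)
      (fun x _ => (hasFDerivAt_ballWeight_sq x).differentiableAt)
    simp_rw [e1, fderiv_polyFun_single] at h
    rw [integral_const_mul] at h
    linear_combination h
  have hsum : ∑ i, pderiv i (p * pderiv i q) = ∑ i, pderiv i p * pderiv i q := by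
    simp_rw [Derivation.leibniz, smul_eq_mul, Finset.sum_add_distrib, ← Finset.mul_sum]
    rw [← polyLaplacian_apply, hq2, mul_zero, zero_add]
    exact Finset.sum_congr rfl fun i _ => mul_comm _ _
  have hL : ∫ x, polyFun (∑ i, pderiv i p * pderiv i q) x * ((ballWeight x ^ 2 : ℝ) : ℂ) =
      ∑ i, ∫ x, polyFun (pderiv i (p * pderiv i q)) x * ((ballWeight x ^ 2 : ℝ) : ℂ) := by
    rw [← integral_finsetSum _ fun i _ => hint _ _ hw2 hw2s, ← hsum]
    refine integral_congr_ae (Filter.Eventually.of_forall fun x => ?_)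
    simp only [polyFun, map_sum, Finset.sum_mul]
  rw [hL]
  simp_rw [key]
  rw [← Finset.mul_sum, ← integral_finsetSum _ fun i _ =>
    hint _ _ continuous_ballWeight hasCompactSupport_ballWeight, mul_assoc]
  congr 1
  rw [← integral_const_mul]
  refine integral_congr_ae (Filter.Eventually.of_forall fun x => ?_)
  have hE := congrArg (fun r => polyFun r x) hq1.sum_X_mul_pderiv
  simp only [polyFun, map_sum, map_mul, nsmul_eq_mul, map_natCast] at hE ⊢
  rw [← Finset.sum_mul, ← Finset.mul_sum, hE]
  ring

theorem integral_ball_harmonic_eq_zero {k l : ℕ} (hkl : k ≠ l) {p q : MvPolynomial (Fin n) ℂ}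
    (hp : p ∈ harmonicPoly n k) (hq : q ∈ harmonicPoly n l) :
    ∫ x, polyFun p x * polyFun q x * (ballWeight x : ℂ) = 0 := by
  have h1 := integral_polyFun_pderiv_mul (p := p) hq
  have h2 := integral_polyFun_pderiv_mul (p := q) hp
  have e : ∑ i, pderiv i q * pderiv i p = ∑ i, pderiv i p * pderiv i q :=
    Finset.sum_congr rfl fun i _ => mul_comm _ _
  have e' : ∫ x, polyFun q x * polyFun p x * (ballWeight x : ℂ) =
      ∫ x, polyFun p x * polyFun q x * (ballWeight x : ℂ) := by
    simp_rw [mul_comm (polyFun q _)]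
  rw [e, h1, e'] at h2
  have h3 : ((l : ℂ) - k) * ∫ x, polyFun p x * polyFun q x * (ballWeight x : ℂ) = 0 := by
    linear_combination h2 / 4
  rcases mul_eq_zero.1 h3 with h | h
  · exact absurd (Nat.cast_injective (sub_eq_zero.1 h)).symm hkl
  · exact h

/-- For homogeneous integrands the radial integral factors out, which carries orthogonality from the
ball to the sphere. -/
theorem integral_polar (hn : 1 ≤ n) {d : ℕ} {F : Eucl n → ℂ} {G : USphere n → ℂ}
    (hF : ∀ (r : ℝ) (θ : USphere n), 0 < r → F (r • (θ : Eucl n)) = (r : ℂ) ^ d * G θ) :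
    ∫ x, F x * (ballWeight x : ℂ) =
      (∫ r, ((r : ℝ) : ℂ) ^ d * ((max (1 - (r : ℝ) ^ 2) 0 : ℝ) : ℂ)
        ∂(Measure.volumeIoiPow (n - 1))) * ∫ θ, G θ ∂(surfaceMeasure n) := by
  have : Nonempty (Fin n) := ⟨⟨0, hn⟩⟩
  have hmp := Measure.measurePreserving_homeomorphUnitSphereProd (volume : Measure (Eucl n))
  rw [finrank_euclideanSpace_fin] at hmp
  have h1 : ∫ x, F x * (ballWeight x : ℂ) =
      ∫ x : ({0}ᶜ : Set (Eucl n)), F x * (ballWeight (x : Eucl n) : ℂ)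
        ∂((volume : Measure (Eucl n)).comap Subtype.val) := by
    rw [integral_subtype_comap (measurableSet_singleton (0 : Eucl n)).compl
      (fun x => F x * (ballWeight x : ℂ)), restrict_compl_singleton]
  have hmp' := hmp.symm (homeomorphUnitSphereProd (Eucl n)).toMeasurableEquiv
  rw [h1, ← hmp'.integral_comp
    (homeomorphUnitSphereProd (Eucl n)).symm.measurableEmbedding]
  rw [mul_comm, ← integral_prod_mul (f := G) (g := fun r : Set.Ioi (0 : ℝ) => ((r : ℝ) : ℂ) ^ d *
    ((max (1 - (r : ℝ) ^ 2) 0 : ℝ) : ℂ))]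
  refine integral_congr_ae (Filter.Eventually.of_forall fun z => ?_)
  obtain ⟨θ, r, hr⟩ := z
  have hr' : (0 : ℝ) < r := hr
  have e : ((homeomorphUnitSphereProd (Eucl n)).symm (θ, ⟨r, hr⟩) : Eucl n) = r • (θ : Eucl n) :=
    homeomorphUnitSphereProd_symm_apply_coe _ _
  change F ((homeomorphUnitSphereProd (Eucl n)).symm (θ, ⟨r, hr⟩) : Eucl n) * _ = _
  change F ((homeomorphUnitSphereProd (Eucl n)).symm (θ, ⟨r, hr⟩) : Eucl n) *
    (ballWeight ((homeomorphUnitSphereProd (Eucl n)).symm (θ, ⟨r, hr⟩) : Eucl n) : ℂ) = _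
  rw [e, hF r θ hr', ballWeight, norm_smul, Real.norm_of_nonneg hr'.le,
    norm_eq_of_mem_sphere θ, mul_one]
  simp only
  ring

theorem polyFun_smul {d : ℕ} {p : MvPolynomial (Fin n) ℂ} (hp : p.IsHomogeneous d) (r : ℝ)
    (x : Eucl n) : polyFun p (r • x) = (r : ℂ) ^ d * polyFun p x := by
  simp only [polyFun, eval_eq, Finset.mul_sum]
  refine Finset.sum_congr rfl fun m hm => ?_
  have hd := hp (mem_support_iff.1 hm)
  simp only [PiLp.smul_apply, smul_eq_mul, Complex.ofReal_mul, mul_pow, Finset.prod_mul_distrib]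
  rw [Finset.prod_pow_eq_pow_sum, ← hd, Finsupp.weight_apply, Finsupp.sum]
  simp only [Pi.one_apply, smul_eq_mul, mul_one]
  ring

theorem integral_sphere_harmonic_eq_zero (hn : 1 ≤ n) {k l : ℕ} (hkl : k ≠ l)
    {p q : MvPolynomial (Fin n) ℂ} (hp : p ∈ harmonicPoly n k) (hq : q ∈ harmonicPoly n l) :
    ∫ θ, restrictSphere n p θ * restrictSphere n q θ ∂(surfaceMeasure n) = 0 := by
  have h1 := integral_polar hn (d := k + l) (F := fun x => polyFun p x * polyFun q x)
    (G := fun θ => restrictSphere n p θ * restrictSphere n q θ) fun r θ _ => by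
      rw [polyFun_smul (mem_harmonicPoly.1 hp).1, polyFun_smul (mem_harmonicPoly.1 hq).1, pow_add]
      change _ = _ * (polyFun p θ * polyFun q θ)
      ring
  -- The same radial factor appears for the nonnegative integrand `|x|^{k+l} w`, whose integral is
  -- positive; hence that factor is not zero.
  have h2 := integral_polar hn (d := k + l) (F := fun x => (‖x‖ : ℂ) ^ (k + l))
    (G := fun _ => 1) fun r θ hr => by
      rw [norm_smul, Real.norm_of_nonneg hr.le, norm_eq_of_mem_sphere θ, mul_one, mul_one]
  rw [integral_ball_harmonic_eq_zero hkl hp hq] at h1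
  rcases mul_eq_zero.1 h1.symm with h | h
  · exfalso
    rw [h, zero_mul] at h2
    have : Nonempty (Fin n) := ⟨⟨0, hn⟩⟩
    obtain ⟨v, hv⟩ : ∃ v : Eucl n, ‖v‖ = 1 / 2 :=
      ⟨EuclideanSpace.single ⟨0, hn⟩ (1 / 2), by simp⟩
    have hpos : 0 < ∫ x : Eucl n, ‖x‖ ^ (k + l) * ballWeight x := by
      refine Continuous.integral_pos_of_hasCompactSupport_nonneg_nonzero (x := v)
        ((continuous_norm.pow _).mul continuous_ballWeight)
        hasCompactSupport_ballWeight.mul_left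
        (fun x => mul_nonneg (by positivity) (le_max_right _ _)) ?_
      rw [hv, ballWeight, hv, max_eq_left (by norm_num)]
      positivity
    have h3 : ∫ x : Eucl n, (‖x‖ : ℂ) ^ (k + l) * (ballWeight x : ℂ) =
        ((∫ x : Eucl n, ‖x‖ ^ (k + l) * ballWeight x : ℝ) : ℂ) := by
      rw [← integral_complex_ofReal]
      refine integral_congr_ae (Filter.Eventually.of_forall fun x => ?_)
      push_cast; rfl
    rw [h3] at h2
    exact hpos.ne' (Complex.ofReal_eq_zero.1 h2)
  · exact h

end Orthogonality

/-! ### Completeness of the spherical harmonics -/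

/-- Integrals over closed sets determine `g`, and thickened indicators approximate the indicator of
a closed set by continuous functions. -/
theorem ae_eq_zero_of_integral_mul_continuous {X : Type*} [PseudoMetricSpace X] [CompactSpace X]
    [MeasurableSpace X] [BorelSpace X] {ρ : Measure X} [IsFiniteMeasure ρ] {g : X → ℂ}
    (hg : Integrable g ρ) (h : ∀ φ : C(X, ℂ), ∫ x, g x * φ x ∂ρ = 0) : g =ᵐ[ρ] 0 := by
  refine ae_eq_zero_of_forall_setIntegral_isClosed_eq_zero hg fun F hF => ?_
  have hδ : ∀ m : ℕ, (0 : ℝ) < 1 / ((m : ℝ) + 1) := fun m => by positivity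
  have hlim := thickenedIndicator_tendsto_indicator_closure hδ
    tendsto_one_div_add_atTop_nhds_zero_nat F
  rw [hF.closure_eq, tendsto_pi_nhds] at hlim
  have h1 : Filter.Tendsto (fun m => ∫ x, g x * ((thickenedIndicator (hδ m) F x : ℝ) : ℂ) ∂ρ)
      Filter.atTop (nhds (∫ x, F.indicator g x ∂ρ)) := by
    refine tendsto_integral_of_dominated_convergence (fun x => ‖g x‖) (fun m => ?_) hg.norm
      (fun m => Filter.Eventually.of_forall fun x => ?_) (Filter.Eventually.of_forall fun x => ?_)
    · refine hg.aestronglyMeasurable.mul (Continuous.aestronglyMeasurable ?_)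
      exact Complex.continuous_ofReal.comp
        (NNReal.continuous_coe.comp (thickenedIndicator (hδ m) F).continuous)
    · rw [norm_mul, Complex.norm_real]
      refine mul_le_of_le_one_right (norm_nonneg _) ?_
      rw [Real.norm_of_nonneg (by positivity)]
      exact_mod_cast thickenedIndicator_le_one (hδ m) F x
    · have h2 := (Complex.continuous_ofReal.tendsto _).comp
        ((NNReal.continuous_coe.tendsto _).comp (hlim x))
      have h3 := h2.const_mul (g x)
      refine h3.congr' (Filter.Eventually.of_forall fun m => rfl) |>.trans (le_of_eq ?_)
      congr 1
      by_cases hx : x ∈ F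
      · simp [hx]
      · simp [hx]
  have h0 : ∀ m, ∫ x, g x * ((thickenedIndicator (hδ m) F x : ℝ) : ℂ) ∂ρ = 0 := fun m =>
    h ⟨fun x => ((thickenedIndicator (hδ m) F x : ℝ) : ℂ), Complex.continuous_ofReal.comp
        (NNReal.continuous_coe.comp (thickenedIndicator (hδ m) F).continuous)⟩
  simp_rw [h0] at h1
  rw [← integral_indicator hF.measurableSet]
  exact tendsto_nhds_unique h1 tendsto_const_nhds

/-- Stone–Weierstrass: the coordinates separate points, and conjugating coefficients conjugates the
restriction to the real sphere. -/
theorem dense_range_restrictSphere (n : ℕ) :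
    Dense (Set.range (restrictSphere n) : Set C(USphere n, ℂ)) := by
  let A : StarSubalgebra ℂ C(USphere n, ℂ) :=
    { carrier := Set.range (restrictSphere n)
      mul_mem' := by
        rintro _ _ ⟨p, rfl⟩ ⟨q, rfl⟩
        exact ⟨p * q, by ext θ; simp [restrictSphere_apply]⟩
      one_mem' := ⟨1, by ext θ; simp [restrictSphere_apply]⟩
      add_mem' := by
        rintro _ _ ⟨p, rfl⟩ ⟨q, rfl⟩
        exact ⟨p + q, map_add _ _ _⟩
      zero_mem' := ⟨0, map_zero _⟩
      algebraMap_mem' := fun c => ⟨MvPolynomial.C c, by ext θ; simp [restrictSphere_apply]⟩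
      star_mem' := by
        rintro _ ⟨p, rfl⟩
        exact ⟨MvPolynomial.map (starRingEnd ℂ) p, by ext θ; rw [restrictSphere_conj]; rfl⟩ }
  have hA : A.SeparatesPoints := by
    intro θ θ' hne
    obtain ⟨i, hi⟩ : ∃ i, (θ : Eucl n) i ≠ (θ' : Eucl n) i := by
      by_contra hcon
      push Not at hcon
      exact hne (Subtype.ext (PiLp.ext hcon))
    refine ⟨_, ⟨_, ⟨MvPolynomial.X i, rfl⟩, rfl⟩, ?_⟩
    simpa [restrictSphere_apply] using hi
  have h := ContinuousMap.starSubalgebra_topologicalClosure_eq_top_of_separatesPoints A hA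
  intro φ
  have : φ ∈ A.topologicalClosure := h ▸ trivial
  exact this

/-- Integration against `g` is continuous for the sup norm, so uniform density of polynomials
suffices and `g` need only be integrable. -/
theorem ae_eq_zero_of_integral_mul_harmonic {n : ℕ} (hn : 1 ≤ n) {g : USphere n → ℂ}
    (hg : Integrable g (surfaceMeasure n))
    (h : ∀ k, ∀ Y ∈ harmonicPoly n k, ∫ θ, g θ * restrictSphere n Y θ ∂(surfaceMeasure n) = 0) :
    g =ᵐ[surfaceMeasure n] 0 := by
  have hint : ∀ φ : C(USphere n, ℂ), Integrable (fun θ => g θ * φ θ) (surfaceMeasure n) := fun φ =>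
    hg.mul_bdd (c := ‖φ‖) φ.continuous.aestronglyMeasurable
      (Filter.Eventually.of_forall φ.norm_coe_le_norm)
  let Λ : C(USphere n, ℂ) →ₗ[ℂ] ℂ :=
    { toFun := fun φ => ∫ θ, g θ * φ θ ∂(surfaceMeasure n)
      map_add' := fun φ ψ => by
        rw [← integral_add (hint φ) (hint ψ)]
        simp [mul_add]
      map_smul' := fun c φ => by
        rw [RingHom.id_apply, smul_eq_mul, ← integral_const_mul]
        refine integral_congr_ae (Filter.Eventually.of_forall fun θ => ?_)
        simp only [ContinuousMap.smul_apply, smul_eq_mul]; ring }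
  have hΛ : Continuous Λ := by
    refine (Λ.mkContinuous (∫ θ, ‖g θ‖ ∂(surfaceMeasure n)) fun φ => ?_).continuous
    rw [← integral_mul_const]
    refine norm_integral_le_of_norm_le (hg.norm.mul_const _)
      (Filter.Eventually.of_forall fun θ => ?_)
    rw [norm_mul]
    gcongr
    exact φ.norm_coe_le_norm θ
  have hpoly : ∀ p, Λ (restrictSphere n p) = 0 := by
    intro p
    have hle : Submodule.span ℂ {u | ∃ k, ∃ h ∈ harmonicPoly n k, u = restrictSphere n h} ≤
        LinearMap.ker Λ := by
      refine Submodule.span_le.2 ?_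
      rintro _ ⟨k, Y, hY, rfl⟩
      exact h k Y hY
    exact hle (restrictSphere_mem_span_harmonic hn p)
  refine ae_eq_zero_of_integral_mul_continuous hg fun φ => ?_
  have hcl : IsClosed {φ | Λ φ = 0} := isClosed_eq hΛ continuous_const
  have hsub : closure (Set.range (restrictSphere n)) ⊆ {φ | Λ φ = 0} :=
    hcl.closure_subset_iff.2 (by rintro _ ⟨p, rfl⟩; exact hpoly p)
  exact hsub (dense_range_restrictSphere n φ)

/-! ### Rotations of the sphere -/

section Rotation

variable {n : ℕ}

/-- The action of a linear isometry on the sphere. -/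
def sphereRotate (A : Eucl n ≃ₗᵢ[ℝ] Eucl n) (θ : USphere n) : USphere n :=
  ⟨A θ, by rw [mem_sphere_zero_iff_norm, A.norm_map, norm_eq_of_mem_sphere θ]⟩

theorem continuous_sphereRotate (A : Eucl n ≃ₗᵢ[ℝ] Eucl n) : Continuous (sphereRotate A) :=
  (A.continuous.comp continuous_subtype_val).subtype_mk _

open scoped Pointwise in
-- Surface measure is a multiple of the volume of the cone over a set, and isometries preserve
-- volume.
theorem measurePreserving_sphereRotate (A : Eucl n ≃ₗᵢ[ℝ] Eucl n) :
    MeasurePreserving (sphereRotate A) (surfaceMeasure n) (surfaceMeasure n) := by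
  have hm := (continuous_sphereRotate A).measurable
  refine ⟨hm, Measure.ext fun s hs => ?_⟩
  rw [Measure.map_apply hm hs, Measure.toSphere_apply' _ (hm hs), Measure.toSphere_apply' _ hs]
  congr 1
  rw [← A.measurePreserving.measure_preimage_equiv (f := A.toMeasurableEquiv)
    (Set.Ioo (0 : ℝ) 1 • (Subtype.val '' s) : Set (Eucl n))]
  congr 1
  ext x
  simp only [Set.mem_smul, Set.mem_image, Set.mem_preimage]
  constructor
  · rintro ⟨r, hr, _, ⟨θ, hθ, rfl⟩, rfl⟩
    exact ⟨r, hr, _, ⟨_, hθ, rfl⟩, (A.map_smul r (θ : Eucl n)).symm⟩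
  · rintro ⟨r, hr, _, ⟨θ, hθ, rfl⟩, h⟩
    refine ⟨r, hr, _, ⟨sphereRotate A.symm θ, ?_, rfl⟩, ?_⟩
    · have : sphereRotate A (sphereRotate A.symm θ) = θ := Subtype.ext (A.apply_symm_apply _)
      rwa [this]
    · apply A.injective
      change A (r • A.symm θ) = _
      rw [A.map_smul, A.apply_symm_apply]
      exact h

theorem exists_sphereRotate_eq (θ θ' : USphere n) :
    ∃ A : Eucl n ≃ₗᵢ[ℝ] Eucl n, sphereRotate A θ = θ' :=
  ⟨(Submodule.reflection (Submodule.span ℝ {(θ : Eucl n) - θ'})ᗮ), Subtype.ext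
    (Submodule.reflection_sub (by rw [norm_eq_of_mem_sphere θ, norm_eq_of_mem_sphere θ']))⟩

theorem norm_toLp_sq (g : C(USphere n, ℂ)) :
    ‖ContinuousMap.toLp (E := ℂ) 2 (surfaceMeasure n) ℂ g‖ ^ 2 =
      ∫ θ, ‖g θ‖ ^ 2 ∂(surfaceMeasure n) := by
  have h := ContinuousMap.inner_toLp (𝕜 := ℂ) (surfaceMeasure n) g g
  rw [inner_self_eq_norm_sq_to_K] at h
  have h2 : ∫ θ, g θ * (starRingEnd ℂ) (g θ) ∂(surfaceMeasure n) =
      ((∫ θ, ‖g θ‖ ^ 2 ∂(surfaceMeasure n) : ℝ) : ℂ) := by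
    rw [← integral_complex_ofReal]
    refine integral_congr_ae (Filter.Eventually.of_forall fun θ => ?_)
    simp only [Complex.mul_conj, Complex.normSq_eq_norm_sq]
  rw [h2] at h
  exact Complex.ofReal_injective (by push_cast; exact h)

theorem eLpNorm_two_toLp (g : C(USphere n, ℂ)) :
    eLpNorm g 2 (surfaceMeasure n) =
      ENNReal.ofReal ‖ContinuousMap.toLp (E := ℂ) 2 (surfaceMeasure n) ℂ g‖ := by
  rw [Lp.norm_def, ENNReal.ofReal_toReal (Lp.memLp _).2.ne]
  exact eLpNorm_congr_ae (ContinuousMap.coeFn_toLp (surfaceMeasure n) g).symm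

/-- A rotation-invariant finite-dimensional space of continuous functions on the sphere has an
orthonormal basis whose squares add up to a constant. -/
theorem exists_frame_of_invariant (W : Submodule ℂ C(USphere n, ℂ)) [FiniteDimensional ℂ W]
    (hW : ∀ A : Eucl n ≃ₗᵢ[ℝ] Eucl n, ∀ g ∈ W,
      g.comp ⟨sphereRotate A, continuous_sphereRotate A⟩ ∈ W) :
    ∃ e : Fin (Module.finrank ℂ W) → C(USphere n, ℂ),
      (∀ g ∈ W, ∃ c : Fin (Module.finrank ℂ W) → ℂ, g = ∑ i, c i • e i ∧
        ∑ i, ‖c i‖ ^ 2 = ‖ContinuousMap.toLp (E := ℂ) 2 (surfaceMeasure n) ℂ g‖ ^ 2) ∧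
      ∀ θ, (∑ i, ‖e i θ‖ ^ 2) * (surfaceMeasure n).real Set.univ = Module.finrank ℂ W := by
  set T := (ContinuousMap.toLp (E := ℂ) 2 (surfaceMeasure n) ℂ).toLinearMap with hT
  have hTinj : Function.Injective T := ContinuousMap.toLp_injective _
  have hfd : FiniteDimensional ℂ (W.map T) := Module.Finite.map _ _
  have hfr : Module.finrank ℂ (W.map T) = Module.finrank ℂ W :=
    (LinearEquiv.finrank_eq (Submodule.equivMapOfInjective T hTinj W)).symm
  let b : OrthonormalBasis (Fin (Module.finrank ℂ W)) ℂ (W.map T) :=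
    (stdOrthonormalBasis ℂ (W.map T)).reindex (finCongr hfr)
  have hb : ∀ i, ∃ e ∈ W, T e = b i := fun i => (b i).2
  choose e heW he using hb
  have hrepr : ∀ g ∈ W, ∃ c : Fin (Module.finrank ℂ W) → ℂ, g = ∑ i, c i • e i ∧
        ∑ i, ‖c i‖ ^ 2 = ‖T g‖ ^ 2 := by
    intro g hg
    let v : W.map T := ⟨T g, g, hg, rfl⟩
    refine ⟨fun i => inner ℂ (b i) v, hTinj ?_, b.sum_sq_norm_inner_right v⟩
    rw [map_sum]
    simp_rw [map_smul, he]
    have h := congrArg Subtype.val (b.sum_repr' v)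
    refine h.symm.trans ?_
    simp
  have hnorm : ∀ c : Fin (Module.finrank ℂ W) → ℂ,
      ‖T (∑ i, c i • e i)‖ ^ 2 = ∑ i, ‖c i‖ ^ 2 := by
    intro c
    have h1 : T (∑ i, c i • e i) = ((∑ i, c i • b i : W.map T) : Lp ℂ 2 (surfaceMeasure n)) := by
      rw [map_sum]; simp [he]
    rw [h1]
    change ‖(∑ i, c i • b i : W.map T)‖ ^ 2 = _
    rw [← b.sum_sq_norm_inner_right]
    refine Finset.sum_congr rfl fun i _ => ?_
    rw [b.orthonormal.inner_right_fintype]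
  have hpt : ∀ g ∈ W, ∀ θ, ‖g θ‖ ^ 2 ≤ (∑ i, ‖e i θ‖ ^ 2) * ‖T g‖ ^ 2 := by
    intro g hg θ
    obtain ⟨c, hc, hc2⟩ := hrepr g hg
    rw [← hc2, mul_comm]
    have : g θ = ∑ i, c i * e i θ := by
      conv_lhs => rw [hc]
      simp [ContinuousMap.sum_apply]
    rw [this]
    refine le_trans ?_ (Finset.sum_mul_sq_le_sq_mul_sq _ _ _)
    gcongr
    refine (norm_sum_le _ _).trans (Finset.sum_le_sum fun i _ => ?_)
    rw [norm_mul]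
  -- Apply `hpt` to the reproducing kernel at `θ'`, moved by an isometry taking `θ` to `θ'`. Its
  -- value at `θ` and its squared norm both equal `K`, so `K² ≤ (∑ |e i θ|²) K`.
  have hle : ∀ θ θ', ∑ i, ‖e i θ'‖ ^ 2 ≤ ∑ i, ‖e i θ‖ ^ 2 := by
    intro θ θ'
    obtain ⟨A, hA⟩ := exists_sphereRotate_eq θ θ'
    set K := ∑ i, ‖e i θ'‖ ^ 2 with hK
    set g : C(USphere n, ℂ) := ∑ i, (starRingEnd ℂ) (e i θ') • e i with hg
    have hgW : g ∈ W := W.sum_mem fun i _ => W.smul_mem _ (heW i)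
    have h1 := hpt _ (hW A g hgW) θ
    have h2 : ‖T (g.comp ⟨sphereRotate A, continuous_sphereRotate A⟩)‖ ^ 2 = K := by
      have h3 : ‖T g‖ ^ 2 = K := by
        rw [hg, hnorm]; simp [hK]
      rw [← h3]
      refine (norm_toLp_sq _).trans (Eq.trans ?_ (norm_toLp_sq _).symm)
      conv_rhs => rw [← (measurePreserving_sphereRotate A).map_eq]
      exact (integral_map (continuous_sphereRotate A).aemeasurable
        (g.continuous.norm.pow 2).aestronglyMeasurable).symm
    have h4 : (g.comp ⟨sphereRotate A, continuous_sphereRotate A⟩) θ = (K : ℂ) := by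
      change g (sphereRotate A θ) = _
      rw [hA, hg, ContinuousMap.sum_apply, hK]
      push_cast
      refine Finset.sum_congr rfl fun i _ => ?_
      change (starRingEnd ℂ) (e i θ') * e i θ' = _
      rw [mul_comm, Complex.mul_conj, Complex.normSq_eq_norm_sq]
      push_cast; rfl
    have hK0 : 0 ≤ K := Finset.sum_nonneg fun i _ => sq_nonneg _
    rw [h4, h2, Complex.norm_real, Real.norm_of_nonneg hK0, pow_two] at h1
    rcases hK0.eq_or_lt with h | h
    · rw [← h]; exact Finset.sum_nonneg fun i _ => sq_nonneg _
    · exact le_of_mul_le_mul_right h1 h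
  refine ⟨e, hrepr, fun θ => ?_⟩
  have h1 : ∫ η, ∑ i, ‖e i η‖ ^ 2 ∂(surfaceMeasure n) = Module.finrank ℂ W := by
    rw [integral_finsetSum _ fun i _ => ?_]
    · have : ∀ i, ∫ η, ‖e i η‖ ^ 2 ∂(surfaceMeasure n) = 1 := by
        intro i
        rw [← norm_toLp_sq]
        change ‖T (e i)‖ ^ 2 = 1
        rw [he, ← Submodule.coe_norm, b.orthonormal.1 i, one_pow]
      simp [this]
    · exact Continuous.integrable_of_hasCompactSupport ((e i).continuous.norm.pow 2)
        (HasCompactSupport.of_compactSpace _)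
  rw [← h1]
  have : ∀ η, ∑ i, ‖e i η‖ ^ 2 = ∑ i, ‖e i θ‖ ^ 2 := fun η => le_antisymm (hle _ _) (hle _ _)
  simp_rw [this]
  rw [integral_const, smul_eq_mul, mul_comm]

end Rotation

/-! ### Polynomials on the sphere -/

section SpherePolynomials

open MvPolynomial

variable {n : ℕ}

/-- Restrictions to the sphere of the polynomials of degree at most `N`. -/
def spherePoly (n N : ℕ) : Submodule ℂ C(USphere n, ℂ) :=
  (restrictTotalDegree (Fin n) ℂ N).map (restrictSphere n)

theorem mem_spherePoly {N : ℕ} {g : C(USphere n, ℂ)} :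
    g ∈ spherePoly n N ↔ ∃ p : MvPolynomial (Fin n) ℂ, p.totalDegree ≤ N ∧ restrictSphere n p = g := by
  simp [spherePoly, Submodule.mem_map, mem_restrictTotalDegree]

/-- The monomial functions `x₀^a x₁^{s₁} ⋯` on the sphere. -/
def sphereMonomial {m : ℕ} (a : ℕ) (s : Fin m → ℕ) : C(USphere (m + 1), ℂ) :=
  restrictSphere (m + 1) (X 0 ^ a * ∏ i, X (Fin.succ i) ^ s i)

theorem sphereMonomial_add_two {m : ℕ} (a : ℕ) (s : Fin m → ℕ) :
    sphereMonomial (a + 2) s =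
      sphereMonomial a s - ∑ j, sphereMonomial a (Function.update s j (s j + 2)) := by
  classical
  ext θ
  have hθ : ((θ : Eucl (m + 1)) 0 : ℂ) ^ 2 + ∑ i : Fin m, ((θ : Eucl (m + 1)) i.succ : ℂ) ^ 2 = 1 := by
    have h := eval_radiusSq (θ : Eucl (m + 1))
    rw [norm_eq_of_mem_sphere θ, radiusSq, map_sum, Fin.sum_univ_succ] at h
    simpa using h
  have h1 : ∀ j : Fin m, ∏ i : Fin m, ((θ : Eucl (m + 1)) i.succ : ℂ) ^
      (Function.update s j (s j + 2) i) = ((θ : Eucl (m + 1)) j.succ : ℂ) ^ 2 *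
        ∏ i : Fin m, ((θ : Eucl (m + 1)) i.succ : ℂ) ^ s i := by
    intro j
    rw [← Finset.mul_prod_erase _ _ (Finset.mem_univ j),
      ← Finset.mul_prod_erase _ (fun i : Fin m => ((θ : Eucl (m + 1)) i.succ : ℂ) ^ s i)
        (Finset.mem_univ j), Function.update_self]
    rw [Finset.prod_congr rfl fun i hi => by
      rw [Function.update_of_ne (Finset.ne_of_mem_erase hi)]]
    ring
  simp only [sphereMonomial, ContinuousMap.sub_apply, ContinuousMap.sum_apply,
    restrictSphere_apply, map_mul, map_pow, map_prod, eval_X, h1]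
  rw [← Finset.mul_sum, ← Finset.sum_mul]
  linear_combination ((θ : Eucl (m + 1)) 0 : ℂ) ^ a *
    (∏ i : Fin m, ((θ : Eucl (m + 1)) i.succ : ℂ) ^ s i) * hθ

/-- The equation of the sphere reduces the exponent of `x₀` to `0` or `1`. Only `m = n - 1`
exponents stay free, so the dimension grows like `N^{n-1}`. -/
theorem sphereMonomial_mem_span {m N : ℕ} (a : ℕ) (s : Fin m → ℕ) (h : a + ∑ i, s i ≤ N) :
    sphereMonomial a s ∈ Submodule.span ℂ (Set.range fun z : Fin 2 × (Fin m → Fin (N + 1)) =>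
      sphereMonomial (z.1 : ℕ) fun i => (z.2 i : ℕ)) := by
  induction a using Nat.strong_induction_on generalizing s with
  | _ a ih =>
    rcases lt_or_ge a 2 with ha | ha
    · refine Submodule.subset_span ⟨(⟨a, ha⟩, fun i => ⟨s i, ?_⟩), rfl⟩
      have := Finset.single_le_sum (f := s) (fun i _ => Nat.zero_le _) (Finset.mem_univ i)
      omega
    · obtain ⟨a, rfl⟩ := Nat.exists_eq_add_of_le' ha
      rw [sphereMonomial_add_two]
      refine Submodule.sub_mem _ (ih a (by omega) s (by omega))
        (Submodule.sum_mem _ fun j _ => ih a (by omega) _ ?_)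
      have : ∑ i, Function.update s j (s j + 2) i = ∑ i, s i + 2 := by
        rw [← Finset.add_sum_erase _ _ (Finset.mem_univ j),
          ← Finset.add_sum_erase _ s (Finset.mem_univ j), Function.update_self]
        rw [Finset.sum_congr rfl fun i hi => by
          rw [Function.update_of_ne (Finset.ne_of_mem_erase hi)]]
        ring
      omega

theorem spherePoly_le_span {m N : ℕ} : spherePoly (m + 1) N ≤
    Submodule.span ℂ (Set.range fun z : Fin 2 × (Fin m → Fin (N + 1)) =>
      sphereMonomial (z.1 : ℕ) fun i => (z.2 i : ℕ)) := by
  intro g hg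
  obtain ⟨p, hp, rfl⟩ := mem_spherePoly.1 hg
  rw [p.as_sum, map_sum]
  refine Submodule.sum_mem _ fun t ht => ?_
  have h1 : restrictSphere (m + 1) (monomial t (coeff t p)) =
      coeff t p • sphereMonomial (t 0) fun i => t i.succ := by
    rw [sphereMonomial, ← map_smul]
    congr 1
    rw [monomial_eq, smul_eq_C_mul, Finsupp.prod_fintype _ _ (fun i => pow_zero _),
      Fin.prod_univ_succ]
  rw [h1]
  refine Submodule.smul_mem _ _ (sphereMonomial_mem_span _ _ ?_)
  rw [← Fin.sum_univ_succ (fun i => t i)]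
  refine le_trans ?_ ((le_totalDegree ht).trans hp)
  rw [Finsupp.sum_fintype _ _ fun _ => rfl]

instance finiteDimensional_spherePoly (m N : ℕ) : FiniteDimensional ℂ (spherePoly (m + 1) N) := by
  have := FiniteDimensional.span_of_finite ℂ
    (Set.finite_range fun z : Fin 2 × (Fin m → Fin (N + 1)) =>
      sphereMonomial (z.1 : ℕ) fun i => (z.2 i : ℕ))
  exact Submodule.finiteDimensional_of_le spherePoly_le_span

theorem finrank_spherePoly_le (m N : ℕ) :
    Module.finrank ℂ (spherePoly (m + 1) N) ≤ 2 * (N + 1) ^ m := by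
  have := FiniteDimensional.span_of_finite ℂ
    (Set.finite_range fun z : Fin 2 × (Fin m → Fin (N + 1)) =>
      sphereMonomial (z.1 : ℕ) fun i => (z.2 i : ℕ))
  refine (Submodule.finrank_mono spherePoly_le_span).trans ((finrank_range_le_card _).trans ?_)
  simp

theorem spherePoly_rotate {N : ℕ} (A : Eucl n ≃ₗᵢ[ℝ] Eucl n) {g : C(USphere n, ℂ)}
    (hg : g ∈ spherePoly n N) :
    g.comp ⟨sphereRotate A, continuous_sphereRotate A⟩ ∈ spherePoly n N := by
  obtain ⟨p, hp, rfl⟩ := mem_spherePoly.1 hg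
  let L : Fin n → MvPolynomial (Fin n) ℂ := fun i =>
    ∑ j, C ((A (EuclideanSpace.single j 1) i : ℝ) : ℂ) * X j
  have hL : ∀ i, (L i).totalDegree ≤ 1 := fun i =>
    (totalDegree_finsetSum_le fun j _ => (totalDegree_mul _ _).trans (by simp))
  refine mem_spherePoly.2 ⟨bind₁ L p, ?_, ?_⟩
  · have h1 : bind₁ L p = ∑ t ∈ p.support, C (coeff t p) * ∏ i, L i ^ t i := by
      conv_lhs => rw [p.as_sum, map_sum]
      refine Finset.sum_congr rfl fun t _ => ?_
      rw [bind₁_monomial]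
      congr 1
      exact Finsupp.prod_fintype t (fun i k => L i ^ k) fun i => pow_zero _
    rw [h1]
    refine totalDegree_finsetSum_le fun t ht => (totalDegree_mul _ _).trans ?_
    rw [totalDegree_C, zero_add]
    refine (totalDegree_finsetProd _ _).trans ?_
    refine le_trans (Finset.sum_le_sum fun i _ => (totalDegree_pow _ _).trans
      (Nat.mul_le_mul_left _ (hL i))) ?_
    refine le_trans ?_ ((le_totalDegree ht).trans hp)
    rw [Finsupp.sum_fintype _ _ fun _ => rfl]
    simp
  · ext θ
    change _ = restrictSphere n p (sphereRotate A θ)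
    rw [restrictSphere_apply, restrictSphere_apply, eval, eval₂Hom_bind₁]
    congr 2
    funext i
    have h1 : A θ = ∑ j, (θ : Eucl n) j • A (EuclideanSpace.single j 1) := by
      conv_lhs => rw [← (EuclideanSpace.basisFun (Fin n) ℝ).sum_repr (θ : Eucl n), map_sum]
      simp
    change _ = ((A θ i : ℝ) : ℂ)
    rw [h1]
    simp [L, mul_comm]

end SpherePolynomials

/-! ### Plancherel's theorem for integrable square-integrable functions -/

/-- The integral defining `𝓕⁻ u` is identified with Plancherel's `L²` inverse transform by testing
both on smooth functions of compact support. -/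
theorem eLpNorm_fourierInv_eq {n : ℕ} {u : Eucl n → ℂ} (h1 : Integrable u volume)
    (h2 : MemLp u 2 volume) : eLpNorm (𝓕⁻ u) 2 volume = eLpNorm u 2 volume := by
  set w : Lp ℂ 2 (volume : Measure (Eucl n)) := 𝓕⁻ (h2.toLp u) with hw
  have hc : Continuous fun y => 𝓕 u (-y) :=
    (continuous_fourier_of_integrable h1).comp continuous_neg
  have hpair : ∀ ψ : SchwartzMap (Eucl n) ℂ, ∫ y, ψ y * 𝓕 u (-y) = ∫ y, ψ y * w y := fun ψ =>
    (integral_schwartz_mul_fourier_neg h1 ψ).trans (integral_schwartz_mul_fourierInv_toLp h2 ψ).symm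
  have hae : (fun y => 𝓕 u (-y)) =ᵐ[volume] w := by
    refine ae_eq_of_integral_contDiff_smul_eq hc.locallyIntegrable
      ((Lp.memLp w).locallyIntegrable (by norm_num)) fun g hg hgs => ?_
    have hg' : ContDiff ℝ ∞ fun y => (g y : ℂ) := Complex.ofRealCLM.contDiff.comp hg
    have hgs' : HasCompactSupport fun y => (g y : ℂ) := hgs.comp_left Complex.ofReal_zero
    have := hpair (hgs'.toSchwartzMap hg')
    simpa using this
  have hinv : 𝓕⁻ u = fun y => 𝓕 u (-y) := by
    ext y; rw [Real.fourierInv_eq_fourier_neg]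
  rw [hinv, eLpNorm_congr_ae hae]
  have hn : ‖h2.toLp u‖ = ‖w‖ := by
    rw [← Lp.norm_fourier_eq w, hw, FourierTransform.fourier_fourierInv_eq]
  rw [Lp.norm_toLp, Lp.norm_def, ENNReal.toReal_eq_toReal_iff' h2.2.ne (Lp.memLp w).2.ne] at hn
  exact hn.symm

theorem pdo_eq_fourierInv {n : ℕ} (σ : Eucl n → ℂ) (f : SchwartzMap (Eucl n) ℂ) :
    pdo (fun _ ξ => σ ξ) f = 𝓕⁻ (fun ξ => σ ξ * 𝓕 (f : Eucl n → ℂ) ξ) := by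
  ext x
  rw [Real.fourierInv_eq', pdo]
  refine integral_congr_ae (Filter.Eventually.of_forall fun ξ => ?_)
  simp only [pdoIntegrand, smul_eq_mul]
  rw [show (((2 * Real.pi * inner ℝ ξ x : ℝ) : ℂ) * Complex.I) =
    2 * Real.pi * Complex.I * (inner ℝ ξ x : ℝ) by push_cast; ring]
  ring

theorem memLp_two_fourier_schwartz {n : ℕ} (f : SchwartzMap (Eucl n) ℂ) :
    MemLp (𝓕 (f : Eucl n → ℂ)) 2 volume := by
  rw [← SchwartzMap.fourier_coe]; exact (𝓕 f).memLp 2 volume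

theorem eLpNorm_two_fourier_schwartz {n : ℕ} (f : SchwartzMap (Eucl n) ℂ) :
    eLpNorm (𝓕 (f : Eucl n → ℂ)) 2 volume = eLpNorm (f : Eucl n → ℂ) 2 volume := by
  have := eLpNorm_two_fourierInv_schwartz (𝓕 f)
  rw [FourierTransform.fourierInv_fourier_eq] at this
  rw [← SchwartzMap.fourier_coe]; exact this.symm

/-- `∑ ‖T_{eᵢ} f‖² ≤ B ‖f‖²` for multipliers with `∑ |eᵢ|² ≤ B`. -/
theorem sum_lintegral_pdo_sq_le {n : ℕ} {ι : Type*} [Fintype ι] {e : ι → Eucl n → ℂ}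
    (he : ∀ i, Measurable (e i)) {B : ℝ} (hB : ∀ ξ, ∑ i, ‖e i ξ‖ ^ 2 ≤ B)
    (f : SchwartzMap (Eucl n) ℂ) :
    ∑ i, ∫⁻ x, ‖pdo (fun _ ξ => e i ξ) f x‖ₑ ^ 2 ≤
      ENNReal.ofReal B * ∫⁻ x, ‖f x‖ₑ ^ 2 := by
  have hb : ∀ i ξ, ‖e i ξ‖ ≤ Real.sqrt B := fun i ξ => Real.le_sqrt_of_sq_le
    ((Finset.single_le_sum (f := fun i => ‖e i ξ‖ ^ 2) (fun _ _ => sq_nonneg _)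
      (Finset.mem_univ i)).trans (hB ξ))
  have hsq : ∀ u : Eucl n → ℂ, ∫⁻ x, ‖u x‖ₑ ^ 2 = eLpNorm u 2 volume ^ 2 := by
    intro u
    rw [eLpNorm_eq_lintegral_rpow_enorm_toReal two_ne_zero ENNReal.ofNat_ne_top,
      ← ENNReal.rpow_natCast, ← ENNReal.rpow_mul]
    simp
  -- Plancherel for each `i`; afterwards the sum is taken under the integral, where `∑ |e i|² ≤ B`
  -- applies.
  have h1 : ∀ i, ∫⁻ x, ‖pdo (fun _ ξ => e i ξ) f x‖ₑ ^ 2 =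
      ∫⁻ ξ, ‖e i ξ‖ₑ ^ 2 * ‖𝓕 (f : Eucl n → ℂ) ξ‖ₑ ^ 2 := by
    intro i
    rw [pdo_eq_fourierInv, hsq, eLpNorm_fourierInv_eq, ← hsq]
    · simp_rw [enorm_mul, mul_pow]
    · exact (integrable_fourier_schwartz f).bdd_mul (he i).aestronglyMeasurable
        (Filter.Eventually.of_forall (hb i))
    · exact (memLp_two_fourier_schwartz f).of_le_mul (c := Real.sqrt B)
        ((he i).aestronglyMeasurable.mul (memLp_two_fourier_schwartz f).1)
        (Filter.Eventually.of_forall fun ξ => by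
          rw [norm_mul]; gcongr; exact hb i ξ)
  simp_rw [h1]
  rw [← lintegral_finsetSum' (f := fun i ξ => ‖e i ξ‖ₑ ^ 2 * ‖𝓕 (f : Eucl n → ℂ) ξ‖ₑ ^ 2) _
    fun i _ => (((he i).enorm.pow_const 2).aemeasurable.mul
    ((continuous_fourier_schwartz f).measurable.enorm.pow_const 2).aemeasurable),
    hsq, ← eLpNorm_two_fourier_schwartz, ← hsq, ← lintegral_const_mul' _ _ ENNReal.ofReal_ne_top]
  refine lintegral_mono fun ξ => ?_
  simp only
  rw [← Finset.sum_mul]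
  gcongr
  refine le_trans (le_of_eq ?_) (ENNReal.ofReal_le_ofReal (hB ξ))
  rw [ENNReal.ofReal_sum_of_nonneg fun i _ => sq_nonneg _]
  refine Finset.sum_congr rfl fun i _ => ?_
  rw [ENNReal.ofReal_pow (norm_nonneg _), ofReal_norm]

/-! ### The scale of polynomials on the sphere -/

section SphereScale

variable {n : ℕ}

/-- The radial projection to the sphere, with value `θ₀` at the origin. -/
def sphereProj (θ₀ : USphere n) (ξ : Eucl n) : USphere n :=
  open Classical in
  ⟨if ξ = 0 then (θ₀ : Eucl n) else ‖ξ‖⁻¹ • ξ, by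
    split_ifs with h
    · exact θ₀.2
    · simp [norm_smul, norm_ne_zero_iff.2 h]⟩

theorem sphereProj_of_ne (θ₀ : USphere n) {ξ : Eucl n} (h : ξ ≠ 0) :
    (sphereProj θ₀ ξ : Eucl n) = ‖ξ‖⁻¹ • ξ := if_neg h

theorem measurable_sphereProj (θ₀ : USphere n) : Measurable (sphereProj θ₀) := by
  refine Measurable.subtype_mk ?_
  exact Measurable.ite (measurableSet_singleton 0) measurable_const
    (measurable_norm.inv.smul measurable_id)

/-- In polar coordinates the preimage of a null set is, apart from the origin, a null set times the
half-line. Almost everywhere statements on the sphere thus pull back to `ℝⁿ`. -/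
theorem quasiMeasurePreserving_sphereProj (hn : 1 ≤ n) (θ₀ : USphere n) :
    Measure.QuasiMeasurePreserving (sphereProj θ₀) volume (surfaceMeasure n) := by
  have : Nonempty (Fin n) := ⟨⟨0, hn⟩⟩
  refine ⟨measurable_sphereProj θ₀, Measure.AbsolutelyContinuous.mk fun s hs h0 => ?_⟩
  rw [Measure.map_apply (measurable_sphereProj θ₀) hs]
  have hmp := Measure.measurePreserving_homeomorphUnitSphereProd (volume : Measure (Eucl n))
  have h1 : (volume.comap (Subtype.val : ({0}ᶜ : Set (Eucl n)) → Eucl n))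
      (homeomorphUnitSphereProd (Eucl n) ⁻¹' (s ×ˢ Set.univ)) = 0 := by
    refine hmp.quasiMeasurePreserving.preimage_null ?_
    rw [Measure.prod_prod, h0, zero_mul]
  rw [comap_subtype_coe_apply (measurableSet_singleton (0 : Eucl n)).compl] at h1
  refine measure_mono_null (t := {0} ∪ _) ?_ (measure_union_null (measure_singleton (0 : Eucl n)) h1)
  intro ξ hξ
  by_cases h : ξ = 0
  · exact Or.inl h
  · refine Or.inr ⟨⟨ξ, h⟩, ⟨?_, trivial⟩, rfl⟩
    have : (homeomorphUnitSphereProd (Eucl n) ⟨ξ, h⟩).1 = sphereProj θ₀ ξ :=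
      Subtype.ext (by
        rw [sphereProj_of_ne θ₀ h]; exact homeomorphUnitSphereProd_apply_fst_coe _ _)
    rw [this]; exact hξ

/-- Restrictions to the sphere of the polynomials of degree at most `2^l`; only `0` for `l < 0`. -/
def sphereLevel (n : ℕ) (l : ℤ) : Set (USphere n → ℂ) :=
  {g | ∃ h ∈ spherePoly n (2 ^ l.toNat), (0 ≤ l ∨ h = 0) ∧ g = h}

theorem spherePoly_mono : Monotone (spherePoly n) := by
  intro N N' h g hg
  obtain ⟨p, hp, rfl⟩ := mem_spherePoly.1 hg
  exact mem_spherePoly.2 ⟨p, hp.trans h, rfl⟩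

theorem sphereLevel_mono : Monotone (sphereLevel n) := by
  rintro l l' h g ⟨u, hu, hu0, rfl⟩
  refine ⟨u, spherePoly_mono (Nat.pow_le_pow_right two_pos (Int.toNat_le_toNat h)) hu, ?_, rfl⟩
  exact hu0.imp_left fun h0 => h0.trans h

theorem sphereLevel_mul {l : ℤ} {g h : USphere n → ℂ} (hg : g ∈ sphereLevel n l)
    (hh : h ∈ sphereLevel n l) : (fun θ => g θ * h θ) ∈ sphereLevel n (l + 1) := by
  obtain ⟨u, hu, hu0, rfl⟩ := hg
  obtain ⟨v, hv, -, rfl⟩ := hh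
  rcases hu0 with hl | rfl
  · obtain ⟨p, hp, rfl⟩ := mem_spherePoly.1 hu
    obtain ⟨q, hq, rfl⟩ := mem_spherePoly.1 hv
    refine ⟨restrictSphere n (p * q), mem_spherePoly.2 ⟨p * q, ?_, rfl⟩, Or.inl (by omega), ?_⟩
    · rw [Int.toNat_add hl (by norm_num)]
      refine (MvPolynomial.totalDegree_mul _ _).trans ?_
      rw [pow_add]; simp only [Int.toNat_one, pow_one]; omega
    · ext θ; simp [restrictSphere_apply]
  · exact ⟨0, Submodule.zero_mem _, Or.inr rfl, by ext; simp⟩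

/-- The constant in the Bernstein inequality on the sphere. -/
def sphereConst (n : ℕ) : ℝ≥0 := Real.toNNReal (Real.sqrt (2 ^ n / (surfaceMeasure n).real Set.univ))

theorem surfaceMeasure_real_pos (hn : 1 ≤ n) : 0 < (surfaceMeasure n).real Set.univ := by
  have : Nonempty (Fin n) := ⟨⟨0, hn⟩⟩
  have : NeZero (surfaceMeasure n) := ⟨Measure.toSphere_ne_zero _⟩
  exact measureReal_univ_pos

theorem sphereConst_pos (hn : 1 ≤ n) : 0 < (sphereConst n : ℝ) := by
  have := surfaceMeasure_real_pos hn
  rw [sphereConst, Real.coe_toNNReal _ (Real.sqrt_nonneg _)]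
  positivity

/-- Invariance gives `∑ |e i|²` as dimension over total measure, and the dimension is at most `2^n
2^{l(n-1)}`; the exponent `s` is half the growth rate. -/
theorem exists_spherePoly_frame (hn : 1 ≤ n) {s : ℝ} (hs : s = (n - 1) / 2) {l : ℤ} (hl : 0 ≤ l) :
    ∃ (d : ℕ) (e : Fin d → C(USphere n, ℂ)),
      (∀ g ∈ spherePoly n (2 ^ l.toNat), ∃ c : Fin d → ℂ, g = ∑ i, c i • e i ∧
        ∑ i, ‖c i‖ ^ 2 = ‖ContinuousMap.toLp (E := ℂ) 2 (surfaceMeasure n) ℂ g‖ ^ 2) ∧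
      ∀ θ, ∑ i, ‖e i θ‖ ^ 2 ≤ (sphereConst n * (2 : ℝ) ^ ((l : ℝ) * s)) ^ 2 := by
  have hpos := surfaceMeasure_real_pos hn
  obtain ⟨m, rfl⟩ := Nat.exists_eq_add_of_le' hn
  obtain ⟨e, he1, he2⟩ := exists_frame_of_invariant (spherePoly (m + 1) (2 ^ l.toNat))
    fun A g hg => spherePoly_rotate A hg
  refine ⟨_, e, he1, fun θ => ?_⟩
  obtain ⟨k, rfl⟩ := Int.eq_ofNat_of_zero_le hl
  have hd : (Module.finrank ℂ (spherePoly (m + 1) (2 ^ k)) : ℝ) ≤ 2 ^ (m + 1) * (2 ^ k) ^ m := by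
    have h1 := finrank_spherePoly_le m (2 ^ k)
    have h2 : 2 * (2 ^ k + 1) ^ m ≤ 2 ^ (m + 1) * (2 ^ k) ^ m := by
      rw [pow_succ', mul_assoc, ← mul_pow]
      have := Nat.one_le_two_pow (n := k)
      gcongr
      omega
    exact_mod_cast h1.trans h2
  have hw : ((2 : ℝ) ^ (((k : ℤ) : ℝ) * s)) ^ 2 = (2 ^ k) ^ m := by
    rw [hs, ← Real.rpow_natCast, ← Real.rpow_mul (by norm_num), ← pow_mul, ← Real.rpow_natCast]
    congr 1; push_cast; ring
  rw [mul_pow, hw, sphereConst, Real.coe_toNNReal _ (Real.sqrt_nonneg _),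
    Real.sq_sqrt (by positivity), div_mul_eq_mul_div, le_div_iff₀ hpos, he2 θ]
  exact hd

theorem norm_le_of_frame {d : ℕ} {c z : Fin d → ℂ} {N : ℝ} (hN : 0 ≤ N)
    (hc : ∑ i, ‖c i‖ ^ 2 = N ^ 2) : ‖∑ i, c i * z i‖ ≤ N * Real.sqrt (∑ i, ‖z i‖ ^ 2) := by
  calc ‖∑ i, c i * z i‖ ≤ ∑ i, ‖c i‖ * ‖z i‖ :=
        (norm_sum_le _ _).trans (Finset.sum_le_sum fun i _ => (norm_mul _ _).le)
    _ ≤ Real.sqrt (∑ i, ‖c i‖ ^ 2) * Real.sqrt (∑ i, ‖z i‖ ^ 2) := Real.sum_mul_le_sqrt_mul_sqrt _ _ _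
    _ = _ := by rw [hc, Real.sqrt_sq hN]

/-- Cauchy–Schwarz in the frame. For `s > 0` the weight tends to `0` as `l → -∞`, so constants could
not be admitted at all negative levels. -/
theorem sphereLevel_bernstein (hn : 1 ≤ n) {s : ℝ} (hs : s = (n - 1) / 2) {l : ℤ}
    {g : USphere n → ℂ} (hg : g ∈ sphereLevel n l) (θ : USphere n) :
    ‖g θ‖ₑ ≤ sphereConst n * (dyadicWeight s l * eLpNorm g 2 (surfaceMeasure n)) := by
  obtain ⟨u, hu, hl | rfl, rfl⟩ := hg
  · obtain ⟨d, e, he, hB⟩ := exists_spherePoly_frame hn hs hl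
    obtain ⟨c, hc, hc2⟩ := he u hu
    have h1 : u θ = ∑ i, c i * e i θ := by
      conv_lhs => rw [hc]
      simp [ContinuousMap.sum_apply]
    rw [eLpNorm_two_toLp, dyadicWeight, ← ENNReal.ofReal_coe_nnreal, ← ENNReal.ofReal_mul
      (by positivity), ← ENNReal.ofReal_mul (by positivity), ← ofReal_norm]
    refine ENNReal.ofReal_le_ofReal ?_
    rw [h1]
    refine (norm_le_of_frame (norm_nonneg _) hc2).trans ?_
    rw [mul_comm, ← mul_assoc]
    gcongr
    exact Real.sqrt_le_iff.2 ⟨by positivity, hB θ⟩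
  · simp

theorem continuous_pdo {σ : Eucl n → ℂ} (hσ : Measurable σ) {b : ℝ} (hb : ∀ ξ, ‖σ ξ‖ ≤ b)
    (f : SchwartzMap (Eucl n) ℂ) : Continuous (pdo (fun _ ξ => σ ξ) f) := by
  have h : Integrable (fun ξ => σ ξ * 𝓕 (f : Eucl n → ℂ) ξ) volume :=
    (integrable_fourier_schwartz f).bdd_mul hσ.aestronglyMeasurable (Filter.Eventually.of_forall hb)
  have e : pdo (fun _ ξ => σ ξ) f = fun y => 𝓕 (fun ξ => σ ξ * 𝓕 (f : Eucl n → ℂ) ξ) (-y) := by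
    rw [pdo_eq_fourierInv]
    ext y; rw [Real.fourierInv_eq_fourier_neg]
  rw [e]
  exact (continuous_fourier_of_integrable h).comp continuous_neg

theorem pdo_sum_mul {ι : Type*} [Fintype ι] (c : ι → ℂ) {e : ι → Eucl n → ℂ}
    (he : ∀ i, Measurable (e i)) (hb : ∀ i, ∃ b, ∀ ξ, ‖e i ξ‖ ≤ b) (f : SchwartzMap (Eucl n) ℂ)
    (x : Eucl n) :
    pdo (fun _ ξ => ∑ i, c i * e i ξ) f x = ∑ i, c i * pdo (fun _ ξ => e i ξ) f x := by
  have h1 : ∀ i, Integrable (pdoIntegrand (fun _ ξ => e i ξ) f x) volume := fun i => by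
    obtain ⟨b, hb⟩ := hb i
    exact integrable_pdoIntegrand_of_bound (σ := fun _ ξ => e i ξ) (he i).aestronglyMeasurable
      (Filter.Eventually.of_forall hb) f
  simp only [pdo]
  simp_rw [← integral_const_mul]
  rw [← integral_finsetSum _ fun i _ => (h1 i).const_mul _]
  refine integral_congr_ae (Filter.Eventually.of_forall fun ξ => ?_)
  simp only [pdoIntegrand, Finset.sum_mul, mul_assoc]

/-- Cauchy–Schwarz separates the coefficients of `g` from `f`. The dominant is the square function
of the frame, normalized by `b` so that Plancherel gives norm at most that of `f`. -/
theorem sphereLevel_dominated (hn : 1 ≤ n) (θ₀ : USphere n) {s : ℝ} (hs : s = (n - 1) / 2)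
    (f : SchwartzMap (Eucl n) ℂ) (l : ℤ) : ∃ M : Eucl n → ℝ≥0∞, AEMeasurable M volume ∧
      eLpNorm M 2 volume ≤ eLpNorm (f : Eucl n → ℂ) 2 volume ∧
      ∀ g ∈ sphereLevel n l, eLpNorm g 2 (surfaceMeasure n) < ⊤ → ∀ x,
        ‖pdo (fun _ ξ => g (sphereProj θ₀ ξ)) f x‖ₑ ≤
          sphereConst n * (dyadicWeight s l * eLpNorm g 2 (surfaceMeasure n)) * M x := by
  rcases lt_or_ge l 0 with hl | hl
  · refine ⟨0, aemeasurable_const, by simp, ?_⟩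
    rintro g ⟨u, hu, hl' | rfl, rfl⟩ - x
    · omega
    · simp [pdo, pdoIntegrand]
  obtain ⟨d, e, he, hB⟩ := exists_spherePoly_frame hn hs hl
  set b : ℝ := sphereConst n * (2 : ℝ) ^ ((l : ℝ) * s) with hb
  have hb0 : 0 < b := mul_pos (sphereConst_pos hn) (by positivity)
  set E : Fin d → Eucl n → ℂ := fun i ξ => e i (sphereProj θ₀ ξ) with hE
  have hEm : ∀ i, Measurable (E i) := fun i =>
    (e i).continuous.measurable.comp (measurable_sphereProj θ₀)
  have hEb : ∀ i, ∃ b, ∀ ξ, ‖E i ξ‖ ≤ b := fun i => ⟨‖e i‖, fun ξ => (e i).norm_coe_le_norm _⟩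
  have hcont : ∀ i, Continuous (pdo (fun _ ξ => E i ξ) f) := fun i =>
    (hEb i).elim fun _ h => continuous_pdo (hEm i) h f
  refine ⟨fun x => ENNReal.ofReal (Real.sqrt (∑ i, ‖pdo (fun _ ξ => E i ξ) f x‖ ^ 2) / b), ?_, ?_, ?_⟩
  · refine (ENNReal.continuous_ofReal.comp (Continuous.div_const (Real.continuous_sqrt.comp
      (continuous_finsetSum _ fun i _ => (hcont i).norm.pow 2)) _)).aemeasurable
  · have h1 := sum_lintegral_pdo_sq_le hEm (B := b ^ 2) (fun ξ => hB _) f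
    have hsq : ∀ x, ENNReal.ofReal (Real.sqrt (∑ i, ‖pdo (fun _ ξ => E i ξ) f x‖ ^ 2) / b) ^ 2 =
        ENNReal.ofReal (b ^ 2)⁻¹ * ∑ i, ‖pdo (fun _ ξ => E i ξ) f x‖ₑ ^ 2 := by
      intro x
      rw [← ENNReal.ofReal_pow (by positivity), div_pow, Real.sq_sqrt (by positivity), div_eq_inv_mul,
        ENNReal.ofReal_mul (by positivity), ENNReal.ofReal_sum_of_nonneg fun i _ => sq_nonneg _]
      simp_rw [ENNReal.ofReal_pow (norm_nonneg _), ofReal_norm]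
    rw [eLpNorm_eq_lintegral_rpow_enorm_toReal two_ne_zero ENNReal.ofNat_ne_top,
      eLpNorm_eq_lintegral_rpow_enorm_toReal two_ne_zero ENNReal.ofNat_ne_top]
    simp only [ENNReal.toReal_ofNat, ENNReal.rpow_ofNat, enorm_eq_self]
    gcongr ?_ ^ _
    simp_rw [hsq]
    rw [lintegral_const_mul' _ _ ENNReal.ofReal_ne_top,
      lintegral_finsetSum _ fun i _ => (hcont i).measurable.enorm.pow_const 2]
    refine (mul_le_mul_right h1 _).trans ?_
    rw [← mul_assoc, ← ENNReal.ofReal_mul (by positivity), inv_mul_cancel₀ (by positivity),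
      ENNReal.ofReal_one, one_mul]
  · rintro g ⟨u, hu, -, rfl⟩ - x
    obtain ⟨c, hc, hc2⟩ := he u hu
    have h1 : (fun (_ : Eucl n) ξ => u (sphereProj θ₀ ξ)) = fun _ ξ => ∑ i, c i * E i ξ := by
      ext _ ξ
      conv_lhs => rw [hc]
      simp [ContinuousMap.sum_apply, hE]
    rw [h1, pdo_sum_mul c hEm hEb, eLpNorm_two_toLp, dyadicWeight, ← ENNReal.ofReal_coe_nnreal,
      ← ENNReal.ofReal_mul (by positivity), ← ENNReal.ofReal_mul (by positivity),
      ← ENNReal.ofReal_mul (by positivity), ← ofReal_norm]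
    refine ENNReal.ofReal_le_ofReal ((norm_le_of_frame (norm_nonneg _) hc2).trans (le_of_eq ?_))
    rw [← mul_assoc, ← hb]
    field_simp

theorem sphereLevel_scale (hn : 1 ≤ n) (θ₀ : USphere n) {s : ℝ} (hs : s = (n - 1) / 2) :
    SymbolScale (surfaceMeasure n) (sphereProj θ₀) 2 2 s (sphereLevel n) (sphereConst n) where
  quasiMeasurePreserving := quasiMeasurePreserving_sphereProj hn θ₀
  mono := sphereLevel_mono
  mul_mem := sphereLevel_mul
  measurable := by
    rintro l g ⟨u, -, -, rfl⟩
    exact u.continuous.measurable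
  bernstein := sphereLevel_bernstein hn hs
  dominated := sphereLevel_dominated hn θ₀ hs

/-- The Nikolskii inequality on the sphere. -/
theorem sphereLevel_eLpNorm_two_le (hn : 1 ≤ n) {s : ℝ} (hs : s = (n - 1) / 2) {l : ℤ}
    {g : USphere n → ℂ} (hg : g ∈ sphereLevel n l) :
    eLpNorm g 2 (surfaceMeasure n) ≤
      sphereConst n * (dyadicWeight s l * eLpNorm g 1 (surfaceMeasure n)) := by
  set N := eLpNorm g 2 (surfaceMeasure n) with hN
  have hsq : N ^ 2 = ∫⁻ θ, ‖g θ‖ₑ ^ 2 ∂(surfaceMeasure n) := by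
    rw [hN, eLpNorm_eq_lintegral_rpow_enorm_toReal two_ne_zero ENNReal.ofNat_ne_top,
      ← ENNReal.rpow_natCast, ← ENNReal.rpow_mul]
    simp
  have hfin : N ≠ ⊤ := by
    obtain ⟨u, -, -, rfl⟩ := hg
    rw [hN, eLpNorm_two_toLp]; exact ENNReal.ofReal_ne_top
  -- `‖g‖_2² ≤ ‖g‖_∞ ‖g‖_1` with Bernstein for the sup norm; one factor `N`, finite and nonzero, is
  -- then cancelled.
  have h1 : N ^ 2 ≤ sphereConst n * (dyadicWeight s l * N) * eLpNorm g 1 (surfaceMeasure n) := by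
    rw [hsq, eLpNorm_one_eq_lintegral_enorm, ← lintegral_const_mul' _ _
      (ENNReal.mul_ne_top ENNReal.coe_ne_top (ENNReal.mul_ne_top (dyadicWeight_ne_top s l) hfin))]
    refine lintegral_mono fun θ => ?_
    simp only [pow_two]
    gcongr
    exact sphereLevel_bernstein hn hs hg θ
  rcases eq_or_ne N 0 with h0 | h0
  · rw [h0]; exact zero_le
  · rw [pow_two] at h1
    have h2 : N * N ≤ N * (sphereConst n * (dyadicWeight s l * eLpNorm g 1 (surfaceMeasure n))) :=
      h1.trans (le_of_eq (by ring))
    exact (ENNReal.mul_le_mul_iff_right h0 hfin).1 h2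

end SphereScale

/-! ### The spherical harmonics expansion -/

section HarmonicExpansion

variable {n : ℕ}

theorem integrable_mul_continuousMap {g : USphere n → ℂ} (hg : Integrable g (surfaceMeasure n))
    (φ : C(USphere n, ℂ)) : Integrable (fun θ => g θ * φ θ) (surfaceMeasure n) :=
  hg.mul_bdd (c := ‖φ‖) φ.continuous.aestronglyMeasurable
    (Filter.Eventually.of_forall φ.norm_coe_le_norm)

theorem integrable_continuousMap (φ : C(USphere n, ℂ)) : Integrable φ (surfaceMeasure n) :=
  φ.continuous.integrable_of_hasCompactSupport (HasCompactSupport.of_compactSpace _)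

/-- Harmonic polynomials forming an orthonormal basis of the spherical harmonics of degree `k`. -/
theorem exists_harmonic_basis (n k : ℕ) : ∃ (d : ℕ) (p : Fin d → MvPolynomial (Fin n) ℂ),
    (∀ j, p j ∈ harmonicPoly n k) ∧
    (∀ g : USphere n → ℂ, harmonicComponent k g =ᵐ[surfaceMeasure n] fun θ =>
      ∑ j, (∫ η, g η * (starRingEnd ℂ) (restrictSphere n (p j) η) ∂(surfaceMeasure n)) *
        restrictSphere n (p j) θ) ∧
    ∀ Y ∈ harmonicPoly n k, ∀ θ, restrictSphere n Y θ =
      ∑ j, (∫ η, restrictSphere n (p j) η * restrictSphere n Y η ∂(surfaceMeasure n)) *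
        (starRingEnd ℂ) (restrictSphere n (p j) θ) := by
  set b := stdOrthonormalBasis ℂ (sphericalHarmonics n k) with hb
  set T := (ContinuousMap.toLp (E := ℂ) 2 (surfaceMeasure n) ℂ).toLinearMap with hT
  have hTinj : Function.Injective T := ContinuousMap.toLp_injective _
  have hp : ∀ j, ∃ p ∈ harmonicPoly n k, T (restrictSphere n p) = b j := fun j => (b j).2
  choose p hpH hpT using hp
  have hae : ∀ j, ((b j : Lp ℂ 2 (surfaceMeasure n)) : USphere n → ℂ) =ᵐ[surfaceMeasure n]
      restrictSphere n (p j) := by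
    intro j
    rw [← hpT j]
    exact ContinuousMap.coeFn_toLp (surfaceMeasure n) _
  refine ⟨_, p, hpH, fun g => ?_, fun Y hY θ => ?_⟩
  · have hcb : ∀ j, ∫ η, g η * (starRingEnd ℂ) ((b j : Lp ℂ 2 (surfaceMeasure n)) η)
        ∂(surfaceMeasure n) =
        ∫ η, g η * (starRingEnd ℂ) (restrictSphere n (p j) η) ∂(surfaceMeasure n) := by
      intro j
      refine integral_congr_ae ?_
      filter_upwards [hae j] with η hη
      rw [hη]
    filter_upwards [ae_all_iff.2 hae] with θ hθ
    refine Finset.sum_congr rfl fun j _ => ?_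
    rw [hcb, hθ]
  · set Y' := MvPolynomial.map (starRingEnd ℂ) Y with hY'
    let w : sphericalHarmonics n k := ⟨T (restrictSphere n Y'), Y', conj_mem_harmonicPoly hY, rfl⟩
    have hexp : restrictSphere n Y' = ∑ j, inner ℂ (b j) w • restrictSphere n (p j) := by
      refine hTinj ?_
      rw [map_sum]
      simp_rw [map_smul, hpT]
      refine (congrArg Subtype.val (b.sum_repr' w)).symm.trans ?_
      simp
    have hconj : ∀ θ, (starRingEnd ℂ) (restrictSphere n Y' θ) = restrictSphere n Y θ := by
      intro θ; rw [hY', restrictSphere_conj, Complex.conj_conj]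
    have hin : ∀ j, (starRingEnd ℂ) (inner ℂ (b j) w) =
        ∫ η, restrictSphere n (p j) η * restrictSphere n Y η ∂(surfaceMeasure n) := by
      intro j
      have h1 : inner ℂ (b j) w = inner ℂ (T (restrictSphere n (p j))) (T (restrictSphere n Y')) := by
        rw [hpT]; rfl
      have h2 := ContinuousMap.inner_toLp (𝕜 := ℂ) (surfaceMeasure n) (restrictSphere n (p j))
        (restrictSphere n Y')
      rw [h1, show inner ℂ (T (restrictSphere n (p j))) (T (restrictSphere n Y')) = _ from h2,
        ← integral_conj]
      refine integral_congr_ae (Filter.Eventually.of_forall fun θ => ?_)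
      simp only [map_mul, hconj, Complex.conj_conj]
      exact mul_comm _ _
    rw [← hconj, hexp, ContinuousMap.sum_apply, map_sum]
    refine Finset.sum_congr rfl fun j _ => ?_
    rw [← hin, ← map_mul]; rfl

/-- The component of degree `k` is a.e. a harmonic polynomial of degree `k` with the same moments. -/
theorem exists_harmonicComponent_eq {g : USphere n → ℂ} (hg : Integrable g (surfaceMeasure n))
    (k : ℕ) : ∃ Q ∈ harmonicPoly n k,
      harmonicComponent k g =ᵐ[surfaceMeasure n] restrictSphere n Q ∧
      ∀ Y ∈ harmonicPoly n k, ∫ θ, restrictSphere n Q θ * restrictSphere n Y θ ∂(surfaceMeasure n) =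
        ∫ θ, g θ * restrictSphere n Y θ ∂(surfaceMeasure n) := by
  obtain ⟨d, p, hpH, hcomp, hexp⟩ := exists_harmonic_basis n k
  set c := fun j => ∫ η, g η * (starRingEnd ℂ) (restrictSphere n (p j) η) ∂(surfaceMeasure n) with hc
  have hQ : ∀ θ, restrictSphere n (∑ j, c j • p j) θ = ∑ j, c j * restrictSphere n (p j) θ := by
    intro θ
    rw [map_sum, ContinuousMap.sum_apply]
    refine Finset.sum_congr rfl fun j _ => ?_
    rw [map_smul]; rfl
  refine ⟨∑ j, c j • p j, Submodule.sum_mem _ fun j _ => Submodule.smul_mem _ _ (hpH j),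
    (hcomp g).trans (Filter.Eventually.of_forall fun θ => (hQ θ).symm), fun Y hY => ?_⟩
  have hL : ∫ θ, restrictSphere n (∑ j, c j • p j) θ * restrictSphere n Y θ ∂(surfaceMeasure n) =
      ∑ j, c j * ∫ θ, restrictSphere n (p j) θ * restrictSphere n Y θ ∂(surfaceMeasure n) := by
    simp_rw [← integral_const_mul]
    rw [← integral_finsetSum _ fun j _ => (integrable_mul_continuousMap
      (integrable_continuousMap _) _).const_mul _]
    refine integral_congr_ae (Filter.Eventually.of_forall fun θ => ?_)
    simp only [hQ, Finset.sum_mul, mul_assoc]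
  set a := fun j => ∫ θ, restrictSphere n (p j) θ * restrictSphere n Y θ ∂(surfaceMeasure n) with ha
  have hR : ∫ θ, g θ * restrictSphere n Y θ ∂(surfaceMeasure n) = ∑ j, a j * c j := by
    have h1 : ∀ θ, g θ * restrictSphere n Y θ =
        ∑ j, a j * (g θ * (starRingEnd ℂ) (restrictSphere n (p j) θ)) := by
      intro θ
      rw [hexp Y hY θ, Finset.mul_sum]
      exact Finset.sum_congr rfl fun j _ => mul_left_comm _ _ _
    simp_rw [h1]
    have h2 : ∀ j, Integrable (fun θ => g θ * (starRingEnd ℂ) (restrictSphere n (p j) θ))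
        (surfaceMeasure n) := fun j => integrable_mul_continuousMap hg (star (restrictSphere n (p j)))
    rw [integral_finsetSum _ fun j _ => (h2 j).const_mul _]
    exact Finset.sum_congr rfl fun j _ => integral_const_mul _ _
  rw [hL, hR]
  exact Finset.sum_congr rfl fun j _ => mul_comm _ _

/-- Continuity adds the endpoint `2`, so that `P_m` involves only degrees strictly below `2^{m+1}`.
-/
theorem IsLPCutoff.eq_zero_of_two_le {χ : ℝ → ℝ} (hχ : IsLPCutoff χ) {t : ℝ} (ht : 2 ≤ t) :
    χ t = 0 := by
  have hcl : IsClosed {t | χ t = 0} := isClosed_eq hχ.smooth.continuous continuous_const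
  have hsub : closure (Set.Ioi 2) ⊆ {t | χ t = 0} := hcl.closure_subset_iff.2 fun t ht =>
    hχ.eq_zero t (lt_of_lt_of_le ht (le_abs_self t))
  rw [closure_Ioi] at hsub
  exact hsub ht

theorem lpBump_eq_zero_of_two_le {χ : ℝ → ℝ} (hχ : IsLPCutoff χ) {t : ℝ} (ht : 2 ≤ t) :
    lpBump χ t = 0 := by
  rw [lpBump, hχ.eq_zero_of_two_le ht, hχ.eq_zero_of_two_le (by rw [smul_eq_mul]; linarith),
    sub_zero]

theorem two_le_zpow_neg_mul {m : ℤ} {k : ℕ} (h : 2 ^ (m + 1).toNat ≤ k) :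
    2 ≤ (2 : ℝ) ^ (-m) * (k : ℝ) := by
  have h1 : (2 : ℝ) ^ (m + 1) ≤ k := by
    calc (2 : ℝ) ^ (m + 1) ≤ (2 : ℝ) ^ ((m + 1).toNat : ℤ) :=
          zpow_le_zpow_right₀ (by norm_num) (Int.self_le_toNat _)
      _ ≤ k := by rw [zpow_natCast]; exact_mod_cast h
  calc (2 : ℝ) = 2 ^ (-m) * 2 ^ (m + 1) := by
        rw [← zpow_add₀ (by norm_num)]; simp
    _ ≤ _ := by gcongr

theorem lpBump_zpow_eq_zero {χ : ℝ → ℝ} (hχ : IsLPCutoff χ) {m : ℤ} {k : ℕ}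
    (h : 2 ^ (m + 1).toNat ≤ k) : lpBump χ ((2 : ℝ) ^ (-m) * (k : ℝ)) = 0 :=
  lpBump_eq_zero_of_two_le hχ (two_le_zpow_neg_mul h)

theorem sphereLpProj_ae_eq {χ : ℝ → ℝ} (hχ : IsLPCutoff χ) {g : USphere n → ℂ}
    {Q : ℕ → MvPolynomial (Fin n) ℂ}
    (hQ : ∀ k, harmonicComponent k g =ᵐ[surfaceMeasure n] restrictSphere n (Q k)) (m : ℤ) :
    sphereLpProj χ m g =ᵐ[surfaceMeasure n] restrictSphere n
      (∑ k ∈ Finset.range (2 ^ (m + 1).toNat), (lpBump χ ((2 : ℝ) ^ (-m) * (k : ℝ)) : ℂ) • Q k) := by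
  filter_upwards [ae_all_iff.2 hQ] with θ hθ
  rw [sphereLpProj, tsum_eq_sum (s := Finset.range (2 ^ (m + 1).toNat)) fun k hk => ?_]
  · rw [map_sum, ContinuousMap.sum_apply]
    refine Finset.sum_congr rfl fun k _ => ?_
    rw [hθ, map_smul]; rfl
  · rw [Finset.mem_range, not_lt] at hk
    rw [lpBump_zpow_eq_zero hχ hk]; simp

/-- The pieces of the Littlewood–Paley decomposition on the sphere, with the mean in front. -/
def spherePiece (χ : ℝ → ℝ) (Q : ℕ → MvPolynomial (Fin n) ℂ) : ℕ → MvPolynomial (Fin n) ℂ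
  | 0 => Q 0
  | m + 1 => ∑ k ∈ Finset.range (2 ^ (m + 1)), (lpBump χ ((2 : ℝ) ^ (-(m : ℤ)) * (k : ℝ)) : ℂ) • Q k

/-- The index shift serves this bound: piece `m + 1` is `P_m` and fits in level `m + 1`. Negative
`m` contribute nothing, since the bump vanishes at `0` and at all arguments from `2` on. -/
theorem totalDegree_spherePiece_le {χ : ℝ → ℝ} {Q : ℕ → MvPolynomial (Fin n) ℂ}
    (hQ : ∀ k, Q k ∈ harmonicPoly n k) (i : ℕ) : (spherePiece χ Q i).totalDegree ≤ 2 ^ i := by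
  have hdeg : ∀ k, (Q k).totalDegree ≤ k := fun k => (mem_harmonicPoly.1 (hQ k)).1.totalDegree_le
  cases i with
  | zero => exact (hdeg 0).trans (by norm_num)
  | succ m =>
    refine MvPolynomial.totalDegree_finsetSum_le fun k hk => ?_
    exact (MvPolynomial.totalDegree_smul_le _ _).trans ((hdeg k).trans (Finset.mem_range.1 hk).le)

theorem sum_lpBump {χ : ℝ → ℝ} (k N : ℕ) :
    ∑ m ∈ Finset.range N, lpBump χ ((2 : ℝ) ^ (-(m : ℤ)) * (k : ℝ)) =
      χ (2 * ((2 : ℝ) ^ (-(N : ℤ)) * k)) - χ (2 * k) := by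
  induction N with
  | zero => simp
  | succ N ih =>
    rw [Finset.sum_range_succ, ih, lpBump, smul_eq_mul]
    have : 2 * ((2 : ℝ) ^ (-((N + 1 : ℕ) : ℤ)) * k) = (2 : ℝ) ^ (-(N : ℤ)) * k := by
      rw [← mul_assoc]
      congr 1
      rw [← zpow_one_add₀ (by norm_num)]
      congr 1; push_cast; ring
    rw [this]; ring

/-- The bumps telescope to `1` on every degree `k ≥ 1` and to `0` on degree `0`; the extra term
stands for the mean. -/
theorem tendsto_sum_lpBump {χ : ℝ → ℝ} (hχ : IsLPCutoff χ) (k : ℕ) :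
    Filter.Tendsto (fun N => (if k = 0 then 1 else 0) +
      ∑ m ∈ Finset.range N, lpBump χ ((2 : ℝ) ^ (-(m : ℤ)) * (k : ℝ))) Filter.atTop (nhds 1) := by
  simp_rw [sum_lpBump]
  rcases Nat.eq_zero_or_pos k with rfl | hk
  · simp
  · have h1 : χ (2 * k) = 0 := hχ.eq_zero_of_two_le (by
      have : (1 : ℝ) ≤ k := by exact_mod_cast hk
      linarith)
    rw [h1, if_neg hk.ne']
    refine tendsto_const_nhds.congr' ?_
    have h2 : Filter.Tendsto (fun N : ℕ => 2 * ((2 : ℝ) ^ (-(N : ℤ)) * k)) Filter.atTop (nhds 0) := by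
      have h3 := tendsto_pow_atTop_nhds_zero_of_lt_one (r := (1 / 2 : ℝ)) (by norm_num) (by norm_num)
      have h4 := (h3.mul_const (k : ℝ)).const_mul 2
      simpa [zpow_neg] using h4
    filter_upwards [h2.eventually (eventually_le_nhds zero_lt_one)] with N hN
    rw [hχ.eq_one _ (by rw [Real.norm_of_nonneg (by positivity)]; exact hN)]
    norm_num

end HarmonicExpansion

/-! ### Decomposition of symbols on the sphere -/

section SphereDecomp

variable {n : ℕ}

theorem nonempty_uSphere (hn : 1 ≤ n) : Nonempty (USphere n) :=
  ⟨⟨EuclideanSpace.single ⟨0, hn⟩ 1, by simp⟩⟩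

theorem integral_harmonic_mul {g : USphere n → ℂ} (hn : 1 ≤ n) {Q : ℕ → MvPolynomial (Fin n) ℂ}
    (hQ : ∀ k, Q k ∈ harmonicPoly n k)
    (hmom : ∀ k, ∀ Y ∈ harmonicPoly n k,
      ∫ θ, restrictSphere n (Q k) θ * restrictSphere n Y θ ∂(surfaceMeasure n) =
        ∫ θ, g θ * restrictSphere n Y θ ∂(surfaceMeasure n))
    (j : ℕ) {k : ℕ} {Y : MvPolynomial (Fin n) ℂ} (hY : Y ∈ harmonicPoly n k) :
    ∫ θ, restrictSphere n (Q j) θ * restrictSphere n Y θ ∂(surfaceMeasure n) =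
      if j = k then ∫ θ, g θ * restrictSphere n Y θ ∂(surfaceMeasure n) else 0 := by
  split_ifs with h
  · subst h; exact hmom _ Y hY
  · exact integral_sphere_harmonic_eq_zero hn h (hQ j) hY

theorem integral_spherePiece_mul {χ : ℝ → ℝ} (hχ : IsLPCutoff χ) {g : USphere n → ℂ} (hn : 1 ≤ n)
    {Q : ℕ → MvPolynomial (Fin n) ℂ} (hQ : ∀ k, Q k ∈ harmonicPoly n k)
    (hmom : ∀ k, ∀ Y ∈ harmonicPoly n k,
      ∫ θ, restrictSphere n (Q k) θ * restrictSphere n Y θ ∂(surfaceMeasure n) =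
        ∫ θ, g θ * restrictSphere n Y θ ∂(surfaceMeasure n))
    (m : ℕ) {k : ℕ} {Y : MvPolynomial (Fin n) ℂ} (hY : Y ∈ harmonicPoly n k) :
    ∫ θ, restrictSphere n (spherePiece χ Q (m + 1)) θ * restrictSphere n Y θ ∂(surfaceMeasure n) =
      (lpBump χ ((2 : ℝ) ^ (-(m : ℤ)) * (k : ℝ)) : ℂ) *
        ∫ θ, g θ * restrictSphere n Y θ ∂(surfaceMeasure n) := by
  have h1 : ∫ θ, restrictSphere n (spherePiece χ Q (m + 1)) θ * restrictSphere n Y θ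
      ∂(surfaceMeasure n) = ∑ j ∈ Finset.range (2 ^ (m + 1)),
        (lpBump χ ((2 : ℝ) ^ (-(m : ℤ)) * (j : ℝ)) : ℂ) *
          ∫ θ, restrictSphere n (Q j) θ * restrictSphere n Y θ ∂(surfaceMeasure n) := by
    simp_rw [← integral_const_mul]
    rw [← integral_finsetSum _ fun j _ => (integrable_mul_continuousMap
      (integrable_continuousMap _) _).const_mul _]
    refine integral_congr_ae (Filter.Eventually.of_forall fun θ => ?_)
    simp only [spherePiece, map_sum, map_smul, ContinuousMap.sum_apply, Finset.sum_mul]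
    refine Finset.sum_congr rfl fun j _ => ?_
    rw [← mul_assoc]; rfl
  rw [h1]
  simp_rw [integral_harmonic_mul hn hQ hmom _ hY]
  simp only [mul_ite, mul_zero, Finset.sum_ite_eq', Finset.mem_range]
  split_ifs with h
  · rfl
  · have h0 : lpBump χ ((2 : ℝ) ^ (-(m : ℤ)) * (k : ℝ)) = 0 :=
      lpBump_zpow_eq_zero hχ (m := m) (by
        rw [show ((m : ℤ) + 1).toNat = m + 1 by omega]; exact not_lt.1 h)
    rw [h0]; simp

/-- The uniformly convergent sum `S` is continuous. Orthogonality and telescoping show that `S` and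
`g` have the same moments against all harmonics, and completeness concludes. -/
theorem ae_hasSum_spherePiece {χ : ℝ → ℝ} (hχ : IsLPCutoff χ) {g : USphere n → ℂ} (hn : 1 ≤ n)
    (hg : Integrable g (surfaceMeasure n)) {Q : ℕ → MvPolynomial (Fin n) ℂ}
    (hQ : ∀ k, Q k ∈ harmonicPoly n k)
    (hmom : ∀ k, ∀ Y ∈ harmonicPoly n k,
      ∫ θ, restrictSphere n (Q k) θ * restrictSphere n Y θ ∂(surfaceMeasure n) =
        ∫ θ, g θ * restrictSphere n Y θ ∂(surfaceMeasure n))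
    {b : ℕ → ℝ} (hb : Summable b)
    (hbound : ∀ i θ, ‖restrictSphere n (spherePiece χ Q i) θ‖ ≤ b i) :
    ∀ᵐ θ ∂(surfaceMeasure n), HasSum (fun i => restrictSphere n (spherePiece χ Q i) θ) (g θ) := by
  set F : ℕ → C(USphere n, ℂ) := fun i => restrictSphere n (spherePiece χ Q i) with hF
  have hsum : ∀ θ, Summable fun i => F i θ := fun θ =>
    Summable.of_norm_bounded hb fun i => hbound i θ
  let S : C(USphere n, ℂ) := ⟨fun θ => ∑' i, F i θ,
    continuous_tsum (fun i => (F i).continuous) hb hbound⟩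
  have hS : (fun θ => g θ - S θ) =ᵐ[surfaceMeasure n] 0 := by
    refine ae_eq_zero_of_integral_mul_harmonic hn (hg.sub (integrable_continuousMap S))
      fun k Y hY => ?_
    set I := ∫ θ, g θ * restrictSphere n Y θ ∂(surfaceMeasure n) with hI
    have h1 : HasSum (fun i => ∫ θ, F i θ * restrictSphere n Y θ ∂(surfaceMeasure n))
        (∫ θ, S θ * restrictSphere n Y θ ∂(surfaceMeasure n)) := by
      refine hasSum_integral_of_dominated_convergence (fun i _ => b i * ‖restrictSphere n Y‖)
        (fun i => (integrable_mul_continuousMap (integrable_continuousMap _) _).1)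
        (fun i => Filter.Eventually.of_forall fun θ => ?_)
        (Filter.Eventually.of_forall fun θ => hb.mul_right _) (integrable_const _)
        (Filter.Eventually.of_forall fun θ => ?_)
      · rw [norm_mul]
        exact mul_le_mul (hbound i θ) (ContinuousMap.norm_coe_le_norm _ θ) (norm_nonneg _)
          ((norm_nonneg _).trans (hbound i θ))
      · exact (hsum θ).hasSum.mul_right _
    have h2 := (h1.tendsto_sum_nat.comp (Filter.tendsto_add_atTop_nat 1))
    have h3 : ∀ N, ∑ i ∈ Finset.range (N + 1),
        ∫ θ, F i θ * restrictSphere n Y θ ∂(surfaceMeasure n) =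
        (((if k = 0 then 1 else 0) +
          ∑ m ∈ Finset.range N, lpBump χ ((2 : ℝ) ^ (-(m : ℤ)) * (k : ℝ)) : ℝ) : ℂ) * I := by
      intro N
      rw [Finset.sum_range_succ']
      simp_rw [hF, integral_spherePiece_mul hχ hn hQ hmom _ hY]
      rw [← Finset.sum_mul, spherePiece, integral_harmonic_mul hn hQ hmom 0 hY, ← hI]
      push_cast
      rcases eq_or_ne k 0 with rfl | hk
      · simp [add_mul, add_comm]
      · simp [hk, hk.symm]
    have h4 : Filter.Tendsto (fun N => ∑ i ∈ Finset.range (N + 1),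
        ∫ θ, F i θ * restrictSphere n Y θ ∂(surfaceMeasure n)) Filter.atTop (nhds I) := by
      simp_rw [h3]
      have := ((Complex.continuous_ofReal.tendsto _).comp (tendsto_sum_lpBump hχ k)).mul_const I
      simpa using this
    have h5 := tendsto_nhds_unique h2 h4
    simp_rw [sub_mul]
    rw [integral_sub (integrable_mul_continuousMap hg _)
      (integrable_mul_continuousMap (integrable_continuousMap S) _), ← hI, h5, sub_self]
  filter_upwards [hS] with θ hθ
  have : g θ = S θ := sub_eq_zero.1 hθ
  rw [this]
  exact (hsum θ).hasSum

/-- A symbol on the sphere with finite Besov norm is a sum of localized pieces, provided the Besov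
norm controls the `L²` norms of the pieces. -/
theorem IsSphereSymbol.hasLocalizedDecomp (hn : 1 ≤ n) {χ : ℝ → ℝ} (hχ : IsLPCutoff χ) {s t : ℝ}
    (hs : s = (n - 1) / 2) (ht : 0 ≤ t) {q : ℝ≥0∞} {κ : ℝ≥0}
    (hκ : ∀ l, ∀ g ∈ sphereLevel n l, dyadicWeight s l * eLpNorm g 2 (surfaceMeasure n) ≤
      κ * (dyadicWeight t l * eLpNorm g q (surfaceMeasure n)))
    {μ : Eucl n → USphere n → ℂ} (hμ : IsSphereSymbol μ) (hfin : sphereBesov χ t q μ < ⊤) :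
    HasLocalizedDecomp (surfaceMeasure n) 2 s (sphereLevel n) μ
      ((κ * Real.toNNReal ((2 : ℝ) ^ t) : ℝ≥0) * sphereBesov χ t q μ) := by
  choose Q hQ hQae hmom using fun x => exists_harmonicComponent_eq (hμ.integrable x)
  set D : ℝ≥0 := Real.toNNReal ((2 : ℝ) ^ t) with hD
  have hD1 : (1 : ℝ≥0∞) ≤ D := by
    rw [hD, ← ENNReal.ofReal, ENNReal.one_le_ofReal]
    exact Real.one_le_rpow (by norm_num) ht
  set w : ℤ → ℝ≥0∞ := fun m => dyadicWeight t m *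
    ⨆ x, eLpNorm (sphereLpProj χ m (μ x)) q (surfaceMeasure n) with hw
  set w₀ : ℝ≥0∞ := ⨆ x, eLpNorm (harmonicComponent 0 (μ x)) q (surfaceMeasure n) with hw₀
  have hB : sphereBesov χ t q μ = w₀ + ∑' m, w m := rfl
  -- `D = 2^t` pays for moving `P_m` to level `m + 1`, and `κ` converts `L²` norms into `L^q` norms.
  let a : ℕ → ℝ≥0∞ := fun i => κ * (D * Nat.casesOn i w₀ fun m => w m)
  have hasum : ∑' i, a i ≤ (κ * D : ℝ≥0) * sphereBesov χ t q μ := by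
    rw [ENNReal.tsum_mul_left, ENNReal.tsum_mul_left, ENNReal.coe_mul, mul_assoc, hB,
      tsum_eq_zero_add' ENNReal.summable]
    exact mul_le_mul_right (mul_le_mul_right (add_le_add_right
      (ENNReal.tsum_comp_le_tsum_of_injective (f := fun m : ℕ => (m : ℤ)) Nat.cast_injective w) _) _) _
  have hafin : ∑' i, a i ≠ ⊤ :=
    (hasum.trans_lt (ENNReal.mul_lt_top ENNReal.coe_lt_top hfin)).ne
  have hmem : ∀ (i : ℕ) x, (restrictSphere n (spherePiece χ (Q x) i) : USphere n → ℂ) ∈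
      sphereLevel n i := fun i x =>
    ⟨_, mem_spherePoly.2 ⟨_, by simpa using totalDegree_spherePiece_le (hQ x) i, rfl⟩,
      Or.inl (Int.natCast_nonneg i), rfl⟩
  have hle : ∀ (i : ℕ) x, dyadicWeight s i * eLpNorm (restrictSphere n (spherePiece χ (Q x) i)) 2
      (surfaceMeasure n) ≤ a i := by
    intro i x
    refine (hκ i _ (hmem i x)).trans (mul_le_mul_right ?_ _)
    cases i with
    | zero =>
      rw [spherePiece, ← eLpNorm_congr_ae (hQae x 0)]
      have h0 : dyadicWeight t ((0 : ℕ) : ℤ) = 1 := by simp [dyadicWeight]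
      rw [h0]
      exact mul_le_mul' hD1 (le_iSup (fun x => eLpNorm (harmonicComponent 0 (μ x)) q _) x)
    | succ m =>
      have h1 := sphereLpProj_ae_eq hχ (hQae x) m
      rw [show ((m : ℤ) + 1).toNat = m + 1 by omega] at h1
      rw [spherePiece, ← eLpNorm_congr_ae h1, Nat.cast_succ, dyadicWeight_succ, mul_assoc]
      exact mul_le_mul_right (mul_le_mul_right
        (le_iSup (fun x => eLpNorm (sphereLpProj χ m (μ x)) q _) x) _) _
  obtain ⟨θ₀⟩ := nonempty_uSphere hn
  have hscale := sphereLevel_scale hn θ₀ hs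
  refine ⟨ℕ, inferInstance, fun i => i, a, fun i x => restrictSphere n (spherePiece χ (Q x) i),
    hmem, hle, hasum, fun x => ?_⟩
  exact ae_hasSum_spherePiece hχ hn (hμ.integrable x) (hQ x) (hmom x)
    (SymbolScale.summable_bound hafin (sphereConst n)) fun i θ =>
      hscale.norm_le (hmem i x) (hle i x) (ENNReal.ne_top_of_tsum_ne_top hafin i) θ

theorem homogeneousSymbol_ae_eq (hn : 1 ≤ n) (θ₀ : USphere n) (μ : Eucl n → USphere n → ℂ)
    (x : Eucl n) : ∀ᵐ ξ, μ x (sphereProj θ₀ ξ) = homogeneousSymbol μ x ξ := by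
  have : Nonempty (Fin n) := ⟨⟨0, hn⟩⟩
  filter_upwards [Measure.ae_ne volume (0 : Eucl n)] with ξ hξ
  rw [homogeneousSymbol, dif_neg hξ]
  congr 1
  exact Subtype.ext (sphereProj_of_ne θ₀ hξ)

/-- The hypothesis `hκ` covers both quantities at once: it is trivial for `q = 2`, `t = s`, and it
is the Nikolskii inequality for `q = 1`, `t = 2 s`. -/
theorem sphere_pdo_bounds (hn : 1 ≤ n) {χ : ℝ → ℝ} (hχ : IsLPCutoff χ) {s t : ℝ}
    (hs : s = (n - 1) / 2) (ht : 0 ≤ t) {q : ℝ≥0∞} {κ : ℝ≥0}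
    (hκ : ∀ l, ∀ g ∈ sphereLevel n l, dyadicWeight s l * eLpNorm g 2 (surfaceMeasure n) ≤
      κ * (dyadicWeight t l * eLpNorm g q (surfaceMeasure n))) :
    ∃ K : ℝ≥0,
      (∀ μ₁ μ₂ : Eucl n → USphere n → ℂ, IsSphereSymbol μ₁ → IsSphereSymbol μ₂ →
        sphereBesov χ t q μ₁ < ⊤ → sphereBesov χ t q μ₂ < ⊤ →
        PdoNormLE (homogeneousSymbol (fun x θ => μ₁ x θ * μ₂ x θ)) 2
          (K * (sphereBesov χ t q μ₁ * sphereBesov χ t q μ₂))) ∧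
      (∀ μ : Eucl n → USphere n → ℂ, IsSphereSymbol μ → sphereBesov χ t q μ < ⊤ →
        PdoNormLE (homogeneousSymbol (fun x θ => Complex.exp (μ x θ))) 2
          (ENNReal.ofReal (Real.exp (K * (sphereBesov χ t q μ).toReal)))) := by
  set c : ℝ≥0 := κ * Real.toNNReal ((2 : ℝ) ^ t)
  set C := sphereConst n
  obtain ⟨θ₀⟩ := nonempty_uSphere hn
  have hscale := sphereLevel_scale hn θ₀ hs
  refine ⟨max (C * (SymbolScale.prodConst s C * (c * c))) (SymbolScale.expConst s C * c),
    fun μ₁ μ₂ h1 h2 hf1 hf2 => ?_, fun μ h hf => ?_⟩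
  · refine ((hscale.pdoNormLE_mul one_le_two ENNReal.ofNat_ne_top h1.measurable h2.measurable
      (h1.hasLocalizedDecomp hn hχ hs ht hκ hf1) (h2.hasLocalizedDecomp hn hχ hs ht hκ hf2)
      hf1.ne hf2.ne).mono ?_).congr_ae (homogeneousSymbol_ae_eq hn θ₀ fun x θ => μ₁ x θ * μ₂ x θ)
    gcongr
    exact le_max_left _ _
  · refine ((hscale.pdoNormLE_exp one_le_two ENNReal.ofNat_ne_top h.measurable
      (h.hasLocalizedDecomp hn hχ hs ht hκ hf) hf.ne).mono (ENNReal.ofReal_le_ofReal ?_)).congr_ae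
      (homogeneousSymbol_ae_eq hn θ₀ fun x θ => Complex.exp (μ x θ))
    gcongr
    exact le_max_right _ _

end SphereDecomp

end

/-! ### The main theorem. -/

theorem mainTheorem9 (n : ℕ) (hn : 1 ≤ n) :
    (∀ χ : Eucl n → ℝ, IsLPCutoff χ → ∃ C : ℝ, 0 < C ∧
      -- products, `L²`
      (∀ σ₁ σ₂ : Eucl n → Eucl n → ℂ, IsSymbol σ₁ → IsSymbol σ₂ →
        symbolBesov χ (n / 2) 2 σ₁ < ⊤ → symbolBesov χ (n / 2) 2 σ₂ < ⊤ →
        PdoNormLE (fun x ξ => σ₁ x ξ * σ₂ x ξ) 2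
          (ENNReal.ofReal C * (symbolBesov χ (n / 2) 2 σ₁ * symbolBesov χ (n / 2) 2 σ₂))) ∧
      -- products, `L^p`
      (∀ σ₁ σ₂ : Eucl n → Eucl n → ℂ, IsSymbol σ₁ → IsSymbol σ₂ →
        symbolBesov χ n 1 σ₁ < ⊤ → symbolBesov χ n 1 σ₂ < ⊤ →
        ∀ p : ENNReal, 1 < p → p < ⊤ →
        PdoNormLE (fun x ξ => σ₁ x ξ * σ₂ x ξ) p
          (ENNReal.ofReal C * (symbolBesov χ n 1 σ₁ * symbolBesov χ n 1 σ₂))) ∧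
      -- exponentials, `L²`
      (∀ σ : Eucl n → Eucl n → ℂ, IsSymbol σ → symbolBesov χ (n / 2) 2 σ < ⊤ →
        PdoNormLE (fun x ξ => Complex.exp (σ x ξ)) 2
          (ENNReal.ofReal (C * Real.exp (C * (symbolBesov χ (n / 2) 2 σ).toReal)))) ∧
      -- exponentials, `L^p`
      (∀ σ : Eucl n → Eucl n → ℂ, IsSymbol σ → symbolBesov χ n 1 σ < ⊤ →
        ∀ p : ENNReal, 1 < p → p < ⊤ →
        PdoNormLE (fun x ξ => Complex.exp (σ x ξ)) p
          (ENNReal.ofReal (C * Real.exp (C * (symbolBesov χ n 1 σ).toReal))))) ∧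
    (∀ χ : ℝ → ℝ, IsLPCutoff χ → ∃ C : ℝ, 0 < C ∧
      -- products of homogeneous symbols
      (∀ μ₁ μ₂ : Eucl n → USphere n → ℂ, IsSphereSymbol μ₁ → IsSphereSymbol μ₂ →
        sphereBesov χ ((n - 1) / 2) 2 μ₁ < ⊤ → sphereBesov χ ((n - 1) / 2) 2 μ₂ < ⊤ →
        PdoNormLE (homogeneousSymbol (fun x θ => μ₁ x θ * μ₂ x θ)) 2
          (ENNReal.ofReal C *
            (sphereBesov χ ((n - 1) / 2) 2 μ₁ * sphereBesov χ ((n - 1) / 2) 2 μ₂))) ∧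
      -- exponentials of homogeneous symbols, with the `L²(S^{n-1})` quantity
      (∀ μ : Eucl n → USphere n → ℂ, IsSphereSymbol μ →
        sphereBesov χ ((n - 1) / 2) 2 μ < ⊤ →
        PdoNormLE (homogeneousSymbol (fun x θ => Complex.exp (μ x θ))) 2
          (ENNReal.ofReal (C * Real.exp (C * (sphereBesov χ ((n - 1) / 2) 2 μ).toReal)))) ∧
      -- exponentials of homogeneous symbols, with the `L¹(S^{n-1})` quantity
      (∀ μ : Eucl n → USphere n → ℂ, IsSphereSymbol μ →
        sphereBesov χ (n - 1) 1 μ < ⊤ →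
        PdoNormLE (homogeneousSymbol (fun x θ => Complex.exp (μ x θ))) 2
          (ENNReal.ofReal (C * Real.exp (C * (sphereBesov χ (n - 1) 1 μ).toReal))))) := by
  refine ⟨fun χ hχ => ?_, fun χ hχ => ?_⟩
  · obtain ⟨K₂, h₂⟩ := euclidean_pdo_bounds hn hχ (q := 2) (Or.inr rfl) (s := n / 2) (by simp)
    obtain ⟨K₁, h₁⟩ := euclidean_pdo_bounds hn hχ (q := 1) (Or.inl rfl) (s := n) (by simp)
    obtain ⟨hm₂, he₂⟩ := h₂ 2 le_rfl ENNReal.ofNat_ne_top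
    -- The lower bound `1` makes the constant positive and lets it stand in front of the exponential
    -- as well.
    have hC₁ : (1 : ℝ) ≤ max 1 (max K₁ K₂ : ℝ) := le_max_left _ _
    have hK₁ : (K₁ : ℝ) ≤ max 1 (max K₁ K₂ : ℝ) := (le_max_left _ _).trans (le_max_right _ _)
    have hK₂ : (K₂ : ℝ) ≤ max 1 (max K₁ K₂ : ℝ) := (le_max_right _ _).trans (le_max_right _ _)
    refine ⟨max 1 (max K₁ K₂), by positivity, fun σ₁ σ₂ hσ₁ hσ₂ hf₁ hf₂ => ?_,
      fun σ₁ σ₂ hσ₁ hσ₂ hf₁ hf₂ p hp hp' => ?_, fun σ hσ hf => ?_, fun σ hσ hf p hp hp' => ?_⟩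
    · exact (hm₂ σ₁ σ₂ hσ₁ hσ₂ hf₁ hf₂).mono (mul_le_mul_left (le_ofReal_coe_of_le hK₂) _)
    · exact ((h₁ p hp.le hp'.ne).1 σ₁ σ₂ hσ₁ hσ₂ hf₁ hf₂).mono
        (mul_le_mul_left (le_ofReal_coe_of_le hK₁) _)
    · exact (he₂ σ hσ hf).mono (ofReal_exp_le hK₂ hC₁ ENNReal.toReal_nonneg)
    · exact ((h₁ p hp.le hp'.ne).2 σ hσ hf).mono (ofReal_exp_le hK₁ hC₁ ENNReal.toReal_nonneg)
  · have hn' : (1 : ℝ) ≤ n := by exact_mod_cast hn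
    obtain ⟨K₂, hm₂, he₂⟩ := sphere_pdo_bounds hn hχ (s := (n - 1) / 2) (t := (n - 1) / 2) (q := 2)
      (κ := 1) rfl (by linarith) fun l g _ => by simp
    obtain ⟨K₁, -, he₁⟩ := sphere_pdo_bounds hn hχ (s := (n - 1) / 2) (t := n - 1) (q := 1)
      (κ := sphereConst n) rfl (by linarith) fun l g hg => by
        refine (mul_le_mul_right (sphereLevel_eLpNorm_two_le hn rfl hg) _).trans (le_of_eq ?_)
        -- Nikolskii costs a second factor `2^{l(n-1)/2}`, which accounts for the exponent `n - 1`
        -- of the `L¹` quantity.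
        have hw : dyadicWeight ((n : ℝ) - 1) l =
            dyadicWeight (((n : ℝ) - 1) / 2) l * dyadicWeight (((n : ℝ) - 1) / 2) l := by
          rw [dyadicWeight, dyadicWeight, ← ENNReal.ofReal_mul (by positivity),
            ← Real.rpow_add (by norm_num)]
          congr 2; ring
        rw [hw]; ring
    have hC₁ : (1 : ℝ) ≤ max 1 (max K₁ K₂ : ℝ) := le_max_left _ _
    have hK₁ : (K₁ : ℝ) ≤ max 1 (max K₁ K₂ : ℝ) := (le_max_left _ _).trans (le_max_right _ _)
    have hK₂ : (K₂ : ℝ) ≤ max 1 (max K₁ K₂ : ℝ) := (le_max_right _ _).trans (le_max_right _ _)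
    refine ⟨max 1 (max K₁ K₂), by positivity, fun μ₁ μ₂ hμ₁ hμ₂ hf₁ hf₂ => ?_,
      fun μ hμ hf => ?_, fun μ hμ hf => ?_⟩
    · exact (hm₂ μ₁ μ₂ hμ₁ hμ₂ hf₁ hf₂).mono (mul_le_mul_left (le_ofReal_coe_of_le hK₂) _)
    · exact (he₂ μ hμ hf).mono (ofReal_exp_le hK₂ hC₁ ENNReal.toReal_nonneg)
    · exact (he₁ μ hμ hf).mono (ofReal_exp_le hK₁ hC₁ ENNReal.toReal_nonneg)
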